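/- **Conventions.** For a non-vertical line $\ell: y=ax+c$ let $\ell^+$ and $\ell^-$ be the closed halfplanes above and below $\ell$. For non-vertical lines $\ell_1,\ell_2$ with the slope of $\ell_1$ smaller than that of $\ell_2$, put $\mathrm{East}(\ell_1,\ell_2)=\ell_1^+\cap\ell_2^-$ and $\mathrm{West}(\ell_1,\ell_2)=\ell_1^-\cap\ell_2^+$; these regions are called East and West wedges. If $\ell_1,\ell_2$ are parallel with $\ell_1$ below $\ell_2$, the strip $\mathrm{East}(\ell_1,\ell_2)=\ell_1^+\cap\ell_2^-$ is by convention also counted as an East wedge. For a finite set $R\subset\mathbb{R}^2$ of red points, the red outliers of a region $W$ are the points of $R$ in the interior of $W$. The model of computation is the real RAM: a fixed finite program with integer constants works on arrays of real numbers and arrays of words of $O(\log n)$ bits, with indirect addressing; each arithmetic operation $+,-,\times,/$ (exact on reals; truncated subtraction and rounded-down division on words), comparison and memory access costs one unit of time, and reals cannot be converted to words (no floor function). **Theorem.** There is a real RAM program that, for all $n\ge 2$ and all sets $B$ (blue) and $R$ (red) of at most $n$ points each in $\mathbb{R}^2$ such that the points of $B$ and $R$ together are in general position (all the points have pairwise distinct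 $x$-coordinates, in particular $B\cap R=\emptyset$, and no three of them are collinear), given as arrays of coordinates in any order, constructs in $O(n\log n)$ time two lines $\ell_1,\ell_2$, with the slope of $\ell_1$ smaller than that of $\ell_2$, and a choice of $W=\mathrm{East}(\ell_1,\ell_2)$ or $W=\mathrm{West}(\ell_1,\ell_2)$, such that $B\subset W$ and $W$ has the fewest red outliers among all East and West wedges (strips included) that contain $B$. -/

import Mathlib

/-! ## Computation model: a real RAM

The memory consists of arrays of machine words (natural numbers) and arrays of real numbers, with
indirect addressing by words. A program is a finite piece of syntax over integer literals,
so one and the same program serves inputs of all sizes. Every operation on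
words or on reals, every memory access and every comparison costs one unit. There is no way to turn
a real into a word (no floor function), and words are bounded by a parameter `M`; a program that
overflows a word or divides by zero gets stuck. -/

namespace RealRAM

/-- Memory: cell `i` of word array `a` is `word a i`, cell `i` of real array `a` is `real a i`. -/
structure State where
  word : ℕ → ℕ → ℕ
  real : ℕ → ℕ → ℝ

/-- Write the word `v` into cell `i` of word array `a`. -/
def State.setWord (s : State) (a i v : ℕ) : State :=
  { s with word := Function.update s.word a (Function.update (s.word a) i v) }

/-- Write the real `v` into cell `i` of real array `a`. -/
noncomputable def State.setReal (s : State) (a i : ℕ) (v : ℝ) : State :=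
  { s with real := Function.update s.real a (Function.update (s.real a) i v) }

/-- Word expressions. Subtraction is truncated, division rounds down. -/
inductive WExpr where
  | lit (c : ℕ)
  | read (a : ℕ) (i : WExpr)
  | add (e f : WExpr)
  | sub (e f : WExpr)
  | mul (e f : WExpr)
  | div (e f : WExpr)

namespace WExpr

/-- The value of a word expression. -/
def eval (s : State) : WExpr → ℕ
  | lit c => c
  | read a i => s.word a (i.eval s)
  | add e f => e.eval s + f.eval s
  | sub e f => e.eval s - f.eval s
  | mul e f => e.eval s * f.eval s
  | div e f => e.eval s / f.eval s

/-- No literal or intermediate result reaches the word bound `M`, and no divisor is zero. -/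
def Safe (M : ℕ) (s : State) : WExpr → Prop
  | lit c => c < M
  | read _ i => i.Safe M s
  | add e f => e.Safe M s ∧ f.Safe M s ∧ e.eval s + f.eval s < M
  | sub e f => e.Safe M s ∧ f.Safe M s
  | mul e f => e.Safe M s ∧ f.Safe M s ∧ e.eval s * f.eval s < M
  | div e f => e.Safe M s ∧ f.Safe M s ∧ f.eval s ≠ 0

/-- The number of operations performed by the evaluation of a word expression. -/
def cost : WExpr → ℕ
  | lit _ => 1
  | read _ i => i.cost + 1
  | add e f => e.cost + f.cost + 1
  | sub e f => e.cost + f.cost + 1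
  | mul e f => e.cost + f.cost + 1
  | div e f => e.cost + f.cost + 1

end WExpr

/-- Real expressions. The only constants are integers. -/
inductive RExpr where
  | lit (c : ℤ)
  | read (a : ℕ) (i : WExpr)
  | add (e f : RExpr)
  | sub (e f : RExpr)
  | mul (e f : RExpr)
  | div (e f : RExpr)

namespace RExpr

/-- The value of a real expression, in exact arithmetic. -/
noncomputable def eval (s : State) : RExpr → ℝ
  | lit c => (c : ℝ)
  | read a i => s.real a (i.eval s)
  | add e f => e.eval s + f.eval s
  | sub e f => e.eval s - f.eval s
  | mul e f => e.eval s * f.eval s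
  | div e f => e.eval s / f.eval s

/-- All addresses are safe words, and no divisor is zero. -/
def Safe (M : ℕ) (s : State) : RExpr → Prop
  | lit _ => True
  | read _ i => i.Safe M s
  | add e f => e.Safe M s ∧ f.Safe M s
  | sub e f => e.Safe M s ∧ f.Safe M s
  | mul e f => e.Safe M s ∧ f.Safe M s
  | div e f => e.Safe M s ∧ f.Safe M s ∧ f.eval s ≠ 0

/-- The number of operations performed by the evaluation of a real expression. -/
def cost : RExpr → ℕ
  | lit _ => 1
  | read _ i => i.cost + 1
  | add e f => e.cost + f.cost + 1
  | sub e f => e.cost + f.cost + 1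
  | mul e f => e.cost + f.cost + 1
  | div e f => e.cost + f.cost + 1

end RExpr

/-- Tests: comparisons of words or of reals, and their Boolean combinations. -/
inductive Test where
  | wlt (e f : WExpr)
  | rlt (e f : RExpr)
  | not (b : Test)
  | and (b c : Test)

namespace Test

/-- The truth of a test. -/
def Holds (s : State) : Test → Prop
  | wlt e f => e.eval s < f.eval s
  | rlt e f => e.eval s < f.eval s
  | not b => ¬ b.Holds s
  | and b c => b.Holds s ∧ c.Holds s

/-- All expressions in the test are safe. -/
def Safe (M : ℕ) (s : State) : Test → Prop
  | wlt e f => e.Safe M s ∧ f.Safe M s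
  | rlt e f => e.Safe M s ∧ f.Safe M s
  | not b => b.Safe M s
  | and b c => b.Safe M s ∧ c.Safe M s

/-- The number of operations performed by a test. -/
def cost : Test → ℕ
  | wlt e f => e.cost + f.cost + 1
  | rlt e f => e.cost + f.cost + 1
  | not b => b.cost + 1
  | and b c => b.cost + c.cost + 1

end Test

/-- Programs: assignments to memory cells, composition, branching and while loops. -/
inductive Prog where
  | skip
  | setWord (a : ℕ) (i e : WExpr)
  | setReal (a : ℕ) (i : WExpr) (e : RExpr)
  | seq (p q : Prog)
  | branch (b : Test) (p q : Prog)
  | loop (b : Test) (p : Prog)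

/-- `Runs M p s t s'`: with words bounded by `M`, the program `p` started in memory `s` halts after
exactly `t` units of time, without getting stuck, and leaves the memory `s'`. -/
inductive Runs (M : ℕ) : Prog → State → ℕ → State → Prop where
  | skip (s : State) : Runs M .skip s 1 s
  | setWord (s : State) (a : ℕ) (i e : WExpr) (hi : i.Safe M s) (he : e.Safe M s) :
      Runs M (.setWord a i e) s (i.cost + e.cost + 1) (s.setWord a (i.eval s) (e.eval s))
  | setReal (s : State) (a : ℕ) (i : WExpr) (e : RExpr) (hi : i.Safe M s) (he : e.Safe M s) :
      Runs M (.setReal a i e) s (i.cost + e.cost + 1) (s.setReal a (i.eval s) (e.eval s))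
  | seq {p q : Prog} {s s' s'' : State} {t t' : ℕ} (hp : Runs M p s t s')
      (hq : Runs M q s' t' s'') : Runs M (.seq p q) s (t + t') s''
  | branchTrue {b : Test} {p q : Prog} {s s' : State} {t : ℕ} (hs : b.Safe M s)
      (hb : b.Holds s) (hp : Runs M p s t s') : Runs M (.branch b p q) s (b.cost + t + 1) s'
  | branchFalse {b : Test} {p q : Prog} {s s' : State} {t : ℕ} (hs : b.Safe M s)
      (hb : ¬ b.Holds s) (hq : Runs M q s t s') : Runs M (.branch b p q) s (b.cost + t + 1) s'
  | loopTrue {b : Test} {p : Prog} {s s' s'' : State} {t t' : ℕ} (hs : b.Safe M s)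
      (hb : b.Holds s) (hp : Runs M p s t s') (hl : Runs M (.loop b p) s' t' s'') :
      Runs M (.loop b p) s (b.cost + t + t' + 1) s''
  | loopFalse {b : Test} {p : Prog} {s : State} (hs : b.Safe M s) (hb : ¬ b.Holds s) :
      Runs M (.loop b p) s (b.cost + 1) s

end RealRAM

/-! ## Wedges in the plane -/

namespace TwoLines

/-- A non-vertical line `y = slope * x + intercept`. -/
structure Line where
  slope : ℝ
  intercept : ℝ

/-- The closed halfplane above a line. -/
def Line.upper (l : Line) : Set (ℝ × ℝ) := {p | l.slope * p.1 + l.intercept ≤ p.2}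

/-- The closed halfplane below a line. -/
def Line.lower (l : Line) : Set (ℝ × ℝ) := {p | p.2 ≤ l.slope * p.1 + l.intercept}

/-- The East region of a pair of lines, the first having the smaller slope. -/
def East (l₁ l₂ : Line) : Set (ℝ × ℝ) := l₁.upper ∩ l₂.lower

/-- The West region of a pair of lines, the first having the smaller slope. -/
def West (l₁ l₂ : Line) : Set (ℝ × ℝ) := l₁.lower ∩ l₂.upper

/-- East and West wedges. By convention the strip between two parallel lines, the first below
the second, counts as their East region. -/
def IsSideways (W : Set (ℝ × ℝ)) : Prop :=
  ∃ l₁ l₂ : Line,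
    (l₁.slope < l₂.slope ∧ (W = East l₁ l₂ ∨ W = West l₁ l₂)) ∨
    (l₁.slope = l₂.slope ∧ l₁.intercept < l₂.intercept ∧ W = East l₁ l₂)

/-- The number of red outliers of a region: the red points in its interior. -/
noncomputable def redOutliers (R W : Set (ℝ × ℝ)) : ℕ := (R ∩ interior W).ncard

/-- General position: the `x`-coordinates are pairwise distinct (so the points are, too) and no
three points are collinear. -/
def GeneralPosition {ι : Type*} (P : ι → ℝ × ℝ) : Prop :=
  Function.Injective (fun i => (P i).1) ∧
    ∀ i j k : ι, i ≠ j → j ≠ k → i ≠ k → ¬ Collinear ℝ {P i, P j, P k}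

/-! ## Input and output of the wedge problem -/

/-- Store a finite sequence of reals in an array, followed by zeros. -/
def store {m : ℕ} (f : Fin m → ℝ) : ℕ → ℝ := fun i => if h : i < m then f ⟨i, h⟩ else 0

/-- The initial memory: the numbers of blue and red points are in cells 0 and 1 of word array 0, the
coordinates of the points in the real arrays 0 (blue, `x`), 1 (blue, `y`), 2 (red, `x`) and
3 (red, `y`). All other cells hold zero. -/
def input {b r : ℕ} (B : Fin b → ℝ × ℝ) (R : Fin r → ℝ × ℝ) : RealRAM.State where
  word a i := if a = 0 then (if i = 0 then b else if i = 1 then r else 0) else 0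
  real a :=
    if a = 0 then store (fun j => (B j).1)
    else if a = 1 then store (fun j => (B j).2)
    else if a = 2 then store (fun j => (R j).1)
    else if a = 3 then store (fun j => (R j).2)
    else fun _ => 0

/-- The first line returned, in cells 0 and 1 of real array 4. -/
def outLine₁ (s : RealRAM.State) : Line := ⟨s.real 4 0, s.real 4 1⟩

/-- The second line returned, in cells 2 and 3 of real array 4. -/
def outLine₂ (s : RealRAM.State) : Line := ⟨s.real 4 2, s.real 4 3⟩

/-- The region returned: cell 0 of word array 1 tells whether it is the East region (value 0) or
the West region (any other value) of the two lines returned. -/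
def outRegion (s : RealRAM.State) : Set (ℝ × ℝ) :=
  if s.word 1 0 = 0 then East (outLine₁ s) (outLine₂ s) else West (outLine₁ s) (outLine₂ s)

/-- The final memory `s` holds a solution: two lines that intersect, the first having the smaller
slope, and their East or West wedge, which contains all blue points and has the fewest red
outliers. -/
def IsSolution (B R : Set (ℝ × ℝ)) (s : RealRAM.State) : Prop :=
  (outLine₁ s).slope < (outLine₂ s).slope ∧
  B ⊆ outRegion s ∧
  ∀ W : Set (ℝ × ℝ), IsSideways W → B ⊆ W → redOutliers R (outRegion s) ≤ redOutliers R W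

end TwoLines

/-!
Fix the slopes `a₁` and `a₂` of the lower and the upper bounding line. Among the regions above a
line of slope `a₁` and below a line of slope `a₂` that contain the blue points, the one whose
bounding lines touch the blue points has the smallest interior. A red point is not in this interior
if and only if the line of slope `a₁` through it has no blue point below it (`Below`), or the line
of slope `a₂` through it has no blue point above it (`Above`). The slopes `a₁` with the first
property form a closed interval: its left endpoint is the largest slope of a line from a blue point
to the left of the red point, and its right endpoint is the smallest slope of a line from a blue
point to the right (`IsEnds.below`, `IsEnds.le_of_below`). The slopes `a₂` with the second property
form an interval of the same kind, with left and right exchanged. So the problem is to find a pair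
`(a₁, a₂)` that maximizes the number of red points `j` for which `a₁` lies in the first interval of
`j` or `a₂` lies in the second one. No constraint links the two slopes: if `a₁ < a₂`, then the
region is an East wedge, if `a₁ > a₂`, it is a West wedge, and if `a₁ = a₂`, it is a strip, so that
all competitors are covered (`TwoLines.IsSideways.eq_inter`).

The endpoints of the intervals are slopes of tangents to convex hulls of blue points. A sweep over
the points in the order of the `x`-coordinates maintains the lower hull of the blue points to the
left on a stack (`HullStack`), on which the tangent point of a red point is found by binary search;
sign changes of the coordinates reduce the four kinds of tangents to this one (`allTangents_spec`).
The endpoints of the intervals of either kind are sorted, infinite ones being replaced by `-K` and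
`K` for a bound `K` on the finite ones. Only the positions of the slopes among the sorted endpoints
matter (`Active`, `Sorted.exists_active`). While `a₁` sweeps over the first family, a complete
binary tree over the endpoints of the second family stores a weight `1` at the left and `-1` at the
right endpoint of the second interval of every red point whose first interval does not contain `a₁`;
the maximal prefix sum, which is available at the root, is the largest number of red points that a
suitable `a₂` excludes in addition (`active_add_sum_weights`, `SumTree.root`). Each of the `O(n)`
events changes two leaves, which takes `O(log n)` time (`setLeaf_spec`, `sweep_spec`).

The best position of `a₁` or `a₂` stands for a whole intersection of intervals. The slope `a₁` is the
left end of its intersection, and `a₂` is either end `hi` or `lo` of the other one. In general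
position `lo < hi`, since at a single common slope a line would touch the blue points and contain
three of the given points (`IsChoice.lo_lt_hi`). Hence `a₂` can be chosen different from `a₁`, so that
the output is a wedge and not a strip.

Sorting is done with a tournament tree (`sort_spec`). Programs are verified in a calculus of total
correctness (`WP`), in which running times are part of the postconditions, and the arrays that a
program does not write to are known to be unchanged (`Runs.frame`). A scalar variable is cell `0` of
an array, so that word variable 8 is cell `0` of word array 8.
-/

/-! ### A total-correctness calculus for the real RAM -/

namespace RealRAM

section Memory

variable (s : State) (a i v : ℕ) (x : ℝ)

@[simp] theorem State.setWord_word_self :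
    (s.setWord a i v).word a = Function.update (s.word a) i v := by
  simp [State.setWord]

@[simp] theorem State.setWord_word_of_ne {a' : ℕ} (h : a' ≠ a) :
    (s.setWord a i v).word a' = s.word a' := by
  simp [State.setWord, h]

@[simp] theorem State.setWord_real : (s.setWord a i v).real = s.real := rfl

@[simp] theorem State.setReal_real_self :
    (s.setReal a i x).real a = Function.update (s.real a) i x := by
  simp [State.setReal]

@[simp] theorem State.setReal_real_of_ne {a' : ℕ} (h : a' ≠ a) :
    (s.setReal a i x).real a' = s.real a' := by
  simp [State.setReal, h]

@[simp] theorem State.setReal_word : (s.setReal a i x).word = s.word := rfl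

end Memory

/-- Disjunction of tests. -/
def Test.or (b c : Test) : Test := .not (.and (.not b) (.not c))

theorem Test.or_holds {b c : Test} {s : State} :
    (b.or c).Holds s ↔ b.Holds s ∨ c.Holds s := by
  simp only [Test.or, Test.Holds]; tauto

namespace Prog

/-- Whether the program contains an assignment to word array `a`. -/
def writesWord : Prog → ℕ → Bool
  | skip, _ => false
  | setWord a _ _, a' => a == a'
  | setReal _ _ _, _ => false
  | seq p q, a => p.writesWord a || q.writesWord a
  | branch _ p q, a => p.writesWord a || q.writesWord a
  | loop _ p, a => p.writesWord a

/-- Whether the program contains an assignment to real array `a`. -/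
def writesReal : Prog → ℕ → Bool
  | skip, _ => false
  | setWord _ _ _, _ => false
  | setReal a _ _, a' => a == a'
  | seq p q, a => p.writesReal a || q.writesReal a
  | branch _ p q, a => p.writesReal a || q.writesReal a
  | loop _ p, a => p.writesReal a

/-- Whether the program has no loops. -/
def loopFree : Prog → Bool
  | seq p q => p.loopFree && q.loopFree
  | branch _ p q => p.loopFree && q.loopFree
  | loop _ _ => false
  | _ => true

/-- An upper bound for the running time of a loop-free program. -/
def time : Prog → ℕ
  | skip => 1
  | setWord _ i e => i.cost + e.cost + 1
  | setReal _ i e => i.cost + e.cost + 1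
  | seq p q => p.time + q.time
  | branch b p q => b.cost + max p.time q.time + 1
  | loop _ _ => 0

open Classical in
/-- The final memory of a loop-free program. -/
noncomputable def exec : Prog → State → State
  | skip, s => s
  | setWord a i e, s => s.setWord a (i.eval s) (e.eval s)
  | setReal a i e, s => s.setReal a (i.eval s) (e.eval s)
  | seq p q, s => q.exec (p.exec s)
  | branch b p q, s => if b.Holds s then p.exec s else q.exec s
  | loop _ _, s => s

/-- A loop-free program started in memory `s` does not get stuck. -/
def SafeAt (M : ℕ) : Prog → State → Prop
  | skip, _ => True
  | setWord _ i e, s => i.Safe M s ∧ e.Safe M s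
  | setReal _ i e, s => i.Safe M s ∧ e.Safe M s
  | seq p q, s => p.SafeAt M s ∧ q.SafeAt M (p.exec s)
  | branch b p q, s => b.Safe M s ∧ (b.Holds s → p.SafeAt M s) ∧ (¬ b.Holds s → q.SafeAt M s)
  | loop _ _, _ => True

/-- `Frame p s s'`: the memories `s` and `s'` agree on the arrays that `p` does not write to. -/
def Frame (p : Prog) (s s' : State) : Prop :=
  (∀ a, p.writesWord a = false → s'.word a = s.word a) ∧
    ∀ a, p.writesReal a = false → s'.real a = s.real a

theorem Frame.refl (p : Prog) (s : State) : p.Frame s s := ⟨fun _ _ => rfl, fun _ _ => rfl⟩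

theorem Frame.trans {p : Prog} {s s' s'' : State} (h : p.Frame s s') (h' : p.Frame s' s'') :
    p.Frame s s'' :=
  ⟨fun a ha => (h'.1 a ha).trans (h.1 a ha), fun a ha => (h'.2 a ha).trans (h.2 a ha)⟩

theorem Frame.mono {p q : Prog} {s s' : State} (h : p.Frame s s')
    (hw : ∀ a, q.writesWord a = false → p.writesWord a = false)
    (hr : ∀ a, q.writesReal a = false → p.writesReal a = false) : q.Frame s s' :=
  ⟨fun a ha => h.1 a (hw a ha), fun a ha => h.2 a (hr a ha)⟩

end Prog

variable {M : ℕ} {p q : Prog} {s : State}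

/-- A program changes only the arrays that it writes to. -/
theorem Runs.frame {t : ℕ} {s' : State} (h : Runs M p s t s') : p.Frame s s' := by
  induction h with
  | skip s => exact Prog.Frame.refl _ _
  | setWord s a i e hi he =>
    refine ⟨fun a' h => State.setWord_word_of_ne _ _ _ _ ?_, fun _ _ => rfl⟩
    rintro rfl; simp [Prog.writesWord] at h
  | setReal s a i e hi he =>
    refine ⟨fun _ _ => rfl, fun a' h => State.setReal_real_of_ne _ _ _ _ ?_⟩
    rintro rfl; simp [Prog.writesReal] at h
  | seq _ _ h1 h2 =>
    refine (h1.mono ?_ ?_).trans (h2.mono ?_ ?_) <;>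
      · intro a; simp only [Prog.writesWord, Prog.writesReal, Bool.or_eq_false_iff]; tauto
  | branchTrue _ _ _ h1 =>
    refine h1.mono ?_ ?_ <;>
      · intro a; simp only [Prog.writesWord, Prog.writesReal, Bool.or_eq_false_iff]; tauto
  | branchFalse _ _ _ h1 =>
    refine h1.mono ?_ ?_ <;>
      · intro a; simp only [Prog.writesWord, Prog.writesReal, Bool.or_eq_false_iff]; tauto
  | loopTrue _ _ _ _ h1 h2 => exact (h1.mono (fun _ h => h) (fun _ h => h)).trans h2
  | loopFalse _ _ => exact Prog.Frame.refl _ _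

/-- The program `p`, started in memory `s`, halts without getting stuck, and its running time and
final memory satisfy `Q`. -/
def WP (M : ℕ) (p : Prog) (s : State) (Q : ℕ → State → Prop) : Prop :=
  ∃ t s', Runs M p s t s' ∧ Q t s'

namespace WP

variable {Q Q' : ℕ → State → Prop}

theorem mono (h : WP M p s Q) (hQ : ∀ t s', p.Frame s s' → Q t s' → Q' t s') : WP M p s Q' := by
  obtain ⟨t, s', hr, hq⟩ := h
  exact ⟨t, s', hr, hQ t s' hr.frame hq⟩

theorem seq (h : WP M p s fun t s' => WP M q s' fun t' s'' => Q (t + t') s'') :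
    WP M (.seq p q) s Q := by
  obtain ⟨t, s', hr, t', s'', hr', hq⟩ := h
  exact ⟨_, _, .seq hr hr', hq⟩

theorem branch {b : Test} (hs : b.Safe M s)
    (hp : b.Holds s → WP M p s fun t s' => Q (b.cost + t + 1) s')
    (hq : ¬ b.Holds s → WP M q s fun t s' => Q (b.cost + t + 1) s') :
    WP M (.branch b p q) s Q := by
  by_cases h : b.Holds s
  · obtain ⟨t, s', hr, hQ⟩ := hp h
    exact ⟨_, _, .branchTrue hs h hr, hQ⟩
  · obtain ⟨t, s', hr, hQ⟩ := hq h
    exact ⟨_, _, .branchFalse hs h hr, hQ⟩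

/-- Loop-free programs are evaluated symbolically. -/
theorem of_exec (hl : p.loopFree = true) (hs : p.SafeAt M s)
    (hQ : ∀ t ≤ p.time, Q t (p.exec s)) : WP M p s Q := by
  have key : ∀ (p : Prog) (s : State), p.loopFree = true → p.SafeAt M s →
      ∃ t ≤ p.time, Runs M p s t (p.exec s) := by
    intro p
    induction p with
    | skip => exact fun s _ _ => ⟨1, le_rfl, .skip s⟩
    | setWord a i e => exact fun s _ h => ⟨_, le_rfl, .setWord s a i e h.1 h.2⟩
    | setReal a i e => exact fun s _ h => ⟨_, le_rfl, .setReal s a i e h.1 h.2⟩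
    | seq p q hp hq =>
      intro s hl h
      simp only [Prog.loopFree, Bool.and_eq_true] at hl
      obtain ⟨t, ht, hr⟩ := hp s hl.1 h.1
      obtain ⟨t', ht', hr'⟩ := hq _ hl.2 h.2
      exact ⟨_, Nat.add_le_add ht ht', .seq hr hr'⟩
    | branch b p q hp hq =>
      intro s hl h
      simp only [Prog.loopFree, Bool.and_eq_true] at hl
      by_cases hb : b.Holds s
      · obtain ⟨t, ht, hr⟩ := hp s hl.1 (h.2.1 hb)
        refine ⟨b.cost + t + 1, ?_, ?_⟩
        · simp only [Prog.time]; omega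
        · simp only [Prog.exec, if_pos hb]; exact .branchTrue h.1 hb hr
      · obtain ⟨t, ht, hr⟩ := hq s hl.2 (h.2.2 hb)
        refine ⟨b.cost + t + 1, ?_, ?_⟩
        · simp only [Prog.time]; omega
        · simp only [Prog.exec, if_neg hb]; exact .branchFalse h.1 hb hr
    | loop b p _ => intro s hl; simp [Prog.loopFree] at hl
  obtain ⟨t, ht, hr⟩ := key p s hl hs
  exact ⟨t, _, hr, hQ t ht⟩

/-- The loop rule. The invariant is `I`, and the potential `Φ` pays for the running time. -/
theorem loop {b : Test} (I : State → Prop) (Φ : State → ℕ) (h0 : I s)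
    (hs : ∀ s', p.Frame s s' → I s' → b.Safe M s')
    (hp : ∀ s', p.Frame s s' → I s' → b.Holds s' →
      WP M p s' fun t s'' => I s'' ∧ t + b.cost + 1 + Φ s'' ≤ Φ s') :
    WP M (.loop b p) s fun t s' => I s' ∧ ¬ b.Holds s' ∧ t + Φ s' ≤ Φ s + b.cost + 1 := by
  suffices H : ∀ n, ∀ s', Φ s' = n → p.Frame s s' → I s' →
      WP M (.loop b p) s' fun t s'' => I s'' ∧ ¬ b.Holds s'' ∧ t + Φ s'' ≤ Φ s' + b.cost + 1 from
    H _ s rfl (Prog.Frame.refl _ _) h0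
  intro n
  induction n using Nat.strong_induction_on with
  | _ n ih =>
    intro s' hn hf hI
    by_cases hb : b.Holds s'
    · obtain ⟨t, s1, hr, hI1, ht⟩ := hp s' hf hI hb
      obtain ⟨t2, s2, hr2, hI2, hb2, ht2⟩ := ih (Φ s1) (by omega) s1 rfl (hf.trans hr.frame) hI1
      exact ⟨_, s2, .loopTrue (hs s' hf hI) hb hr hr2, hI2, hb2, by omega⟩
    · exact ⟨_, s', .loopFalse (hs s' hf hI) hb, hI, hb, by omega⟩

end WP

/-- The value of a scalar variable: cell 0 of word array `a`. -/
abbrev wvar (a : ℕ) : WExpr := .read a (.lit 0)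

/-- The value of a scalar variable: cell 0 of real array `a`. -/
abbrev rvar (a : ℕ) : RExpr := .read a (.lit 0)

/-- Assignment to a scalar word variable. -/
abbrev wset (a : ℕ) (e : WExpr) : Prog := .setWord a (.lit 0) e

/-- Assignment to a scalar real variable. -/
abbrev rset (a : ℕ) (e : RExpr) : Prog := .setReal a (.lit 0) e

theorem size_div_two {n : ℕ} (hn : 0 < n) : Nat.size (n / 2) + 1 = Nat.size n := by
  have h : n = Nat.bit (n.bodd) (n / 2) := by
    rw [← Nat.div2_val, Nat.bit_bodd_div2]
  conv_rhs => rw [h]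
  rw [Nat.size_bit]
  rw [← h]; omega

end RealRAM

/-! ### Complete binary trees in arrays -/

namespace RealRAM

/-- Node `k` of the implicit binary tree `T` holds the combination of its two children. -/
def NodeOK {α : Type*} (op : α → α → α) (T : ℕ → α) (k : ℕ) : Prop :=
  T k = op (T (2 * k)) (T (2 * k + 1))

/-- Node `k` is a proper ancestor of node `i`. -/
def Anc (k i : ℕ) : Prop := ∃ e, k = i / 2 ^ (e + 1)

theorem anc_iff {k i : ℕ} : Anc k i ↔ k = i / 2 ∨ Anc k (i / 2) := by
  constructor
  · rintro ⟨e, rfl⟩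
    cases e with
    | zero => left; simp
    | succ e => right; exact ⟨e, by rw [Nat.div_div_eq_div_mul, pow_succ' 2 (e + 1)]⟩
  · rintro (rfl | ⟨e, rfl⟩)
    · exact ⟨0, by simp⟩
    · exact ⟨e + 1, by rw [Nat.div_div_eq_div_mul, pow_succ' 2 (e + 1)]⟩

theorem not_anc_one {k : ℕ} (hk : 0 < k) : ¬ Anc k 1 := by
  rintro ⟨e, rfl⟩
  have : 1 / 2 ^ (e + 1) = 0 := Nat.div_eq_of_lt (Nat.one_lt_two_pow (by omega))
  omega

/-- Recompute all proper ancestors of the node in variable 3, from the bottom up, where `rec`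
recomputes the node in variable 3 from its children. -/
def climb (rec : Prog) : Prog :=
  .loop (.wlt (.lit 1) (wvar 3)) (.seq (wset 3 (.div (wvar 3) (.lit 2))) rec)

/-- Compute all nodes of the tree with `P` leaves from the bottom up, where `P` is in variable 2
and `leaf` computes the leaf in variable 3. -/
def build (rec leaf : Prog) : Prog :=
  .seq (wset 3 (.add (wvar 2) (wvar 2)))
    (.loop (.wlt (.lit 1) (wvar 3))
      (.seq (wset 3 (.sub (wvar 3) (.lit 1)))
        (.branch (.wlt (wvar 3) (wvar 2)) rec leaf)))

section Tree

variable {α : Type*} {view : State → ℕ → α} {op : α → α → α} {rec leaf : Prog} {M P Tr Tl : ℕ}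
  {I : State → Prop}

/-- Restoring a tree after a change at one node takes logarithmic time. -/
theorem climb_spec (hI : ∀ s v, I s → I (s.setWord 3 0 v))
    (hv : ∀ s v, view (s.setWord 3 0 v) = view s)
    (hrec : ∀ s, I s → 0 < s.word 3 0 → s.word 3 0 < P → WP M rec s fun t s' =>
      t ≤ Tr ∧ I s' ∧ s'.word 3 0 = s.word 3 0 ∧ view s' = Function.update (view s) (s.word 3 0)
        (op (view s (2 * s.word 3 0)) (view s (2 * s.word 3 0 + 1))))
    (hM : 2 < M) {s : State} (hs : I s) (h0 : 0 < s.word 3 0) (hP : s.word 3 0 < 2 * P)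
    (hOK : ∀ k, 0 < k → k < P → ¬ Anc k (s.word 3 0) → NodeOK op (view s) k) :
    WP M (climb rec) s fun t s' => t ≤ (Tr + 11) * Nat.size (s.word 3 0) + 5 ∧ I s' ∧
      (∀ k, 0 < k → k < P → NodeOK op (view s') k) ∧ ∀ k, P ≤ k → view s' k = view s k := by
  refine (WP.loop (fun s' => I s' ∧ 0 < s'.word 3 0 ∧ s'.word 3 0 < 2 * P ∧
      (∀ k, 0 < k → k < P → ¬ Anc k (s'.word 3 0) → NodeOK op (view s') k) ∧
      ∀ k, P ≤ k → view s' k = view s k)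
      (fun s => (Tr + 11) * Nat.size (s.word 3 0)) ⟨hs, h0, hP, hOK, fun _ _ => rfl⟩ ?_ ?_).mono ?_
  · intro s' _ _
    simp [Test.Safe, WExpr.Safe]; omega
  · rintro s1 _ ⟨h1, h2, h3, h4, h5⟩ hb
    simp only [Test.Holds, WExpr.eval] at hb
    refine .seq (.of_exec rfl (by simp [Prog.SafeAt, WExpr.Safe, WExpr.eval]; omega) ?_)
    intro t ht
    have ht' : t ≤ 6 := ht
    simp only [Prog.exec, WExpr.eval]
    have hw : (s1.setWord 3 0 (s1.word 3 0 / 2)).word 3 0 = s1.word 3 0 / 2 := by simp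
    refine (hrec _ (hI _ _ h1) (by rw [hw]; omega) (by rw [hw]; omega)).mono ?_
    rintro t2 s2 _ ⟨ht2, hI3, hw2, hv2⟩
    rw [hw] at hw2 hv2
    rw [hv] at hv2
    set i := s1.word 3 0 / 2 with hi
    refine ⟨⟨hI3, by rw [hw2]; omega, by rw [hw2]; omega, ?_, ?_⟩, ?_⟩
    · intro k hk hkP hanc
      rw [hw2] at hanc
      unfold NodeOK
      by_cases hki : k = i
      · subst hki
        rw [hv2, Function.update_self, Function.update_of_ne (by omega),
          Function.update_of_ne (by omega)]
      · have hk2 : k ≠ i / 2 := fun h => hanc (anc_iff.2 (.inl h))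
        rw [hv2, Function.update_of_ne hki, Function.update_of_ne (by omega),
          Function.update_of_ne (by omega)]
        refine h4 k hk hkP fun h => ?_
        rcases anc_iff.1 h with h | h
        · exact hki h
        · exact hanc h
    · intro k hk
      rw [hv2, Function.update_of_ne (by omega), h5 k hk]
    · rw [hw2]
      have := size_div_two h2
      rw [← hi] at this
      rw [← this, Nat.mul_add]
      simp only [Test.cost, WExpr.cost]
      omega
  · rintro t s' _ ⟨⟨h1, h2, h3, h4, h5⟩, hb, ht⟩
    simp only [Test.Holds, WExpr.eval] at hb
    have h1' : s'.word 3 0 = 1 := by omega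
    rw [h1'] at h4
    simp only [Test.cost, WExpr.cost] at ht
    exact ⟨by omega, h1, fun k hk hkP => h4 k hk hkP (not_anc_one hk), h5⟩

/-- Building a tree takes linear time. -/
theorem build_spec {f : ℕ → α} (hI : ∀ s v, I s → I (s.setWord 3 0 v))
    (hv : ∀ s v, view (s.setWord 3 0 v) = view s) (hIP : ∀ s, I s → s.word 2 0 = P)
    (hrec : ∀ s, I s → 0 < s.word 3 0 → s.word 3 0 < P → WP M rec s fun t s' =>
      t ≤ Tr ∧ I s' ∧ s'.word 3 0 = s.word 3 0 ∧ view s' = Function.update (view s) (s.word 3 0)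
        (op (view s (2 * s.word 3 0)) (view s (2 * s.word 3 0 + 1))))
    (hleaf : ∀ s, I s → P ≤ s.word 3 0 → s.word 3 0 < 2 * P → WP M leaf s fun t s' =>
      t ≤ Tr ∧ I s' ∧ s'.word 3 0 = s.word 3 0 ∧
        view s' = Function.update (view s) (s.word 3 0) (f (s.word 3 0)))
    (hP0 : 0 < P) (hM : 2 * P < M) {s : State} (hs : I s) :
    WP M (build rec leaf) s fun t s' => t ≤ (Tr + 17) * (2 * P) + 12 ∧ I s' ∧
      (∀ k, 0 < k → k < P → NodeOK op (view s') k) ∧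
      ∀ k, P ≤ k → k < 2 * P → view s' k = f k := by
  have hPs := hIP s hs
  refine .seq (.of_exec rfl (by simp [Prog.SafeAt, WExpr.Safe, WExpr.eval]; omega) ?_)
  intro t ht
  have ht' : t ≤ 7 := ht
  simp only [Prog.exec, WExpr.eval]
  refine (WP.loop (fun s' => I s' ∧ 0 < s'.word 3 0 ∧ s'.word 3 0 ≤ 2 * P ∧
      (∀ k, s'.word 3 0 ≤ k → k < P → NodeOK op (view s') k) ∧
      ∀ k, P ≤ k → s'.word 3 0 ≤ k → k < 2 * P → view s' k = f k)
      (fun s => (Tr + 17) * s.word 3 0) ?_ ?_ ?_).mono ?_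
  · refine ⟨hI _ _ hs, ?_⟩
    simp only [State.setWord_word_self, Function.update_self, hPs]
    refine ⟨by omega, by omega, fun k _ _ => by omega, fun k _ _ => by omega⟩
  · intro s' _ _
    simp [Test.Safe, WExpr.Safe]; omega
  · rintro s1 _ ⟨h1, h2, h3, h4, h5⟩ hb
    simp only [Test.Holds, WExpr.eval] at hb
    refine .seq (.of_exec rfl (by simp [Prog.SafeAt, WExpr.Safe]; omega) ?_)
    intro t ht
    have ht' : t ≤ 6 := ht
    simp only [Prog.exec, WExpr.eval]
    have hw : (s1.setWord 3 0 (s1.word 3 0 - 1)).word 3 0 = s1.word 3 0 - 1 := by simp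
    have hI2 := hI _ (s1.word 3 0 - 1) h1
    have hP2 := hIP _ hI2
    have hcost : (Tr + 17) * (s1.word 3 0) = (Tr + 17) * (s1.word 3 0 - 1) + (Tr + 17) := by
      conv_lhs => rw [show s1.word 3 0 = s1.word 3 0 - 1 + 1 by omega]
      ring
    refine .branch (by simp [Test.Safe, WExpr.Safe]; omega) (fun hc => ?_) (fun hc => ?_)
    · simp only [Test.Holds, WExpr.eval] at hc
      rw [hw, hP2] at hc
      refine (hrec _ hI2 (by rw [hw]; omega) (by rw [hw]; omega)).mono ?_
      rintro t2 s2 _ ⟨ht2, hI3, hw2, hv2⟩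
      rw [hw] at hw2 hv2
      rw [hv] at hv2
      set i := s1.word 3 0 - 1 with hi
      refine ⟨⟨hI3, by omega, by omega, ?_, ?_⟩, ?_⟩
      · intro k hk hkP
        rw [hw2] at hk
        unfold NodeOK
        by_cases hki : k = i
        · subst hki
          rw [hv2, Function.update_self, Function.update_of_ne (by omega),
            Function.update_of_ne (by omega)]
        · rw [hv2, Function.update_of_ne hki, Function.update_of_ne (by omega),
            Function.update_of_ne (by omega)]
          exact h4 k (by omega) hkP
      · intro k hk hk2 hk3
        rw [hv2, Function.update_of_ne (by omega)]
        exact h5 k hk (by omega) hk3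
      · rw [hw2]
        simp only [Test.cost, WExpr.cost]
        omega
    · simp only [Test.Holds, WExpr.eval] at hc
      rw [hw, hP2] at hc
      refine (hleaf _ hI2 (by rw [hw]; omega) (by rw [hw]; omega)).mono ?_
      rintro t2 s2 _ ⟨ht2, hI3, hw2, hv2⟩
      rw [hw] at hw2 hv2
      rw [hv] at hv2
      set i := s1.word 3 0 - 1 with hi
      refine ⟨⟨hI3, by omega, by omega, ?_, ?_⟩, ?_⟩
      · intro k hk hkP
        omega
      · intro k hk hk2 hk3
        by_cases hki : k = i
        · rw [hv2, hki, Function.update_self]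
        · rw [hv2, Function.update_of_ne hki]
          exact h5 k hk (by omega) hk3
      · rw [hw2]
        simp only [Test.cost, WExpr.cost]
        omega
  · rintro t2 s' _ ⟨⟨h1, h2, h3, h4, h5⟩, hb, ht2⟩
    simp only [Test.Holds, WExpr.eval] at hb
    have h1' : s'.word 3 0 = 1 := by omega
    rw [h1'] at h4 h5
    simp only [Test.cost, WExpr.cost, State.setWord_word_self, Function.update_self, hPs] at ht2
    rw [← two_mul] at ht2
    exact ⟨by omega, h1, fun k hk hkP => h4 k hk hkP, fun k hk hk2 => h5 k hk (by omega) hk2⟩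

end Tree

/-- Compute in variable 2 the least power of two greater than variable 4. -/
def powTwo : Prog :=
  .seq (wset 2 (.lit 1))
    (.loop (.wlt (wvar 2) (.add (wvar 4) (.lit 1))) (wset 2 (.add (wvar 2) (wvar 2))))

theorem powTwo_spec {M : ℕ} {s : State} (hM : 2 * s.word 4 0 + 2 < M) :
    WP M powTwo s fun t s' => t ≤ 15 * (2 * s.word 4 0 + 2) + 11 ∧
      (∃ H, s'.word 2 0 = 2 ^ H) ∧ s.word 4 0 < s'.word 2 0 ∧
        s'.word 2 0 ≤ 2 * s.word 4 0 + 1 := by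
  refine .seq (.of_exec rfl (by simp [Prog.SafeAt, WExpr.Safe]; omega) ?_)
  intro t ht
  have ht' : t ≤ 3 := ht
  simp only [Prog.exec, WExpr.eval]
  refine (WP.loop (fun s' => s'.word 4 = s.word 4 ∧ (∃ H, s'.word 2 0 = 2 ^ H) ∧
    s'.word 2 0 ≤ 2 * s.word 4 0 + 1)
    (fun s' => 15 * (2 * s.word 4 0 + 2 - s'.word 2 0)) ?_ ?_ ?_).mono ?_
  · exact ⟨by simp, ⟨0, by simp⟩, by simp⟩
  · rintro s' hf ⟨h1, h2, h3⟩
    simp [Test.Safe, WExpr.Safe, WExpr.eval, h1]; omega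
  · rintro s1 hf ⟨h1, ⟨H, h2⟩, h3⟩ hb
    simp only [Test.Holds, WExpr.eval, h1] at hb
    refine .of_exec rfl (by simp [Prog.SafeAt, WExpr.Safe, WExpr.eval]; omega) ?_
    intro t ht
    have ht' : t ≤ 7 := ht
    have h2' : 0 < 2 ^ H := by positivity
    simp only [Prog.exec, WExpr.eval, State.setWord_word_self, Function.update_self, Test.cost,
      WExpr.cost]
    refine ⟨⟨by simp [h1], ⟨H + 1, by rw [h2]; ring⟩, by omega⟩, by omega⟩
  · rintro t2 s' _ ⟨⟨h1, h2, h3⟩, hb, ht2⟩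
    simp only [Test.Holds, WExpr.eval, h1] at hb
    simp only [Test.cost, WExpr.cost, State.setWord_word_self, Function.update_self] at ht2
    exact ⟨by omega, h2, by omega, h3⟩

/-! ### Sorting with a tournament tree -/

/-- The strict linear order in which indices are sorted: by key, ties broken by the index. -/
def Before (v : ℕ → ℝ) (x y : ℕ) : Prop := v x < v y ∨ v x = v y ∧ x < y

/-- The key of an index, with a greatest element for the indices from `N` on. -/
noncomputable def rankKey (v : ℕ → ℝ) (N x : ℕ) : WithTop (ℝ ×ₗ ℕ) :=
  if x < N then ((toLex (v x, x) : ℝ ×ₗ ℕ) : WithTop (ℝ ×ₗ ℕ)) else ⊤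

theorem rankKey_lt_iff {v : ℕ → ℝ} {N x y : ℕ} :
    rankKey v N x < rankKey v N y ↔ x < N ∧ (N ≤ y ∨ Before v x y) := by
  unfold rankKey Before
  by_cases hx : x < N <;> by_cases hy : y < N <;> simp [hx, hy, Prod.Lex.toLex_lt_toLex]
  omega

open Classical in
/-- The winner of a tournament match: the index with the smaller key. -/
noncomputable def winner (v : ℕ → ℝ) (N x y : ℕ) : ℕ :=
  if rankKey v N y < rankKey v N x then y else x

/-- Recompute node `i` (variable 3) of the tournament tree (word array 5) over the keys in real
array 5, of which there are `N` (variable 4). -/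
def matchNode : Prog :=
  let l := WExpr.read 5 (.mul (.lit 2) (wvar 3))
  let r := WExpr.read 5 (.add (.mul (.lit 2) (wvar 3)) (.lit 1))
  .branch (.and (.wlt r (wvar 4)) (.or (.not (.wlt l (wvar 4)))
      (.or (.rlt (.read 5 r) (.read 5 l))
        (.and (.not (.rlt (.read 5 l) (.read 5 r))) (.wlt r l)))))
    (.setWord 5 (wvar 3) r) (.setWord 5 (wvar 3) l)

theorem matchNode_spec {M P : ℕ} {s : State} (hM : 2 * P < M) (hi : s.word 3 0 < P) :
    WP M matchNode s fun t s' => t ≤ 100 ∧ s'.word 3 0 = s.word 3 0 ∧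
      s'.word 5 = Function.update (s.word 5) (s.word 3 0)
        (winner (s.real 5) (s.word 4 0) (s.word 5 (2 * s.word 3 0))
          (s.word 5 (2 * s.word 3 0 + 1))) := by
  refine .of_exec rfl ?_ ?_
  · simp [matchNode, Prog.SafeAt, Test.Safe, Test.or, WExpr.Safe, RExpr.Safe, WExpr.eval]
    omega
  · intro t ht
    refine ⟨ht.trans (by decide), ?_⟩
    unfold winner
    simp only [matchNode, Prog.exec, rankKey_lt_iff, Before]
    simp only [Test.Holds, Test.or_holds, WExpr.eval, RExpr.eval, not_lt]
    have heq : ∀ x y : ℝ, ∀ p : Prop, (x < y ∨ x ≤ y ∧ p) ↔ (x < y ∨ x = y ∧ p) := by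
      intro x y p
      constructor
      · rintro (h | ⟨h, hp⟩)
        · exact .inl h
        · exact h.lt_or_eq.imp id fun h => ⟨h, hp⟩
      · rintro (h | ⟨h, hp⟩)
        · exact .inl h
        · exact .inr ⟨h.le, hp⟩
    simp only [heq]
    split_ifs <;> simp

/-- Put item `i - P` into leaf `i` of the tournament tree. -/
def seedLeaf : Prog :=
  .branch (.wlt (.sub (wvar 3) (wvar 2)) (wvar 4))
    (.setWord 5 (wvar 3) (.sub (wvar 3) (wvar 2))) (.setWord 5 (wvar 3) (wvar 4))

/-- Sort the `N` (variable 4) keys in real array 5: afterwards word array 6 lists the indices in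
sorted order, and word array 7 holds the position of each index in this list. The winner of the
tournament is extracted `N` times. -/
def sort : Prog :=
  .seq powTwo (.seq (build matchNode seedLeaf) (.seq (wset 8 (.lit 0))
    (.loop (.wlt (wvar 8) (wvar 4))
      (.seq
        (.seq (wset 9 (.read 5 (.lit 1)))
        (.seq (.setWord 6 (wvar 8) (wvar 9))
        (.seq (.setWord 7 (wvar 9) (wvar 8))
        (.seq (.setWord 5 (.add (wvar 2) (wvar 9)) (wvar 4))
          (wset 3 (.add (wvar 2) (wvar 9)))))))
        (.seq (climb matchNode) (wset 8 (.add (wvar 8) (.lit 1))))))))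

/-- `ord` lists the indices below `N` in increasing order of their keys, and `pos` is its
inverse. -/
structure Sorted (v : ℕ → ℝ) (N : ℕ) (ord pos : ℕ → ℕ) : Prop where
  ord_lt : ∀ k < N, ord k < N
  pos_ord : ∀ k < N, pos (ord k) = k
  pos_lt : ∀ x < N, pos x < N
  ord_pos : ∀ x < N, ord (pos x) = x
  before : ∀ k₁ k₂, k₁ < k₂ → k₂ < N → Before v (ord k₁) (ord k₂)

theorem winner_eq_or (v : ℕ → ℝ) (N x y : ℕ) : winner v N x y = x ∨ winner v N x y = y := by
  unfold winner; split_ifs <;> simp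

/-- The root of the tournament tree holds the smallest key among all nodes. -/
theorem rankKey_root_le {v : ℕ → ℝ} {N P : ℕ} {T : ℕ → ℕ}
    (h : ∀ k, 0 < k → k < P → NodeOK (winner v N) T k) {j : ℕ} (hj : 0 < j) (hjP : j < 2 * P) :
    rankKey v N (T 1) ≤ rankKey v N (T j) := by
  induction j using Nat.strong_induction_on with
  | _ j ih =>
    rcases Nat.lt_or_ge 1 j with h1 | h1
    · refine (ih (j / 2) (by omega) (by omega) (by omega)).trans ?_
      rw [h (j / 2) (by omega) (by omega)]
      unfold winner
      rcases Nat.mod_two_eq_zero_or_one j with hm | hm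
      · rw [show 2 * (j / 2) = j by omega]
        split_ifs with hc
        · exact hc.le
        · exact le_rfl
      · rw [show 2 * (j / 2) + 1 = j by omega]
        split_ifs with hc
        · exact le_rfl
        · exact not_lt.1 hc
    · rw [show j = 1 by omega]

theorem tree_forall {v : ℕ → ℝ} {N P : ℕ} {T : ℕ → ℕ}
    (h : ∀ k, 0 < k → k < P → NodeOK (winner v N) T k) {p : ℕ → Prop}
    (hp : ∀ k, P ≤ k → k < 2 * P → p (T k)) {j : ℕ} (hj : 0 < j) (hjP : j < 2 * P) : p (T j) := by
  induction hn : 2 * P - j using Nat.strong_induction_on generalizing j with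
  | _ n ih =>
    rcases Nat.lt_or_ge j P with h1 | h1
    · rw [h j hj h1]
      rcases winner_eq_or v N (T (2 * j)) (T (2 * j + 1)) with h2 | h2 <;> rw [h2]
      · exact ih (2 * P - 2 * j) (by omega) (by omega) (by omega) rfl
      · exact ih (2 * P - (2 * j + 1)) (by omega) (by omega) (by omega) rfl
    · exact hp j h1 hjP

/-- The running time is `O(N log N)`, since each of the `N` extractions repairs one path of the tree.
The number of leaves and its being a power of two are part of the conclusion because the
last call of the sorting program also fixes the size of the tree of the sweep. -/
theorem sort_spec {M : ℕ} {s : State} (hM : 8 * s.word 4 0 + 8 < M) :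
    WP M sort s fun t s' =>
      t ≤ 1000 * ((s.word 4 0 + 1) * Nat.size (4 * s.word 4 0 + 2)) ∧
      Sorted (s.real 5) (s.word 4 0) (s'.word 6) (s'.word 7) ∧
      s.word 4 0 < s'.word 2 0 ∧ s'.word 2 0 ≤ 2 * s.word 4 0 + 1 ∧
      ∃ H, s'.word 2 0 = 2 ^ H := by
  set N := s.word 4 0 with hN
  set v := s.real 5 with hvdef
  have hL : 1 ≤ Nat.size (4 * N + 2) := Nat.size_pos.2 (by omega)
  refine .seq ((powTwo_spec (by omega)).mono ?_)
  rintro t1 s1 hf1 ⟨ht1, hH, hP1, hP2⟩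
  set P := s1.word 2 0 with hP
  rw [← hN] at hP1 hP2 ht1
  have e4 : s1.word 4 0 = N := congrFun (hf1.1 4 rfl) 0
  have e5 : s1.real 5 = v := hf1.2 5 rfl
  have hrec : ∀ s : State, (s.real 5 = v ∧ s.word 4 0 = N ∧ s.word 2 0 = P) → 0 < s.word 3 0 →
      s.word 3 0 < P → WP M matchNode s fun t s' =>
      t ≤ 100 ∧ (s'.real 5 = v ∧ s'.word 4 0 = N ∧ s'.word 2 0 = P) ∧
      s'.word 3 0 = s.word 3 0 ∧ s'.word 5 = Function.update (s.word 5) (s.word 3 0)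
        (winner v N (s.word 5 (2 * s.word 3 0)) (s.word 5 (2 * s.word 3 0 + 1))) := by
    rintro s ⟨h1, h2, h3⟩ h4 h5
    refine (matchNode_spec (by omega) h5).mono ?_
    rintro t s' hf ⟨ht, hw, hv⟩
    rw [hf.2 5 rfl, hf.1 4 rfl, hf.1 2 rfl]
    rw [h1, h2] at hv
    exact ⟨ht, ⟨h1, h2, h3⟩, hw, hv⟩
  refine .seq ((build_spec (view := fun s => s.word 5) (op := winner v N) (Tr := 100) (P := P)
    (I := fun s => s.real 5 = v ∧ s.word 4 0 = N ∧ s.word 2 0 = P)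
    (f := fun k => if k - P < N then k - P else N) ?_ ?_ ?_ hrec ?_ (by omega) (by omega)
    ⟨e5, e4, rfl⟩).mono ?_)
  · rintro s v ⟨h1, h2, h3⟩; simp [h1, h2, h3]
  · intro s v; simp
  · rintro s ⟨h1, h2, h3⟩; exact h3
  · rintro s ⟨h1, h2, h3⟩ h4 h5
    refine .of_exec rfl ?_ ?_
    · simp [seedLeaf, Prog.SafeAt, Test.Safe, WExpr.Safe]; omega
    · intro t ht
      refine ⟨ht.trans (by decide), ?_⟩
      simp only [seedLeaf, Prog.exec, Test.Holds, WExpr.eval, h2, h3]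
      split_ifs <;> simp [h1, h2, h3]
  rintro t2 s2 hf2 ⟨ht2, ⟨e5, e4, e2⟩, hOK, hleaf⟩
  refine .seq (.of_exec rfl (by simp [Prog.SafeAt, WExpr.Safe]; omega) ?_)
  intro t3 ht3
  have ht3' : t3 ≤ 3 := ht3
  simp only [Prog.exec, WExpr.eval]
  -- Leaf `P + x` holds `x` until `x` is extracted, and the sentinel `N` from then on; all items that
  -- have been extracted come before those that have not.
  refine (WP.loop (fun s' => s'.real 5 = v ∧ s'.word 4 0 = N ∧ s'.word 2 0 = P ∧
    s'.word 8 0 ≤ N ∧ (∀ k, 0 < k → k < P → NodeOK (winner v N) (s'.word 5) k) ∧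
    (∀ k < s'.word 8 0, s'.word 6 k < N ∧ s'.word 7 (s'.word 6 k) = k) ∧
    (∀ x < N, (s'.word 5 (P + x) = x ∧
        ∀ k < s'.word 8 0, s'.word 6 k ≠ x ∧ Before v (s'.word 6 k) x) ∨
      (s'.word 5 (P + x) = N ∧ s'.word 7 x < s'.word 8 0 ∧ s'.word 6 (s'.word 7 x) = x)) ∧
    (∀ x, N ≤ x → x < P → s'.word 5 (P + x) = N) ∧
    ∀ k₁ k₂, k₁ < k₂ → k₂ < s'.word 8 0 → Before v (s'.word 6 k₁) (s'.word 6 k₂))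
    (fun s' => (111 * Nat.size (4 * N + 2) + 50) * (N - s'.word 8 0)) ?_ ?_ ?_).mono ?_
  · simp only [ne_eq, Nat.reduceEqDiff, not_false_eq_true,
      State.setWord_word_of_ne, State.setWord_word_self, Function.update_self, State.setWord_real,
      e5, e4, e2, Nat.not_lt_zero, IsEmpty.forall_iff, implies_true, and_true, true_and, zero_le,
      or_false, false_and, and_false]
    refine ⟨hOK, fun x hx => ?_, fun x hx hxP => ?_⟩
    · rw [hleaf _ (by omega) (by omega)]; simp [hx]
    · rw [hleaf _ (by omega) (by omega)]; simp [hx]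
  · intro s' _ _
    simp [Test.Safe, WExpr.Safe]; omega
  · rintro s' _ ⟨i5, i4, i2, hk, iOK, iord, ileaf, ipad, ibef⟩ hb
    simp only [Test.Holds, WExpr.eval, i4] at hb
    have hroot : s'.word 5 1 = N ∨ s'.word 5 1 < N ∧ s'.word 5 (P + s'.word 5 1) = s'.word 5 1 := by
      refine tree_forall iOK (p := fun y => y = N ∨ y < N ∧ s'.word 5 (P + y) = y) ?_ one_pos
        (by omega)
      intro k hk1 hk2
      obtain ⟨x, rfl⟩ := Nat.exists_eq_add_of_le hk1
      rcases Nat.lt_or_ge x N with hx | hx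
      · rcases ileaf x hx with h | h
        · right; rw [h.1]; exact ⟨hx, h.1⟩
        · left; exact h.1
      · left; exact ipad x hx (by omega)
    have hmin : ∀ x < N, s'.word 5 (P + x) = x → rankKey v N (s'.word 5 1) ≤ rankKey v N x := by
      intro x hx h
      have := rankKey_root_le iOK (j := P + x) (by omega) (by omega)
      rwa [h] at this
    -- While fewer than `N` items have been extracted, the pigeonhole principle leaves one alive.
    have halive : s'.word 5 1 ≠ N := by
      intro h
      have hdead : ∀ x < N, s'.word 7 x < s'.word 8 0 ∧ s'.word 6 (s'.word 7 x) = x := by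
        intro x hx
        rcases ileaf x hx with h' | h'
        · have := hmin x hx h'.1
          rw [h] at this
          simp [rankKey, hx] at this
        · exact h'.2
      have hcard := Finset.card_le_card_of_injOn (s := Finset.range N)
        (t := Finset.range (s'.word 8 0)) (s'.word 7)
        (fun x hx => by
          simp only [Finset.coe_range, Set.mem_Iio] at hx ⊢; exact (hdead x hx).1)
        (fun x hx y hy hxy => by
          simp only [Finset.coe_range, Set.mem_Iio] at hx hy
          rw [← (hdead x hx).2, ← (hdead y hy).2, hxy])
      simp only [Finset.card_range] at hcard
      omega
    obtain ⟨hxN, hxT⟩ := hroot.resolve_left halive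
    set x := s'.word 5 1 with hx
    set k := s'.word 8 0 with hkdef
    have hxk : ∀ k' < k, s'.word 6 k' ≠ x ∧ Before v (s'.word 6 k') x := by
      rcases ileaf x hxN with h | h
      · exact h.2
      · rw [h.1] at hxT; omega
    refine .seq (.of_exec rfl ?_ ?_)
    · simp [Prog.SafeAt, Prog.exec, WExpr.Safe, WExpr.eval, i2]
      rw [← hx]
      have h1 : s'.word 5 1 = x := hx.symm
      omega
    intro t4 ht4
    have ht4' : t4 ≤ 31 := ht4.trans (by decide)
    refine .seq ?_
    set s4 := Prog.exec _ s' with hs4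
    simp only [Prog.exec, WExpr.eval, ne_eq, Nat.reduceEqDiff,
      not_false_eq_true, State.setWord_word_of_ne, State.setWord_word_self, Function.update_self, i2,
      i4, ← hkdef, ← hx] at hs4
    have a5 : s4.real 5 = v := by rw [hs4]; simp [i5]
    have a4 : s4.word 4 0 = N := by rw [hs4]; simp [i4]
    have a2 : s4.word 2 0 = P := by rw [hs4]; simp [i2]
    have a3 : s4.word 3 0 = P + x := by rw [hs4]; simp
    have a6 : s4.word 6 = Function.update (s'.word 6) k x := by rw [hs4]; simp
    have a7 : s4.word 7 = Function.update (s'.word 7) x k := by rw [hs4]; simp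
    have a8 : s4.word 8 0 = k := by rw [hs4]; simp [hkdef]
    have aT : s4.word 5 = Function.update (s'.word 5) (P + x) N := by rw [hs4]; simp
    clear_value s4
    refine (climb_spec (view := fun s => s.word 5) (op := winner v N) (Tr := 100) (P := P)
      (I := fun s => s.real 5 = v ∧ s.word 4 0 = N ∧ s.word 2 0 = P) ?_ ?_ hrec (by omega)
      ⟨a5, a4, a2⟩ (by omega) (by omega) ?_).mono ?_
    · rintro s v ⟨h1, h2, h3⟩; simp [h1, h2, h3]
    · intro s v; simp
    · intro j hj hjP hanc
      rw [a3] at hanc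
      have : j ≠ (P + x) / 2 := fun h => hanc (anc_iff.2 (.inl h))
      unfold NodeOK
      rw [aT, Function.update_of_ne (by omega), Function.update_of_ne (by omega),
        Function.update_of_ne (by omega)]
      exact iOK j hj hjP
    rintro t5 s5 hf5 ⟨ht5, ⟨b5, b4, b2⟩, bOK, bleaf⟩
    have b6 := (hf5.1 6 rfl).trans a6
    have b7 := (hf5.1 7 rfl).trans a7
    have b8 : s5.word 8 0 = k := (congrFun (hf5.1 8 rfl) 0).trans a8
    have bT : ∀ y, s5.word 5 (P + y) = if y = x then N else s'.word 5 (P + y) := by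
      intro y
      rw [bleaf _ (by omega), aT, Function.update_apply]; simp
    refine .of_exec rfl (by simp [Prog.SafeAt, WExpr.Safe, WExpr.eval, b8]; omega) ?_
    intro t6 ht6
    have ht6' : t6 ≤ 6 := ht6
    simp only [Prog.exec, WExpr.eval, ne_eq, Nat.reduceEqDiff,
      not_false_eq_true, State.setWord_word_of_ne, State.setWord_word_self, Function.update_self,
      State.setWord_real, b8, b5, b4, b2, b6, b7, bT, true_and, Test.cost, WExpr.cost]
    refine ⟨⟨by omega, bOK, ?_, ?_, ?_, ?_⟩, ?_⟩
    · intro k' hk'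
      rcases Nat.lt_or_ge k' k with h | h
      · rw [Function.update_of_ne (by omega), Function.update_of_ne (hxk k' h).1]
        exact iord k' h
      · rw [show k' = k by omega, Function.update_self, Function.update_self]
        exact ⟨hxN, rfl⟩
    · intro y hy
      by_cases hyx : y = x
      · subst hyx
        right
        simp [Function.update_self]
      · simp only [hyx, if_false]
        rcases ileaf y hy with h | h
        · left
          refine ⟨h.1, fun k' hk' => ?_⟩
          rcases Nat.lt_or_ge k' k with h' | h'
          · rw [Function.update_of_ne (by omega)]; exact h.2 k' h'
          · rw [show k' = k by omega, Function.update_self]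
            refine ⟨fun h => hyx h.symm, ?_⟩
            have hle := hmin y hy h.1
            have hlt : rankKey v N x < rankKey v N y := by
              refine lt_of_le_of_ne hle fun he => ?_
              simp only [rankKey, hxN, hy, if_true, WithTop.coe_inj] at he
              exact hyx (congrArg Prod.snd (toLex.injective he)).symm
            exact (rankKey_lt_iff.1 hlt).2.resolve_left (by omega)
        · right
          refine ⟨h.1, ?_⟩
          rw [Function.update_of_ne hyx, Function.update_of_ne (by omega)]
          exact ⟨by omega, h.2.2⟩
    · intro y hy hyP
      rw [if_neg (by omega)]; exact ipad y hy hyP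
    · intro k₁ k₂ h1 h2
      rw [Function.update_of_ne (by omega)]
      rcases Nat.lt_or_ge k₂ k with h | h
      · rw [Function.update_of_ne (by omega)]; exact ibef k₁ k₂ h1 h
      · rw [show k₂ = k by omega, Function.update_self]
        exact (hxk k₁ (by omega)).2
    · have hsz : Nat.size (P + x) ≤ Nat.size (4 * N + 2) := Nat.size_le_size (by omega)
      rw [a3] at ht5
      have h5 : 111 * Nat.size (P + x) ≤ 111 * Nat.size (4 * N + 2) := by omega
      obtain ⟨d, hd⟩ : ∃ d, N - k = d + 1 := ⟨N - k - 1, by omega⟩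
      rw [show N - (k + 1) = d by omega, hd, Nat.mul_add]
      omega
  · rintro t4 s' _ ⟨⟨i5, i4, i2, hk, iOK, iord, ileaf, ipad, ibef⟩, hb, ht4⟩
    simp only [Test.Holds, WExpr.eval, i4] at hb
    have hkN : s'.word 8 0 = N := by omega
    rw [hkN] at iord ileaf ibef
    simp only [Test.cost, WExpr.cost, State.setWord_word_self, Function.update_self] at ht4
    rw [i2]
    refine ⟨?_, ⟨fun k hk => (iord k hk).1, fun k hk => (iord k hk).2, ?_, ?_, ibef⟩,
      by omega, by omega, hH⟩
    · set L := Nat.size (4 * N + 2)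
      have h1 : (N + 1) * L ≥ N + 1 := Nat.le_mul_of_pos_right _ hL
      have h2 : (111 * L + 50) * (N - 0) ≤ 111 * ((N + 1) * L) + 50 * N := by
        rw [Nat.sub_zero]; nlinarith
      omega
    all_goals
      intro x hx
      rcases ileaf x hx with h | h
      · -- All positions are taken by `N` distinct items different from `x`.
        exfalso
        have hcard := Finset.card_le_card_of_injOn (s := Finset.range N)
          (t := (Finset.range N).erase x) (s'.word 6)
          (fun k hk => by
            simp only [Finset.coe_range, Set.mem_Iio, Finset.coe_erase, Set.mem_sdiff,
              Set.mem_singleton_iff] at hk ⊢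
            exact ⟨(iord k hk).1, (h.2 k hk).1⟩)
          (fun k hk k' hk' hkk => by
            simp only [Finset.coe_range, Set.mem_Iio] at hk hk'
            rw [← (iord k hk).2, ← (iord k' hk').2, hkk])
        rw [Finset.card_erase_of_mem (by simpa using hx), Finset.card_range] at hcard
        omega
      · first | exact h.2.1 | exact h.2.2

/-! ### Tangents to lower hulls -/

/-- The slope of the line through the points with indices `p` and `q`. -/
noncomputable def slo (x y : ℕ → ℝ) (p q : ℕ) : ℝ := (y q - y p) / (x q - x p)

section Slope

variable {x y : ℕ → ℝ} {p q r : ℕ}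

/-- The slope of the long side of a triangle is an average of the slopes of the short sides. -/
theorem slo_add (hpq : x p < x q) (hqr : x q < x r) :
    slo x y p r * (x r - x p) = slo x y p q * (x q - x p) + slo x y q r * (x r - x q) := by
  unfold slo
  rw [div_mul_cancel₀ _ (by linarith), div_mul_cancel₀ _ (by linarith),
    div_mul_cancel₀ _ (by linarith)]
  ring

theorem slo_lt_iff (hpq : x p < x q) (hqr : x q < x r) :
    slo x y p r < slo x y q r ↔ slo x y p q < slo x y q r := by
  have h := slo_add (y := y) hpq hqr
  constructor
  · intro h1
    by_contra h2
    nlinarith [mul_nonneg (sub_nonneg.2 (not_lt.1 h2)) (sub_pos.2 hpq).le,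
      mul_pos (sub_pos.2 h1) (sub_pos.2 (hpq.trans hqr))]
  · intro h1
    by_contra h2
    nlinarith [mul_nonneg (sub_nonneg.2 (not_lt.1 h2)) (sub_pos.2 (hpq.trans hqr)).le,
      mul_pos (sub_pos.2 h1) (sub_pos.2 hpq)]

theorem slo_lt_iff' (hpq : x p < x q) (hqr : x q < x r) :
    slo x y p q < slo x y p r ↔ slo x y p q < slo x y q r := by
  have h := slo_add (y := y) hpq hqr
  constructor
  · intro h1
    by_contra h2
    nlinarith [mul_nonneg (sub_nonneg.2 (not_lt.1 h2)) (sub_pos.2 hqr).le,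
      mul_pos (sub_pos.2 h1) (sub_pos.2 (hpq.trans hqr))]
  · intro h1
    by_contra h2
    nlinarith [mul_nonneg (sub_nonneg.2 (not_lt.1 h2)) (sub_pos.2 (hpq.trans hqr)).le,
      mul_pos (sub_pos.2 h1) (sub_pos.2 hqr)]

/-- The comparison of slopes that `leftTurn` makes without a division. -/
theorem slo_lt_iff_mul (hpq : x p < x q) (hqr : x q < x r) :
    slo x y p q < slo x y q r ↔ (y q - y p) * (x r - x q) < (y r - y q) * (x q - x p) := by
  unfold slo
  rw [div_lt_div_iff₀ (by linarith) (by linarith)]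

end Slope

/-- After the first `k` points from the left have been processed, the stack `st` of height `top`
holds blue points (the indices below `b`) that form a convex chain and that contain, for every
point further to the right, a blue point of maximal slope to it. -/
structure HullStack (x y : ℕ → ℝ) (b N : ℕ) (pos st : ℕ → ℕ) (top k : ℕ) : Prop where
  mem : ∀ i < top, st i < b ∧ pos (st i) < k
  incr : ∀ i, i + 1 < top → x (st i) < x (st (i + 1))
  convex : ∀ i, i + 2 < top → slo x y (st i) (st (i + 1)) < slo x y (st (i + 1)) (st (i + 2))
  dom : ∀ q < b, pos q < k → ∀ r < N, k ≤ pos r → ∃ i < top, slo x y q r ≤ slo x y (st i) r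

/-- The state of the stack while points are popped to make room for the blue point `z`. -/
structure PopStack (x y : ℕ → ℝ) (b N : ℕ) (pos st : ℕ → ℕ) (z top k : ℕ) : Prop where
  mem : ∀ i < top, st i < b ∧ pos (st i) < k
  incr : ∀ i, i + 1 < top → x (st i) < x (st (i + 1))
  convex : ∀ i, i + 2 < top → slo x y (st i) (st (i + 1)) < slo x y (st (i + 1)) (st (i + 2))
  dom : ∀ q < b, pos q ≤ k → ∀ r < N, k < pos r →
    slo x y q r ≤ slo x y z r ∨ ∃ i < top, slo x y q r ≤ slo x y (st i) r

section Hull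

variable {x y : ℕ → ℝ} {b N z top k : ℕ} {ord pos st : ℕ → ℕ}

theorem Sorted.lt_of_pos_lt (hs : Sorted x N ord pos)
    (hx : ∀ i < N, ∀ j < N, x i = x j → i = j) {i j : ℕ} (hi : i < N) (hj : j < N)
    (h : pos i < pos j) : x i < x j := by
  have := hs.before (pos i) (pos j) h (hs.pos_lt j hj)
  rw [hs.ord_pos i hi, hs.ord_pos j hj] at this
  rcases this with h' | ⟨h', _⟩
  · exact h'
  · rw [hx i hi j hj h'] at h; omega

theorem Sorted.lt_iff (hs : Sorted x N ord pos)
    (hx : ∀ i < N, ∀ j < N, x i = x j → i = j) {i j : ℕ} (hi : i < N) (hj : j < N) :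
    x i < x j ↔ pos i < pos j := by
  refine ⟨fun h => ?_, hs.lt_of_pos_lt hx hi hj⟩
  by_contra h'
  rcases (not_lt.1 h').lt_or_eq with h2 | h2
  · exact absurd (hs.lt_of_pos_lt hx hj hi h2) (not_lt.2 h.le)
  · have : i = j := by rw [← hs.ord_pos i hi, ← hs.ord_pos j hj, h2]
    subst this; exact lt_irrefl _ h

theorem HullStack.start : HullStack x y b N pos st 0 0 :=
  ⟨by simp, by simp, by simp, by simp⟩

theorem HullStack.skip (h : HullStack x y b N pos st top k)
    (hz : ∀ q < b, pos q ≠ k) : HullStack x y b N pos st top (k + 1) where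
  mem i hi := ⟨(h.mem i hi).1, by have := (h.mem i hi).2; omega⟩
  incr := h.incr
  convex := h.convex
  dom q hq hqk r hr hkr := h.dom q hq (by have := hz q hq; omega) r hr (by omega)

theorem HullStack.beginPop (h : HullStack x y b N pos st top k)
    (hz : ∀ q < b, pos q = k → q = z) : PopStack x y b N pos st z top k where
  mem := h.mem
  incr := h.incr
  convex := h.convex
  dom q hq hqk r hr hkr := by
    rcases hqk.lt_or_eq with h1 | h1
    · exact .inr (h.dom q hq h1 r hr (by omega))
    · rw [hz q hq h1]; exact .inl le_rfl

/-- A point at which the chain towards the new point `z` does not turn left is never needed again: to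
every point beyond `z`, its predecessor or `z` has a slope that is at least as large. -/
theorem PopStack.pop (h : PopStack x y b N pos st z (top + 2) k) (hb : b ≤ N) (hz : z < N)
    (hzk : pos z = k) (hlt : ∀ i < N, ∀ j < N, pos i < pos j → x i < x j)
    (hc : ¬ slo x y (st top) (st (top + 1)) < slo x y (st (top + 1)) z) :
    PopStack x y b N pos st z (top + 1) k where
  mem i hi := h.mem i (by omega)
  incr i hi := h.incr i (by omega)
  convex i hi := h.convex i (by omega)
  dom q hq hqk r hr hkr := by
    rcases h.dom q hq hqk r hr hkr with h1 | ⟨i, hi, h1⟩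
    · exact .inl h1
    · rcases Nat.lt_or_ge i (top + 1) with h2 | h2
      · exact .inr ⟨i, h2, h1⟩
      · -- The popped point lies above the segment from its predecessor to `z`.
        obtain rfl : i = top + 1 := by omega
        obtain ⟨m1, m2⟩ := h.mem (top + 1) (by omega)
        have hqz : x (st (top + 1)) < x z := hlt _ (by omega) _ hz (by omega)
        have hzr : x z < x r := hlt _ hz _ hr (by omega)
        have hpq := h.incr top (by omega)
        by_cases h3 : slo x y (st top) r < slo x y (st (top + 1)) r
        · left
          refine h1.trans ?_
          have h4 := (slo_lt_iff hpq (hqz.trans hzr)).1 h3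
          exact ((slo_lt_iff hqz hzr).2 ((slo_lt_iff' hqz hzr).1 (lt_of_le_of_lt (not_lt.1 hc) h4))).le
        · exact .inr ⟨top, by omega, h1.trans (not_lt.1 h3)⟩

theorem PopStack.push (h : PopStack x y b N pos st z top k) (hb : b ≤ N) (hz : z < b)
    (hzk : pos z = k) (hlt : ∀ i < N, ∀ j < N, pos i < pos j → x i < x j)
    (hc : ∀ i, i + 2 = top → slo x y (st i) (st (i + 1)) < slo x y (st (i + 1)) z) :
    HullStack x y b N pos (Function.update st top z) (top + 1) (k + 1) where
  mem i hi := by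
    rcases Nat.lt_or_ge i top with h1 | h1
    · rw [Function.update_of_ne (by omega)]
      exact ⟨(h.mem i h1).1, by have := (h.mem i h1).2; omega⟩
    · rw [show i = top by omega, Function.update_self]; exact ⟨hz, by omega⟩
  incr i hi := by
    rw [Function.update_of_ne (by omega)]
    rcases Nat.lt_or_ge (i + 1) top with h1 | h1
    · rw [Function.update_of_ne (by omega)]; exact h.incr i h1
    · rw [show i + 1 = top by omega, Function.update_self]
      have := h.mem i (by omega)
      exact hlt _ (by omega) _ (by omega) (by omega)
  convex i hi := by
    rw [Function.update_of_ne (by omega), Function.update_of_ne (by omega)]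
    rcases Nat.lt_or_ge (i + 2) top with h1 | h1
    · rw [Function.update_of_ne (by omega)]; exact h.convex i h1
    · rw [show i + 2 = top by omega, Function.update_self]
      exact hc i (by omega)
  dom q hq hqk r hr hkr := by
    rcases h.dom q hq (by omega) r hr (by omega) with h1 | ⟨i, hi, h1⟩
    · exact ⟨top, by omega, by rwa [Function.update_self]⟩
    · exact ⟨i, by omega, by rwa [Function.update_of_ne (by omega)]⟩

/-- Moving along the chain from point `i` to point `i + 1` increases the slope to `z`. -/
def Improves (x y : ℕ → ℝ) (st : ℕ → ℕ) (z i : ℕ) : Prop :=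
  slo x y (st i) (st (i + 1)) < slo x y (st (i + 1)) z

/-- Along the convex chain, the slopes to `z` first increase and then decrease. -/
theorem HullStack.improves_of_le (h : HullStack x y b N pos st top k)
    (hz : ∀ i < top, x (st i) < x z) {i j : ℕ} (hij : i ≤ j) (hj : j + 1 < top)
    (hi : Improves x y st z j) : Improves x y st z i := by
  induction j, hij using Nat.le_induction with
  | base => exact hi
  | succ j hij ih =>
    refine ih (by omega) ?_
    have h1 := h.convex j (by omega)
    have h2 := (slo_lt_iff' (h.incr (j + 1) (by omega)) (hz (j + 2) (by omega))).2 hi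
    exact h1.trans h2

/-- The index where the slopes to `z` stop increasing gives the largest slope. -/
theorem HullStack.slo_le (h : HullStack x y b N pos st top k)
    (hz : ∀ i < top, x (st i) < x z) {lo : ℕ} (h1 : ∀ i < lo, Improves x y st z i)
    (h2 : ∀ i, lo ≤ i → i + 1 < top → ¬ Improves x y st z i) (hlo : lo < top) {i : ℕ}
    (hi : i < top) : slo x y (st i) z ≤ slo x y (st lo) z := by
  rcases Nat.lt_or_ge i lo with hl | hl
  · refine Nat.le_induction (m := i) (P := fun j _ => j ≤ lo → slo x y (st i) z ≤ slo x y (st j) z)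
      (fun _ => le_rfl) (fun j hj ih hj2 => ?_) lo hl.le le_rfl
    refine (ih (by omega)).trans ?_
    exact ((slo_lt_iff (h.incr j (by omega)) (hz (j + 1) (by omega))).2 (h1 j (by omega))).le
  · refine Nat.le_induction (m := lo) (P := fun j _ => j < top →
      slo x y (st j) z ≤ slo x y (st lo) z)
      (fun _ => le_rfl) (fun j hj ih hj2 => ?_) i hl hi
    refine le_trans ?_ (ih (by omega))
    exact not_lt.1 fun h3 => h2 j hj hj2
      ((slo_lt_iff (h.incr j (by omega)) (hz (j + 1) (by omega))).1 h3)

/-- The flag `f` and the value `v` describe the maximal slope of a line from a blue point to the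
left of point `z` to `z`; the flag is 0 if there is no such point. -/
def IsTangent (x y : ℕ → ℝ) (b z : ℕ) (f : ℕ) (v : ℝ) : Prop :=
  (f = 1 ∧ (∃ q < b, x q < x z ∧ v = slo x y q z) ∧ ∀ q < b, x q < x z → slo x y q z ≤ v) ∨
    (f = 0 ∧ ∀ q < b, ¬ x q < x z)

end Hull

/-- The test whether three points with increasing `x`-coordinates form a left turn. -/
def leftTurn (p q z : WExpr) : Test :=
  .rlt (.mul (.sub (.read 6 q) (.read 6 p)) (.sub (.read 5 z) (.read 5 q)))
    (.mul (.sub (.read 6 z) (.read 6 q)) (.sub (.read 5 q) (.read 5 p)))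

/-- Pop the points that the blue point in variable 9 makes superfluous from the stack (word array
11, height in variable 12), and push that point. -/
def pushBlue : Prog :=
  .seq
    (.loop (.and (.wlt (.lit 1) (wvar 12))
        (.not (leftTurn (.read 11 (.sub (wvar 12) (.lit 2))) (.read 11 (.sub (wvar 12) (.lit 1)))
          (wvar 9))))
      (wset 12 (.sub (wvar 12) (.lit 1))))
    (.seq (.setWord 11 (wvar 12) (wvar 9)) (wset 12 (.add (wvar 12) (.lit 1))))

/-- The height of the stack is the potential that pays for the pops. -/
theorem pushBlue_spec {M b N k : ℕ} {x y : ℕ → ℝ} {pos : ℕ → ℕ} {s : State}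
    (hM : 2 * N + 8 < M) (hx : s.real 5 = x) (hy : s.real 6 = y) (hb : b ≤ N)
    (hlt : ∀ i < N, ∀ j < N, pos i < pos j → x i < x j)
    (hz : s.word 9 0 < b) (hzk : pos (s.word 9 0) = k)
    (hinj : ∀ q < b, pos q = k → q = s.word 9 0) (htop : s.word 12 0 < N)
    (h : HullStack x y b N pos (s.word 11) (s.word 12 0) k) :
    WP M pushBlue s fun t s' => t + 70 * s'.word 12 0 ≤ 70 * s.word 12 0 + 200 ∧
      s'.word 12 0 ≤ s.word 12 0 + 1 ∧
      HullStack x y b N pos (s'.word 11) (s'.word 12 0) (k + 1) := by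
  set z := s.word 9 0 with hzdef
  have htest : ∀ s' : State, s'.real 5 = x → s'.real 6 = y → s'.word 9 0 = z →
      s'.word 11 = s.word 11 → s'.word 12 0 ≤ s.word 12 0 →
      PopStack x y b N pos (s.word 11) z (s'.word 12 0) k → ∀ i, s'.word 12 0 = i + 2 →
      ((leftTurn (.read 11 (.sub (wvar 12) (.lit 2))) (.read 11 (.sub (wvar 12) (.lit 1)))
          (wvar 9)).Holds s' ↔
        slo x y (s.word 11 i) (s.word 11 (i + 1)) < slo x y (s.word 11 (i + 1)) z) := by
    intro s' h1 h2 h3 h4 h5 h6 i h7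
    simp only [leftTurn, Test.Holds, RExpr.eval, WExpr.eval, h1, h2, h3, h4, h7]
    have m := h6.mem (i + 1) (by omega)
    rw [show i + 2 - 1 = i + 1 by omega, show i + 2 - 2 = i by omega,
      slo_lt_iff_mul (h6.incr i (by omega)) (hlt _ (by omega) _ (by omega) (by omega))]
  refine .seq ((WP.loop (fun s' => s'.word 12 0 ≤ s.word 12 0 ∧
    PopStack x y b N pos (s.word 11) z (s'.word 12 0) k)
    (fun s' => 70 * s'.word 12 0) ?_ ?_ ?_).mono ?_)
  · exact ⟨le_rfl, h.beginPop hinj⟩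
  · rintro s' - -
    simp [Test.Safe, leftTurn, RExpr.Safe, WExpr.Safe]; omega
  · rintro s1 hf ⟨h1, h2⟩ hb'
    have e9 : s1.word 9 0 = z := congrFun (hf.1 9 rfl) 0
    have e11 : s1.word 11 = s.word 11 := hf.1 11 rfl
    obtain ⟨hb1, hb2⟩ := hb'
    simp only [Test.Holds, WExpr.eval] at hb1
    obtain ⟨i, hi⟩ : ∃ i, s1.word 12 0 = i + 2 := ⟨s1.word 12 0 - 2, by omega⟩
    rw [Test.Holds, htest s1 ((hf.2 5 rfl).trans hx) ((hf.2 6 rfl).trans hy) e9 e11 h1 h2 i hi]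
      at hb2
    refine .of_exec rfl (by simp [Prog.SafeAt, WExpr.Safe]; omega) ?_
    intro t ht
    have ht' : t ≤ 6 := ht
    have hc : (Test.and (.wlt (.lit 1) (wvar 12))
        (.not (leftTurn (.read 11 (.sub (wvar 12) (.lit 2)))
          (.read 11 (.sub (wvar 12) (.lit 1))) (wvar 9)))).cost ≤ 62 := by decide
    simp only [Prog.exec, WExpr.eval, State.setWord_word_self, Function.update_self, hi]
    rw [hi] at h2
    exact ⟨⟨by omega, h2.pop hb (by omega) hzk hlt hb2⟩, by omega⟩
  · rintro t s1 hf ⟨⟨h1, h2⟩, hb', ht⟩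
    have e9 : s1.word 9 0 = z := congrFun (hf.1 9 rfl) 0
    have e11 : s1.word 11 = s.word 11 := hf.1 11 rfl
    refine .of_exec rfl (by simp [Prog.SafeAt, Prog.exec, WExpr.Safe, WExpr.eval]; omega) ?_
    intro t2 ht2
    have ht2' : t2 ≤ 11 := ht2
    have hc : (Test.and (.wlt (.lit 1) (wvar 12))
        (.not (leftTurn (.read 11 (.sub (wvar 12) (.lit 2)))
          (.read 11 (.sub (wvar 12) (.lit 1))) (wvar 9)))).cost ≤ 62 := by decide
    simp only [Prog.exec, WExpr.eval, ne_eq, Nat.reduceEqDiff, not_false_eq_true,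
      State.setWord_word_of_ne, State.setWord_word_self, Function.update_self, e9, e11]
    refine ⟨by omega, by omega, h2.push hb hz hzk hlt ?_⟩
    intro i hi
    by_contra h3
    apply hb'
    refine ⟨by simp only [Test.Holds, WExpr.eval]; omega, ?_⟩
    rw [Test.Holds, htest s1 ((hf.2 5 rfl).trans hx) ((hf.2 6 rfl).trans hy) e9 e11 h1 h2 i hi.symm]
    exact h3

/-- Find by binary search (variables 13 to 15) the point of the stack with the largest slope to the
red point in variable 9, and store this slope in real array 9 and the flag 1 in word array 16, with
the offset in variable 17. If the stack is empty, then store the flag 0. -/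
def queryRed : Prog :=
  let cell := WExpr.add (wvar 17) (.sub (wvar 9) (wvar 0))
  .branch (.wlt (.lit 0) (wvar 12))
    (.seq (.seq (wset 13 (.lit 0)) (wset 14 (.sub (wvar 12) (.lit 1))))
    (.seq (.loop (.wlt (wvar 13) (wvar 14))
        (.seq (wset 15 (.div (.add (wvar 13) (wvar 14)) (.lit 2)))
          (.branch
            (leftTurn (.read 11 (wvar 15)) (.read 11 (.add (wvar 15) (.lit 1))) (wvar 9))
            (wset 13 (.add (wvar 15) (.lit 1))) (wset 14 (wvar 15)))))
      (.seq
        (.setReal 9 cell (.div (.sub (.read 6 (wvar 9)) (.read 6 (.read 11 (wvar 13))))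
          (.sub (.read 5 (wvar 9)) (.read 5 (.read 11 (wvar 13))))))
        (.setWord 16 cell (.lit 1)))))
    (.setWord 16 cell (.lit 0))

theorem queryRed_spec {M b N k : ℕ} {x y : ℕ → ℝ} {pos : ℕ → ℕ} {s : State}
    (hM : 2 * N + 8 < M) (hM2 : s.word 17 0 + N < M) (hx : s.real 5 = x) (hy : s.real 6 = y)
    (_hb : b ≤ N) (hbs : s.word 0 0 = b)
    (hlt : ∀ i < N, ∀ j < N, x i < x j ↔ pos i < pos j)
    (hz : b ≤ s.word 9 0) (hzN : s.word 9 0 < N) (hzk : pos (s.word 9 0) = k)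
    (htop : s.word 12 0 ≤ N) (h : HullStack x y b N pos (s.word 11) (s.word 12 0) k) :
    WP M queryRed s fun t s' => t ≤ 70 * Nat.size N + 100 ∧
      (∃ f v, IsTangent x y b (s.word 9 0) f v ∧
        s'.word 16 = Function.update (s.word 16) (s.word 17 0 + (s.word 9 0 - b)) f ∧
        (∀ c, c ≠ s.word 17 0 + (s.word 9 0 - b) → s'.real 9 c = s.real 9 c) ∧
        (f = 1 → s'.real 9 (s.word 17 0 + (s.word 9 0 - b)) = v)) := by
  set z := s.word 9 0 with hzdef
  set st := s.word 11 with hst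
  set top := s.word 12 0 with htopdef
  have hxz : ∀ i < top, x (st i) < x z := fun i hi => by
    have := h.mem i hi
    exact (hlt _ (by omega) _ hzN).2 (by omega)
  refine .branch (by simp [Test.Safe, WExpr.Safe]; omega) (fun hc => ?_) (fun hc => ?_)
  · simp only [Test.Holds, WExpr.eval] at hc
    refine .seq (.of_exec rfl (by simp [Prog.SafeAt, WExpr.Safe]; omega) ?_)
    intro t ht
    have ht' : t ≤ 9 := ht
    simp only [Prog.exec, WExpr.eval, ne_eq, Nat.reduceEqDiff, not_false_eq_true,
      State.setWord_word_of_ne, ← htopdef]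
    refine .seq ((WP.loop (fun s' => s'.word 13 0 ≤ s'.word 14 0 ∧ s'.word 14 0 < top ∧
      (∀ i < s'.word 13 0, Improves x y st z i) ∧
      ∀ i, s'.word 14 0 ≤ i → i + 1 < top → ¬ Improves x y st z i)
      (fun s' => 70 * Nat.size (s'.word 14 0 - s'.word 13 0)) ?_ ?_ ?_).mono ?_)
    · simp only [ne_eq, Nat.reduceEqDiff, not_false_eq_true, State.setWord_word_of_ne,
        State.setWord_word_self, Function.update_self]
      exact ⟨by omega, by omega, by simp, fun i h1 h2 => by omega⟩
    · intro s' _ _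
      simp [Test.Safe, WExpr.Safe]; omega
    · rintro s1 hf ⟨h1, h2, h3, h4⟩ hb'
      have e9 : s1.word 9 0 = z := by rw [hf.1 9 rfl]; simp [hzdef]
      have e11 : s1.word 11 = st := by rw [hf.1 11 rfl]; simp [hst]
      have e5 : s1.real 5 = x := by rw [hf.2 5 rfl]; simp [hx]
      have e6 : s1.real 6 = y := by rw [hf.2 6 rfl]; simp [hy]
      simp only [Test.Holds, WExpr.eval] at hb'
      refine .seq (.of_exec rfl (by simp [Prog.SafeAt, WExpr.Safe, WExpr.eval]; omega) ?_)
      intro t ht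
      have ht' : t ≤ 9 := ht.trans (by decide)
      simp only [Prog.exec, WExpr.eval]
      obtain ⟨mid, hmid⟩ : ∃ mid, (s1.word 13 0 + s1.word 14 0) / 2 = mid := ⟨_, rfl⟩
      rw [hmid]
      have himp : (leftTurn (.read 11 (wvar 15)) (.read 11 (.add (wvar 15) (.lit 1)))
          (wvar 9)).Holds (s1.setWord 15 0 mid) ↔ Improves x y st z mid := by
        unfold Improves
        rw [slo_lt_iff_mul (h.incr mid (by omega)) (hxz _ (by omega))]
        simp [leftTurn, Test.Holds, RExpr.eval, WExpr.eval, e9, e11, e5, e6]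
      have hsz := size_div_two (n := s1.word 14 0 - s1.word 13 0) (by omega)
      have hcost : (leftTurn (.read 11 (wvar 15)) (.read 11 (.add (wvar 15) (.lit 1)))
          (wvar 9)).cost ≤ 45 := by decide
      refine .branch ?_ (fun hI => ?_) (fun hI => ?_)
      · simp [leftTurn, Test.Safe, RExpr.Safe, WExpr.Safe, WExpr.eval]; omega
      · rw [himp] at hI
        refine .of_exec rfl (by simp [Prog.SafeAt, WExpr.Safe, WExpr.eval]; omega) ?_
        intro t1 ht1
        have ht1' : t1 ≤ 6 := ht1
        simp only [Prog.exec, WExpr.eval, ne_eq, Nat.reduceEqDiff, not_false_eq_true,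
          State.setWord_word_of_ne, State.setWord_word_self, Function.update_self, Test.cost,
          WExpr.cost]
        have hsz2 : Nat.size (s1.word 14 0 - (mid + 1)) ≤
          Nat.size ((s1.word 14 0 - s1.word 13 0) / 2) := Nat.size_le_size (by omega)
        refine ⟨⟨by omega, h2, fun i hi => h.improves_of_le hxz (by omega) (by omega) hI, h4⟩,
          by omega⟩
      · rw [himp] at hI
        refine .of_exec rfl (by simp [Prog.SafeAt, WExpr.Safe]; omega) ?_
        intro t1 ht1
        have ht1' : t1 ≤ 4 := ht1
        simp only [Prog.exec, WExpr.eval, ne_eq, Nat.reduceEqDiff, not_false_eq_true,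
          State.setWord_word_of_ne, State.setWord_word_self, Function.update_self, Test.cost,
          WExpr.cost]
        have hsz2 : Nat.size (mid - s1.word 13 0) ≤
          Nat.size ((s1.word 14 0 - s1.word 13 0) / 2) := Nat.size_le_size (by omega)
        refine ⟨⟨by omega, by omega, h3, fun i hi hi2 hI2 => hI ?_⟩, by omega⟩
        exact h.improves_of_le hxz hi hi2 hI2
    · rintro t2 s1 hf ⟨⟨h1, h2, h3, h4⟩, hb', ht2⟩
      have e9 : s1.word 9 0 = z := by rw [hf.1 9 rfl]; simp [hzdef]
      have e0 : s1.word 0 0 = b := by rw [hf.1 0 rfl]; simp [hbs]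
      have e17 : s1.word 17 0 = s.word 17 0 := by rw [hf.1 17 rfl]; simp
      have e16 : s1.word 16 = s.word 16 := by rw [hf.1 16 rfl]; simp
      have e11 : s1.word 11 = st := by rw [hf.1 11 rfl]; simp [hst]
      have e5 : s1.real 5 = x := by rw [hf.2 5 rfl]; simp [hx]
      have e6 : s1.real 6 = y := by rw [hf.2 6 rfl]; simp [hy]
      have e9r : s1.real 9 = s.real 9 := by rw [hf.2 9 rfl]; simp
      simp only [Test.Holds, WExpr.eval] at hb'
      have hlo : s1.word 13 0 < top := by omega
      have hxlo := hxz _ hlo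
      refine .of_exec rfl ?_ ?_
      · simp [Prog.SafeAt, Prog.exec, RExpr.Safe, WExpr.Safe, RExpr.eval, WExpr.eval, e9, e0, e17, e5,
          e11]
        exact ⟨⟨by omega, by omega, fun h => by linarith⟩, by omega⟩
      intro t3 ht3
      have ht3' : t3 ≤ 50 := ht3.trans (by decide)
      simp only [Test.cost, WExpr.cost, State.setWord_word_self, ne_eq, Nat.reduceEqDiff,
        not_false_eq_true, State.setWord_word_of_ne, Function.update_self] at ht2
      have hsz : Nat.size (top - 1 - 0) ≤ Nat.size N := Nat.size_le_size (by omega)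
      refine ⟨by simp only [Test.cost, WExpr.cost]; omega, 1, slo x y (st (s1.word 13 0)) z,
        .inl ⟨rfl, ⟨_, (h.mem _ hlo).1, hxlo, rfl⟩, ?_⟩, ?_⟩
      · intro q hq hqz
        obtain ⟨i, hi, hle⟩ := h.dom q hq (by rw [← hzk]; exact (hlt _ (by omega) _ hzN).1 hqz) z
          hzN hzk.ge
        exact hle.trans (h.slo_le hxz h3 (fun i hi => h4 i (by omega)) hlo hi)
      · refine ⟨?_, fun c hc => ?_, fun _ => ?_⟩
        · simp [Prog.exec, WExpr.eval, e9, e0, e17, e16]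
        · simp only [Prog.exec, WExpr.eval, State.setWord_real, State.setReal_real_self, e9r, e9,
            e17, e0]
          rw [Function.update_of_ne hc]
        · simp [Prog.exec, WExpr.eval, RExpr.eval, e9, e0, e17, e5, e6, e11, slo]
  · simp only [Test.Holds, WExpr.eval] at hc
    have hc' : top = 0 := by omega
    refine .of_exec rfl (by simp [Prog.SafeAt, WExpr.Safe, WExpr.eval, hbs]; omega) ?_
    intro t ht
    have ht' : t ≤ 12 := ht.trans (by decide)
    refine ⟨by simp only [Test.cost, WExpr.cost]; omega, 0, 0, .inr ⟨rfl, ?_⟩, ?_⟩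
    · intro q hq hqz
      obtain ⟨i, hi, -⟩ := h.dom q hq (by rw [← hzk]; exact (hlt _ (by omega) _ hzN).1 hqz) z
        hzN hzk.ge
      omega
    · simp [Prog.exec, WExpr.eval, hbs, ← hzdef]

/-- Sweep over the sorted points from left to right, push the blue ones, query the red ones. -/
def tangentSweep : Prog :=
  .seq (.seq (wset 8 (.lit 0)) (wset 12 (.lit 0)))
    (.loop (.wlt (wvar 8) (wvar 4))
      (.seq (wset 9 (.read 6 (wvar 8)))
      (.seq (.branch (.wlt (wvar 9) (wvar 0)) pushBlue queryRed)
        (wset 8 (.add (wvar 8) (.lit 1))))))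

theorem tangentSweep_spec {M b N : ℕ} {x y : ℕ → ℝ} {s : State}
    (hM : 2 * N + 8 < M) (hM2 : s.word 17 0 + N < M) (hx : s.real 5 = x) (hy : s.real 6 = y)
    (hb : b ≤ N) (hbs : s.word 0 0 = b) (hNs : s.word 4 0 = N)
    (hxi : ∀ i < N, ∀ j < N, x i = x j → i = j)
    (hs : Sorted x N (s.word 6) (s.word 7)) :
    WP M tangentSweep s fun t s' => t ≤ 70 * (N * Nat.size N) + 500 * N + 20 ∧
      (∀ j, b + j < N → IsTangent x y b (b + j) (s'.word 16 (s.word 17 0 + j))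
        (s'.real 9 (s.word 17 0 + j))) ∧
      ∀ c, c < s.word 17 0 → s'.word 16 c = s.word 16 c ∧ s'.real 9 c = s.real 9 c := by
  set ord := s.word 6 with hord
  set pos := s.word 7 with hpos
  set base := s.word 17 0 with hbase
  have hlt : ∀ i < N, ∀ j < N, x i < x j ↔ pos i < pos j := fun i hi j hj => hs.lt_iff hxi hi hj
  refine .seq (.of_exec rfl (by simp [Prog.SafeAt, WExpr.Safe]; omega) ?_)
  intro t ht
  have ht' : t ≤ 6 := ht
  simp only [Prog.exec, WExpr.eval]
  refine (WP.loop (fun s' => s'.word 8 0 ≤ N ∧ s'.word 12 0 ≤ s'.word 8 0 ∧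
    HullStack x y b N pos (s'.word 11) (s'.word 12 0) (s'.word 8 0) ∧
    (∀ j, b + j < N → pos (b + j) < s'.word 8 0 →
      IsTangent x y b (b + j) (s'.word 16 (base + j)) (s'.real 9 (base + j))) ∧
    ∀ c, c < base → s'.word 16 c = s.word 16 c ∧ s'.real 9 c = s.real 9 c)
    (fun s' => (70 * Nat.size N + 400) * (N - s'.word 8 0) + 70 * s'.word 12 0) ?_ ?_ ?_).mono ?_
  · refine ⟨by simp, by simp, ?_, by simp, by simp⟩
    simpa using HullStack.start
  · intro s' _ _
    simp [Test.Safe, WExpr.Safe]; omega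
  · rintro s1 hf ⟨h1, h2, h3, h4, h5⟩ hb'
    have e0 : s1.word 0 0 = b := by rw [hf.1 0 rfl]; simp [hbs]
    have e4 : s1.word 4 0 = N := by rw [hf.1 4 rfl]; simp [hNs]
    have e6 : s1.word 6 = ord := by rw [hf.1 6 rfl]; simp [hord]
    have e17 : s1.word 17 0 = base := by rw [hf.1 17 rfl]; simp [hbase]
    have r5 : s1.real 5 = x := by rw [hf.2 5 rfl]; simp [hx]
    have r6 : s1.real 6 = y := by rw [hf.2 6 rfl]; simp [hy]
    clear hf
    simp only [Test.Holds, WExpr.eval, e4] at hb'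
    set k := s1.word 8 0 with hk
    have hzN := hs.ord_lt k hb'
    have hzk := hs.pos_ord k hb'
    set z := ord k with hz
    obtain ⟨d, hd⟩ : ∃ d, N - k = d + 1 := ⟨N - k - 1, by omega⟩
    have hmul : (70 * Nat.size N + 400) * (d + 1) =
      (70 * Nat.size N + 400) * d + (70 * Nat.size N + 400) := by ring
    refine .seq (.of_exec rfl (by simp [Prog.SafeAt, WExpr.Safe]; omega) ?_)
    intro t1 ht1
    have ht1' : t1 ≤ 5 := ht1
    simp only [Prog.exec, WExpr.eval, e6, ← hk, ← hz]
    refine .seq (.branch (by simp [Test.Safe, WExpr.Safe]; omega) (fun hc => ?_) (fun hc => ?_))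
    · simp only [Test.Holds, WExpr.eval, ne_eq, OfNat.zero_ne_ofNat,
        not_false_eq_true, State.setWord_word_of_ne, State.setWord_word_self, Function.update_self,
        e0] at hc
      refine (pushBlue_spec (b := b) (N := N) (k := k) (x := x) (y := y) (pos := pos) hM (by simpa)
        (by simpa) hb (fun i hi j hj => (hlt i hi j hj).2) (by simpa) (by simpa) ?_ ?_ ?_).mono ?_
      · intro q hq hqk
        simp only [State.setWord_word_self, Function.update_self]
        rw [← hs.ord_pos q (by omega), hqk]
      · simp; omega
      · simpa using h3
      rintro t2 s2 hf ⟨ht2, htop, hH⟩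
      have f8 : s2.word 8 0 = k := by rw [hf.1 8 rfl]; simp [hk]
      have f16 : s2.word 16 = s1.word 16 := by rw [hf.1 16 rfl]; simp
      have f9 : s2.real 9 = s1.real 9 := by rw [hf.2 9 rfl]; simp
      simp only [ne_eq, Nat.reduceEqDiff, not_false_eq_true, State.setWord_word_of_ne] at ht2 htop
      refine .of_exec rfl (by simp [Prog.SafeAt, WExpr.Safe, WExpr.eval]; omega) ?_
      intro t3 ht3
      have ht3' : t3 ≤ 6 := ht3
      simp only [Prog.exec, WExpr.eval, ne_eq, Nat.reduceEqDiff, not_false_eq_true,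
        State.setWord_word_of_ne, State.setWord_word_self, Function.update_self, f8, f16, f9,
        State.setWord_real, Test.cost, WExpr.cost]
      refine ⟨⟨by omega, by omega, hH, fun j hj hjk => h4 j hj ?_, h5⟩, ?_⟩
      · have : pos (b + j) ≠ k := fun h => by
          have := hs.ord_pos _ hj
          rw [h] at this; omega
        omega
      · rw [show N - (k + 1) = d by omega, hd, hmul]
        omega
    · simp only [Test.Holds, WExpr.eval, ne_eq, OfNat.zero_ne_ofNat,
        not_false_eq_true, State.setWord_word_of_ne, State.setWord_word_self, Function.update_self,
        e0] at hc
      refine (queryRed_spec (b := b) (N := N) (k := k) (x := x) (y := y) (pos := pos) hM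
        (by simpa [e17] using hM2) (by simpa) (by simpa) hb (by simpa) hlt (by simpa using hc)
        (by simpa) (by simpa) (by simp; omega) ?_).mono ?_
      · simpa using h3
      rintro t2 s2 hf ⟨ht2, f, v, hT, hw, hr, hr2⟩
      have f8 : s2.word 8 0 = k := by rw [hf.1 8 rfl]; simp [hk]
      have f11 : s2.word 11 = s1.word 11 := by rw [hf.1 11 rfl]; simp
      have f12 : s2.word 12 = s1.word 12 := by rw [hf.1 12 rfl]; simp
      simp only [ne_eq, Nat.reduceEqDiff, not_false_eq_true, State.setWord_word_of_ne,
        State.setWord_word_self, Function.update_self, e17, State.setWord_real] at hT hw hr hr2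
      refine .of_exec rfl (by simp [Prog.SafeAt, WExpr.Safe, WExpr.eval]; omega) ?_
      intro t3 ht3
      have ht3' : t3 ≤ 6 := ht3
      simp only [Prog.exec, WExpr.eval, ne_eq, Nat.reduceEqDiff, not_false_eq_true,
        State.setWord_word_of_ne, State.setWord_word_self, Function.update_self, f8, f11, f12, hw,
        State.setWord_real, Test.cost, WExpr.cost]
      refine ⟨⟨by omega, by omega, h3.skip ?_, fun j hj hjk => ?_, fun c hc => ?_⟩, ?_⟩
      · intro q hq hqk
        have := hs.ord_pos q (by omega)
        rw [hqk] at this; omega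
      · by_cases hjz : b + j = z
        · obtain rfl : j = z - b := by omega
          rw [Function.update_self, hjz]
          rcases hT with hT | hT
          · rw [hr2 hT.1]; exact .inl hT
          · exact .inr hT
        · rw [Function.update_of_ne (by omega), hr _ (by omega)]
          refine h4 j hj ?_
          have : pos (b + j) ≠ k := fun h => by
            have := hs.ord_pos _ hj
            rw [h] at this; omega
          omega
      · rw [Function.update_of_ne (by omega), hr _ (by omega)]
        exact h5 c hc
      · rw [show N - (k + 1) = d by omega, hd, hmul]
        omega
  · rintro t2 s1 hf ⟨⟨h1, h2, h3, h4, h5⟩, hb', ht2⟩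
    have e4 : s1.word 4 0 = N := by rw [hf.1 4 rfl]; simp [hNs]
    simp only [Test.Holds, WExpr.eval, e4] at hb'
    refine ⟨?_, fun j hj => h4 j hj ?_, h5⟩
    · simp only [Test.cost, WExpr.cost, State.setWord_word_self, ne_eq, Nat.reduceEqDiff,
        not_false_eq_true, State.setWord_word_of_ne, Function.update_self, Nat.sub_zero] at ht2
      have : (70 * Nat.size N + 400) * N = 70 * (N * Nat.size N) + 400 * N := by ring
      omega
    · have := hs.pos_lt _ hj
      omega

/-- Store the points with both coordinates multiplied by the signs `sx` and `sy` in real arrays 5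
and 6, blue points first, and their number in variable 4. -/
def loadPoints (sx sy : ℤ) : Prog :=
  let red := WExpr.sub (wvar 8) (wvar 0)
  .seq (.seq (wset 4 (.add (wvar 0) (.read 0 (.lit 1)))) (wset 8 (.lit 0)))
    (.loop (.wlt (wvar 8) (wvar 4))
      (.seq
        (.branch (.wlt (wvar 8) (wvar 0))
          (.seq (.setReal 5 (wvar 8) (.mul (.lit sx) (.read 0 (wvar 8))))
            (.setReal 6 (wvar 8) (.mul (.lit sy) (.read 1 (wvar 8)))))
          (.seq (.setReal 5 (wvar 8) (.mul (.lit sx) (.read 2 red)))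
            (.setReal 6 (wvar 8) (.mul (.lit sy) (.read 3 red)))))
        (wset 8 (.add (wvar 8) (.lit 1)))))

theorem loadPoints_spec {M : ℕ} (sx sy : ℤ) {s : State} (hM : s.word 0 0 + s.word 0 1 + 2 < M) :
    WP M (loadPoints sx sy) s fun t s' => t ≤ 60 * (s.word 0 0 + s.word 0 1) + 30 ∧
      s'.word 4 0 = s.word 0 0 + s.word 0 1 ∧
      ∀ k < s.word 0 0 + s.word 0 1,
        s'.real 5 k = sx * (if k < s.word 0 0 then s.real 0 k else s.real 2 (k - s.word 0 0)) ∧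
        s'.real 6 k = sy * (if k < s.word 0 0 then s.real 1 k else s.real 3 (k - s.word 0 0)) := by
  refine .seq (.of_exec rfl (by simp [Prog.SafeAt, WExpr.Safe, WExpr.eval]; omega) ?_)
  intro t ht
  have ht' : t ≤ 10 := ht.trans (by decide)
  simp only [Prog.exec, WExpr.eval]
  set b := s.word 0 0 with hb
  set N := b + s.word 0 1 with hN
  refine (WP.loop (fun s' => s'.word 8 0 ≤ N ∧ s'.word 4 0 = N ∧ ∀ k < s'.word 8 0,
        s'.real 5 k = sx * (if k < b then s.real 0 k else s.real 2 (k - b)) ∧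
        s'.real 6 k = sy * (if k < b then s.real 1 k else s.real 3 (k - b)))
    (fun s' => 60 * (N - s'.word 8 0)) ?_ ?_ ?_).mono ?_
  · simp
  · intro s' _ _
    simp [Test.Safe, WExpr.Safe]; omega
  · rintro s1 hf ⟨h1, h2, h3⟩ hb'
    have e0 : s1.word 0 0 = b := by rw [hf.1 0 rfl]; simp [hb]
    have r0 : s1.real 0 = s.real 0 := by rw [hf.2 0 rfl]; simp
    have r1 : s1.real 1 = s.real 1 := by rw [hf.2 1 rfl]; simp
    have r2 : s1.real 2 = s.real 2 := by rw [hf.2 2 rfl]; simp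
    have r3 : s1.real 3 = s.real 3 := by rw [hf.2 3 rfl]; simp
    simp only [Test.Holds, WExpr.eval, h2] at hb'
    set k := s1.word 8 0 with hk
    refine .of_exec rfl ?_ ?_
    · simp only [Prog.SafeAt, Test.Safe, RExpr.Safe, WExpr.Safe, Prog.exec, WExpr.eval]
      refine ⟨by simp; omega, ?_⟩
      split_ifs <;> simp [← hk] <;> omega
    intro t1 ht1
    have ht1' : t1 ≤ 50 := ht1.trans (by simp [Prog.time, WExpr.cost, RExpr.cost, Test.cost])
    simp only [Prog.exec, Test.Holds, WExpr.eval, RExpr.eval, e0, ← hk, Test.cost, WExpr.cost]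
    by_cases hkb : k < b
    · simp only [hkb, if_true, ne_eq, Nat.reduceEqDiff, not_false_eq_true, State.setReal_word,
        State.setWord_word_self, State.setWord_word_of_ne, Function.update_self,
        State.setWord_real, State.setReal_real_self, State.setReal_real_of_ne, h2, ← hk, r0, r1]
      refine ⟨⟨by omega, trivial, fun i hi => ?_⟩, by omega⟩
      by_cases hik : i = k
      · subst hik; simp [hkb]
      · rw [Function.update_of_ne hik, Function.update_of_ne hik]; exact h3 i (by omega)
    · simp only [hkb, if_false, ne_eq, Nat.reduceEqDiff, not_false_eq_true, State.setReal_word,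
        State.setWord_word_self, State.setWord_word_of_ne, Function.update_self, e0,
        State.setWord_real, State.setReal_real_self, State.setReal_real_of_ne, h2, ← hk, r2, r3]
      refine ⟨⟨by omega, trivial, fun i hi => ?_⟩, by omega⟩
      by_cases hik : i = k
      · subst hik; simp [hkb]
      · rw [Function.update_of_ne hik, Function.update_of_ne hik]; exact h3 i (by omega)
  · rintro t2 s1 hf ⟨⟨h1, h2, h3⟩, hb', ht2⟩
    simp only [Test.Holds, WExpr.eval, h2] at hb'
    simp only [Test.cost, WExpr.cost, State.setWord_word_self, Function.update_self,
      Nat.sub_zero] at ht2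
    exact ⟨by omega, h2, fun k hk => h3 k (by omega)⟩

/-- For every red point, the maximal slope of a line from a blue point to its left, after
multiplication of the coordinates with the signs `sx` and `sy`. -/
def tangents (sx sy : ℤ) : Prog :=
  .seq (loadPoints sx sy) (.seq sort tangentSweep)

theorem IsTangent.congr {x y x' y' : ℕ → ℝ} {b z f N : ℕ} {v : ℝ} (hb : b ≤ N) (hz : z < N)
    (hx : ∀ k < N, x k = x' k) (hy : ∀ k < N, y k = y' k) (h : IsTangent x y b z f v) :
    IsTangent x' y' b z f v := by
  have hs : ∀ q < b, slo x y q z = slo x' y' q z := fun q hq => by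
    unfold slo; rw [hx q (by omega), hy q (by omega), hx z hz, hy z hz]
  have hl : ∀ q < b, (x q < x z ↔ x' q < x' z) := fun q hq => by
    rw [hx q (by omega), hx z hz]
  rcases h with ⟨h1, ⟨q, hq, hqz, hv⟩, h3⟩ | ⟨h1, h2⟩
  · refine .inl ⟨h1, ⟨q, hq, (hl q hq).1 hqz, by rw [hv, hs q hq]⟩, fun q hq hqz => ?_⟩
    rw [← hs q hq]; exact h3 q hq ((hl q hq).2 hqz)
  · exact .inr ⟨h1, fun q hq hqz => h2 q hq ((hl q hq).2 hqz)⟩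

/-- The sequence `f 0, …, f (b - 1), g 0, g 1, …`. -/
noncomputable def join (b : ℕ) (f g : ℕ → ℝ) (k : ℕ) : ℝ := if k < b then f k else g (k - b)

theorem tangents_spec {M b m : ℕ} {sx sy : ℤ} (hsx : sx ≠ 0) {s : State}
    (hM : 8 * (b + m) + 8 < M)
    (hM2 : s.word 17 0 + (b + m) < M) (hb : s.word 0 0 = b) (hm : s.word 0 1 = m)
    (hxi : ∀ i < b + m, ∀ j < b + m,
      join b (s.real 0) (s.real 2) i = join b (s.real 0) (s.real 2) j → i = j) :
    WP M (tangents sx sy) s fun t s' =>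
      t ≤ 2000 * ((b + m + 1) * Nat.size (4 * (b + m) + 2)) ∧
      (∀ j < m, IsTangent (fun k => sx * join b (s.real 0) (s.real 2) k)
        (fun k => sy * join b (s.real 1) (s.real 3) k) b (b + j) (s'.word 16 (s.word 17 0 + j))
        (s'.real 9 (s.word 17 0 + j))) ∧
      ∀ c, c < s.word 17 0 → s'.word 16 c = s.word 16 c ∧ s'.real 9 c = s.real 9 c := by
  refine .seq ((loadPoints_spec sx sy (by omega)).mono ?_)
  rintro t1 s1 hf1 ⟨ht1, h4, hl⟩
  rw [hb, hm] at ht1 h4 hl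
  refine .seq ((sort_spec (by omega)).mono ?_)
  rintro t2 s2 hf2 ⟨ht2, hS, -⟩
  rw [h4] at ht2 hS
  have e5 : s2.real 5 = s1.real 5 := hf2.2 5 rfl
  have e0 : s2.word 0 = s.word 0 := (hf2.1 0 rfl).trans (hf1.1 0 rfl)
  have e4 : s2.word 4 0 = b + m := (congrFun (hf2.1 4 rfl) 0).trans h4
  have e17 : s2.word 17 0 = s.word 17 0 := by rw [hf2.1 17 rfl, hf1.1 17 rfl]
  have e16 : s2.word 16 = s.word 16 := by rw [hf2.1 16 rfl, hf1.1 16 rfl]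
  have e9 : s2.real 9 = s.real 9 := by rw [hf2.2 9 rfl, hf1.2 9 rfl]
  refine (tangentSweep_spec (b := b) (N := b + m) (x := s1.real 5) (y := s2.real 6) (by omega)
    (by omega) e5 rfl (by omega) (by rw [e0, hb]) e4 ?_ hS).mono ?_
  · intro i hi j hj h
    refine hxi i hi j hj ?_
    rw [(hl i hi).1, (hl j hj).1] at h
    exact mul_left_cancel₀ (Int.cast_ne_zero.2 hsx) h
  rintro t3 s3 - ⟨ht3, hT, hc⟩
  rw [e17, e16, e9] at hc
  rw [e17] at hT
  refine ⟨?_, fun j hj => ?_, hc⟩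
  · have h1 : Nat.size (b + m) ≤ Nat.size (4 * (b + m) + 2) := Nat.size_le_size (by omega)
    have h2 : 1 ≤ Nat.size (4 * (b + m) + 2) := Nat.size_pos.2 (by omega)
    set L := Nat.size (4 * (b + m) + 2)
    have h3 : (b + m) * Nat.size (b + m) ≤ (b + m + 1) * L := Nat.mul_le_mul (by omega) h1
    have h4 : b + m + 1 ≤ (b + m + 1) * L := Nat.le_mul_of_pos_right _ h2
    omega
  · refine (hT j (by omega)).congr (N := b + m) (by omega) (by omega) (fun k hk => (hl k hk).1)
      fun k hk => ?_
    rw [hf2.2 6 rfl]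
    exact (hl k hk).2

/-- The slopes of tangents from all red points: maximal slopes of lines from blue points to the left,
minimal slopes to the right (negated), maximal slopes to the right, and minimal slopes to the left
(negated), at offsets
0, `m`, `2 * m` and `3 * m`, where `m` is the number of red points. -/
def allTangents : Prog :=
  .seq (wset 17 (.lit 0)) (.seq (tangents 1 1)
  (.seq (wset 17 (.add (wvar 17) (.read 0 (.lit 1)))) (.seq (tangents (-1) 1)
  (.seq (wset 17 (.add (wvar 17) (.read 0 (.lit 1)))) (.seq (tangents (-1) (-1))
  (.seq (wset 17 (.add (wvar 17) (.read 0 (.lit 1)))) (tangents 1 (-1))))))))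

theorem allTangents_spec {M b m : ℕ} {s : State} (hM : 8 * (b + m) + 8 < M)
    (hb : s.word 0 0 = b) (hm : s.word 0 1 = m)
    (hxi : ∀ i < b + m, ∀ j < b + m,
      join b (s.real 0) (s.real 2) i = join b (s.real 0) (s.real 2) j → i = j) :
    WP M allTangents s fun t s' =>
      t ≤ 8100 * ((b + m + 1) * Nat.size (4 * (b + m) + 2)) ∧
      ∀ i < 4, ∀ j < m,
        IsTangent (fun k => (if i = 0 ∨ i = 3 then 1 else -1) * join b (s.real 0) (s.real 2) k)
          (fun k => (if i < 2 then 1 else -1) * join b (s.real 1) (s.real 3) k) b (b + j)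
          (s'.word 16 (i * m + j)) (s'.real 9 (i * m + j)) := by
  have hstep : ∀ {sx sy : ℤ} {s' : State} {n : ℕ}, sx ≠ 0 → n ≤ 3 → allTangents.Frame s s' →
      s'.word 17 0 = n * m → WP M (tangents sx sy) s' fun t s'' =>
      t ≤ 2000 * ((b + m + 1) * Nat.size (4 * (b + m) + 2)) ∧ allTangents.Frame s s'' ∧
      s''.word 17 0 = n * m ∧
      (∀ j < m, IsTangent (fun k => sx * join b (s.real 0) (s.real 2) k)
        (fun k => sy * join b (s.real 1) (s.real 3) k) b (b + j) (s''.word 16 (n * m + j))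
        (s''.real 9 (n * m + j))) ∧
      ∀ c, c < n * m → s''.word 16 c = s'.word 16 c ∧ s''.real 9 c = s'.real 9 c := by
    intro sx sy s' n hsx hn hf h17
    have e0 : s'.word 0 = s.word 0 := hf.1 0 rfl
    have hnm : n * m ≤ 3 * m := Nat.mul_le_mul_right m hn
    refine (tangents_spec (b := b) (m := m) hsx hM (by omega) (by rw [e0, hb]) (by rw [e0, hm])
      (by rw [hf.2 0 rfl, hf.2 2 rfl]; exact hxi)).mono ?_
    rintro t s'' hf' ⟨ht, h1, h2⟩
    rw [h17, hf.2 0 rfl, hf.2 1 rfl, hf.2 2 rfl, hf.2 3 rfl] at h1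
    rw [h17] at h2
    refine ⟨ht, hf.trans (hf'.mono (fun a h => ?_) (fun a h => ?_)), ?_, h1, h2⟩
    · simp only [allTangents, tangents, Prog.writesWord, loadPoints, sort, tangentSweep, powTwo,
        climb, build, matchNode, seedLeaf, pushBlue, queryRed, Bool.or_eq_false_iff] at h ⊢
      tauto
    · simp only [allTangents, tangents, Prog.writesReal, loadPoints, sort, tangentSweep, powTwo,
        climb, build, matchNode, seedLeaf, pushBlue, queryRed, Bool.or_eq_false_iff] at h ⊢
      tauto
    · rw [hf'.1 17 rfl, h17]
  have hset : ∀ {s' : State} {n : ℕ} {Q : ℕ → State → Prop}, n ≤ 2 → allTangents.Frame s s' →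
      s'.word 17 0 = n * m →
      (∀ t ≤ 10, Q t (s'.setWord 17 0 (s'.word 17 0 + s'.word 0 1))) →
      WP M (wset 17 (.add (wvar 17) (.read 0 (.lit 1)))) s' Q := by
    intro s' n Q hn hf h17 hQ
    have e0 : s'.word 0 = s.word 0 := hf.1 0 rfl
    have hnm : n * m ≤ 2 * m := Nat.mul_le_mul_right m hn
    refine .of_exec rfl ?_ fun t ht => hQ t (ht.trans (by decide))
    simp [Prog.SafeAt, WExpr.Safe, WExpr.eval, h17, e0, hm]; omega
  have hframe : ∀ {s' : State} {v : ℕ}, allTangents.Frame s s' →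
      allTangents.Frame s (s'.setWord 17 0 v) := by
    intro s' v hf
    refine ⟨fun a ha => ?_, hf.2⟩
    have : a ≠ 17 := by rintro rfl; exact absurd ha (by decide)
    rw [State.setWord_word_of_ne _ _ _ _ this, hf.1 a ha]
  have h17 : ∀ {s' : State} {n : ℕ}, allTangents.Frame s s' → s'.word 17 0 = n * m →
      (s'.setWord 17 0 (s'.word 17 0 + s'.word 0 1)).word 17 0 = (n + 1) * m := by
    intro s' n hf h
    rw [State.setWord_word_self, Function.update_self, h, hf.1 0 rfl, hm, Nat.succ_mul]
  refine .seq (.of_exec rfl (by simp [Prog.SafeAt, WExpr.Safe]; omega) fun t0 ht0 => ?_)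
  have ht0' : t0 ≤ 3 := ht0
  simp only [Prog.exec, WExpr.eval]
  have f0 : allTangents.Frame s (s.setWord 17 0 0) := hframe (Prog.Frame.refl _ _)
  refine .seq ((hstep (n := 0) (by decide) (by omega) f0 (by simp)).mono ?_)
  rintro t1 s1 - ⟨ht1, f1, w1, T1, -⟩
  refine .seq (hset (n := 0) (by omega) f1 w1 fun t1' ht1' => ?_)
  refine .seq ((hstep (n := 1) (by decide) (by omega) (hframe f1) (h17 f1 w1)).mono ?_)
  rintro t2 s2 - ⟨ht2, f2, w2, T2, c2⟩
  refine .seq (hset (n := 1) (by omega) f2 w2 fun t2' ht2' => ?_)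
  refine .seq ((hstep (n := 2) (by decide) (by omega) (hframe f2) (h17 f2 w2)).mono ?_)
  rintro t3 s3 - ⟨ht3, f3, w3, T3, c3⟩
  refine .seq (hset (n := 2) (by omega) f3 w3 fun t3' ht3' => ?_)
  refine (hstep (n := 3) (by decide) (by omega) (hframe f3) (h17 f3 w3)).mono ?_
  rintro t4 s4 - ⟨ht4, f4, w4, T4, c4⟩
  simp only [ne_eq, Nat.reduceEqDiff, not_false_eq_true, State.setWord_word_of_ne,
    State.setWord_real] at c2 c3 c4
  constructor
  · have h2 : 1 ≤ Nat.size (4 * (b + m) + 2) := Nat.size_pos.2 (by omega)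
    have h4 : b + m + 1 ≤ (b + m + 1) * Nat.size (4 * (b + m) + 2) :=
      Nat.le_mul_of_pos_right _ h2
    omega
  intro i hi j hj
  interval_cases i
  · rw [(c4 _ (by omega)).1, (c4 _ (by omega)).2, (c3 _ (by omega)).1, (c3 _ (by omega)).2,
      (c2 _ (by omega)).1, (c2 _ (by omega)).2]
    simpa using T1 j hj
  · rw [(c4 _ (by omega)).1, (c4 _ (by omega)).2, (c3 _ (by omega)).1, (c3 _ (by omega)).2]
    simpa using T2 j hj
  · rw [(c4 _ (by omega)).1, (c4 _ (by omega)).2]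
    simpa using T3 j hj
  · simpa using T4 j hj

/-! ### The intervals of admissible slopes -/

/-- Compute in real variable 10 a number that exceeds the absolute values of all slopes found: the
sum of these absolute values, plus 1. -/
def slopeBound : Prog :=
  .seq (.seq (rset 10 (.lit 1)) (wset 8 (.lit 0)))
    (.loop (.wlt (wvar 8) (.mul (.lit 4) (.read 0 (.lit 1))))
      (.seq
        (.branch (.rlt (.read 9 (wvar 8)) (.lit 0))
          (rset 10 (.sub (rvar 10) (.read 9 (wvar 8))))
          (rset 10 (.add (rvar 10) (.read 9 (wvar 8)))))
        (wset 8 (.add (wvar 8) (.lit 1)))))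

theorem slopeBound_spec {M m : ℕ} {s : State} (hM : 4 * m + 8 < M) (hm : s.word 0 1 = m) :
    WP M slopeBound s fun t s' => t ≤ 200 * m + 30 ∧ 0 < s'.real 10 0 ∧
      ∀ k < 4 * m, |s.real 9 k| < s'.real 10 0 := by
  refine .seq (.of_exec rfl (by simp [Prog.SafeAt, RExpr.Safe, WExpr.Safe]; omega) ?_)
  intro t ht
  have ht' : t ≤ 10 := ht.trans (by decide)
  simp only [Prog.exec, WExpr.eval, RExpr.eval]
  refine (WP.loop (fun s' => s'.word 8 0 ≤ 4 * m ∧ 1 ≤ s'.real 10 0 ∧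
    ∀ k < s'.word 8 0, |s.real 9 k| < s'.real 10 0)
    (fun s' => 50 * (4 * m - s'.word 8 0)) ?_ ?_ ?_).mono ?_
  · simp
  · intro s' hf _
    have e0 : s'.word 0 1 = m := by rw [hf.1 0 rfl]; simp [hm]
    simp [Test.Safe, WExpr.Safe, WExpr.eval, e0]; omega
  · rintro s1 hf ⟨h1, h2, h3⟩ hb
    have e0 : s1.word 0 1 = m := by rw [hf.1 0 rfl]; simp [hm]
    have e9 : s1.real 9 = s.real 9 := by rw [hf.2 9 rfl]; simp
    simp only [Test.Holds, WExpr.eval, e0] at hb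
    refine .seq (.branch (by simp [Test.Safe, RExpr.Safe, WExpr.Safe]; omega)
      (fun hc => ?_) (fun hc => ?_))
    all_goals
      simp only [Test.Holds, WExpr.eval, RExpr.eval, e9, Int.cast_zero] at hc
      refine .of_exec rfl (by simp [Prog.SafeAt, RExpr.Safe, WExpr.Safe]; omega) ?_
      intro t1 ht1
      have ht1' : t1 ≤ 20 := ht1.trans (by decide)
      refine .of_exec rfl (by simp [Prog.SafeAt, Prog.exec, WExpr.Safe, WExpr.eval]; omega) ?_
      intro t2 ht2
      have ht2' : t2 ≤ 6 := ht2
      simp only [Prog.exec, WExpr.eval, RExpr.eval, State.setWord_word_self, Function.update_self,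
        State.setWord_real, State.setReal_real_self, State.setReal_word, e9, Test.cost, WExpr.cost,
        RExpr.cost]
      refine ⟨⟨by omega, by linarith, fun k hk => ?_⟩, by omega⟩
      rcases Nat.lt_or_ge k (s1.word 8 0) with h | h
      · have := h3 k h
        linarith
      · rw [show k = s1.word 8 0 by omega]
        first | rw [abs_of_neg hc] | rw [abs_of_nonneg (not_lt.1 hc)]
        linarith
  · rintro t1 s1 hf ⟨⟨h1, h2, h3⟩, hb, ht1⟩
    have e0 : s1.word 0 1 = m := by rw [hf.1 0 rfl]; simp [hm]
    simp only [Test.Holds, WExpr.eval, e0] at hb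
    simp only [Test.cost, WExpr.cost, State.setWord_word_self, Function.update_self,
      Nat.sub_zero] at ht1
    exact ⟨by omega, by linarith, fun k hk => h3 k (by omega)⟩

/-- The number `l` is the largest slope `σ q` over the indices `q < b` in `S`, which is smaller in
absolute value than `K`; or `l = -K`, and there is no such index. -/
def IsMaxSlope (b : ℕ) (K : ℝ) (S : ℕ → Prop) (σ : ℕ → ℝ) (l : ℝ) : Prop :=
  (∀ q < b, S q → σ q ≤ l) ∧
    (l = -K ∧ (∀ q < b, ¬ S q) ∨ |l| < K ∧ ∃ q < b, S q ∧ l = σ q)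

/-- The number `u` is the smallest slope `σ q` over the indices `q < b` in `S`, which is smaller in
absolute value than `K`; or `u = K`, and there is no such index. -/
def IsMinSlope (b : ℕ) (K : ℝ) (S : ℕ → Prop) (σ : ℕ → ℝ) (u : ℝ) : Prop :=
  (∀ q < b, S q → u ≤ σ q) ∧
    (u = K ∧ (∀ q < b, ¬ S q) ∨ |u| < K ∧ ∃ q < b, S q ∧ u = σ q)

/-- The arrays `e₁` and `e₂` hold, for every red point `j < m`, the endpoints (the left one in cell
`j`, the right one in cell `m + j`) of the intervals of slopes of lines that pass above the red
point and below all blue points, and vice versa. Infinite endpoints are replaced by `-K` and `K`.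
The first `b` points of the sequence with coordinates `X` and `Y` are blue, the next `m` are red. -/
structure IsEnds (b m : ℕ) (X Y : ℕ → ℝ) (K : ℝ) (e₁ e₂ : ℕ → ℝ) : Prop where
  pos : 0 < K
  lower_left : ∀ j < m, IsMaxSlope b K (fun q => X q < X (b + j)) (fun q => slo X Y q (b + j)) (e₁ j)
  lower_right : ∀ j < m,
    IsMinSlope b K (fun q => X (b + j) < X q) (fun q => slo X Y q (b + j)) (e₁ (m + j))
  upper_left : ∀ j < m, IsMaxSlope b K (fun q => X (b + j) < X q) (fun q => slo X Y q (b + j)) (e₂ j)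
  upper_right : ∀ j < m,
    IsMinSlope b K (fun q => X q < X (b + j)) (fun q => slo X Y q (b + j)) (e₂ (m + j))

/-- Store in cell `c` of real array `a` the slope in cell `i` of real array 9 if its flag is set,
and `-K` otherwise. -/
def storeMax (a : ℕ) (c i : WExpr) : Prog :=
  .branch (.wlt (.lit 0) (.read 16 i)) (.setReal a c (.read 9 i))
    (.setReal a c (.sub (.lit 0) (rvar 10)))

/-- Store in cell `c` of real array `a` the negated slope in cell `i` of real array 9 if its flag
is set, and `K` otherwise. -/
def storeMin (a : ℕ) (c i : WExpr) : Prog :=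
  .branch (.wlt (.lit 0) (.read 16 i)) (.setReal a c (.sub (.lit 0) (.read 9 i)))
    (.setReal a c (rvar 10))

theorem storeMax_spec {M a b z : ℕ} {c i : WExpr} {s : State} {x y : ℕ → ℝ} (hM : 0 < M)
    (hc : c.Safe M s) (hi : i.Safe M s) (hcost : c.cost + 2 * i.cost ≤ 60)
    (hT : IsTangent x y b z (s.word 16 (i.eval s)) (s.real 9 (i.eval s)))
    (hK : |s.real 9 (i.eval s)| < s.real 10 0) :
    WP M (storeMax a c i) s fun t s' => t ≤ 80 ∧ ∃ v, s' = s.setReal a (c.eval s) v ∧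
      IsMaxSlope b (s.real 10 0) (fun q => x q < x z) (fun q => slo x y q z) v := by
  refine .branch ⟨hM, hi⟩ (fun h => ?_) (fun h => ?_)
  · refine .of_exec rfl ⟨hc, hi⟩ fun t ht => ?_
    simp only [Prog.time, RExpr.cost] at ht
    refine ⟨by simp only [Test.cost, WExpr.cost]; omega, _, rfl, ?_⟩
    rcases hT with ⟨h1, ⟨q, hq, hqz, hv⟩, h3⟩ | ⟨h1, h2⟩
    · exact ⟨h3, .inr ⟨hK, q, hq, hqz, hv⟩⟩
    · simp [Test.Holds, WExpr.eval, h1] at h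
  · refine .of_exec rfl ⟨hc, trivial, hM⟩ fun t ht => ?_
    simp only [Prog.time, RExpr.cost, WExpr.cost] at ht
    refine ⟨by simp only [Test.cost, WExpr.cost]; omega, _, rfl, ?_⟩
    rcases hT with ⟨h1, -⟩ | ⟨h1, h2⟩
    · simp [Test.Holds, WExpr.eval, h1] at h
    · exact ⟨fun q hq hqz => absurd hqz (h2 q hq), .inl ⟨by simp [RExpr.eval, WExpr.eval], h2⟩⟩

theorem storeMin_spec {M a b z : ℕ} {c i : WExpr} {s : State} {x y : ℕ → ℝ} (hM : 0 < M)
    (hc : c.Safe M s) (hi : i.Safe M s) (hcost : c.cost + 2 * i.cost ≤ 60)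
    (hT : IsTangent x y b z (s.word 16 (i.eval s)) (s.real 9 (i.eval s)))
    (hK : |s.real 9 (i.eval s)| < s.real 10 0) :
    WP M (storeMin a c i) s fun t s' => t ≤ 80 ∧ ∃ v, s' = s.setReal a (c.eval s) v ∧
      IsMinSlope b (s.real 10 0) (fun q => x q < x z) (fun q => - slo x y q z) v := by
  refine .branch ⟨hM, hi⟩ (fun h => ?_) (fun h => ?_)
  · refine .of_exec rfl ⟨hc, trivial, hi⟩ fun t ht => ?_
    simp only [Prog.time, RExpr.cost] at ht
    refine ⟨by simp only [Test.cost, WExpr.cost]; omega, _, rfl, ?_⟩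
    simp only [RExpr.eval, Int.cast_zero, zero_sub]
    rcases hT with ⟨h1, ⟨q, hq, hqz, hv⟩, h3⟩ | ⟨h1, h2⟩
    · exact ⟨fun q hq hqz => neg_le_neg (h3 q hq hqz),
        .inr ⟨by rwa [abs_neg], q, hq, hqz, by rw [hv]⟩⟩
    · simp [Test.Holds, WExpr.eval, h1] at h
  · refine .of_exec rfl ⟨hc, hM⟩ fun t ht => ?_
    simp only [Prog.time, RExpr.cost, WExpr.cost] at ht
    refine ⟨by simp only [Test.cost, WExpr.cost]; omega, _, rfl, ?_⟩
    rcases hT with ⟨h1, -⟩ | ⟨h1, h2⟩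
    · simp [Test.Holds, WExpr.eval, h1] at h
    · exact ⟨fun q hq hqz => absurd hqz (h2 q hq), .inl ⟨by simp [RExpr.eval, WExpr.eval], h2⟩⟩

/-- Store the endpoints of the intervals in real arrays 14 and 15. -/
def storeEnds : Prog :=
  let m := WExpr.read 0 (.lit 1)
  let j := wvar 8
  .seq (wset 8 (.lit 0))
    (.loop (.wlt j m)
      (.seq (storeMax 14 j (.add (.mul (.lit 0) m) j))
      (.seq (storeMin 14 (.add m j) (.add (.mul (.lit 1) m) j))
      (.seq (storeMax 15 j (.add (.mul (.lit 2) m) j))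
      (.seq (storeMin 15 (.add m j) (.add (.mul (.lit 3) m) j))
        (wset 8 (.add j (.lit 1))))))))

theorem slo_neg_left (X Y : ℕ → ℝ) (p q : ℕ) : slo (fun k => -X k) Y p q = -slo X Y p q := by
  unfold slo
  rw [← neg_sub', div_neg, sub_eq_add_neg]

theorem slo_neg_right (X Y : ℕ → ℝ) (p q : ℕ) : slo X (fun k => -Y k) p q = -slo X Y p q := by
  unfold slo
  rw [← neg_sub', neg_div]

theorem storeEnds_spec {M b m : ℕ} {X Y : ℕ → ℝ} {s : State} (hM : 4 * m + 8 < M)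
    (hm : s.word 0 1 = m) (hK0 : 0 < s.real 10 0)
    (hT : ∀ i < 4, ∀ j < m,
        IsTangent (fun k => (if i = 0 ∨ i = 3 then 1 else -1) * X k)
          (fun k => (if i < 2 then 1 else -1) * Y k) b (b + j)
          (s.word 16 (i * m + j)) (s.real 9 (i * m + j)))
    (hK : ∀ k < 4 * m, |s.real 9 k| < s.real 10 0) :
    WP M storeEnds s fun t s' => t ≤ 400 * m + 20 ∧
      IsEnds b m X Y (s.real 10 0) (s'.real 14) (s'.real 15) := by
  set K := s.real 10 0
  refine .seq (.of_exec rfl (by simp [Prog.SafeAt, WExpr.Safe]; omega) ?_)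
  intro t ht
  have ht' : t ≤ 3 := ht
  simp only [Prog.exec, WExpr.eval]
  refine (WP.loop (fun s' => s'.word 8 0 ≤ m ∧
    (∀ j < s'.word 8 0,
      IsMaxSlope b K (fun q => X q < X (b + j)) (fun q => slo X Y q (b + j)) (s'.real 14 j) ∧
      IsMinSlope b K (fun q => X (b + j) < X q) (fun q => slo X Y q (b + j)) (s'.real 14 (m + j)) ∧
      IsMaxSlope b K (fun q => X (b + j) < X q) (fun q => slo X Y q (b + j)) (s'.real 15 j) ∧
      IsMinSlope b K (fun q => X q < X (b + j)) (fun q => slo X Y q (b + j)) (s'.real 15 (m + j))))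
    (fun s' => 400 * (m - s'.word 8 0)) ?_ ?_ ?_).mono ?_
  · simp
  · intro s' _ _
    simp [Test.Safe, WExpr.Safe]; omega
  · rintro s0 hf ⟨h1, h2⟩ hb
    have w0 : s0.word 0 1 = m := by rw [hf.1 0 rfl]; simp [hm]
    have w16 : s0.word 16 = s.word 16 := by rw [hf.1 16 rfl]; simp
    have r9 : s0.real 9 = s.real 9 := by rw [hf.2 9 rfl]; simp
    have r10 : s0.real 10 0 = K := by rw [hf.2 10 rfl]; simp [K]
    simp only [Test.Holds, WExpr.eval, w0] at hb
    obtain ⟨k, hk⟩ : ∃ k, s0.word 8 0 = k := ⟨_, rfl⟩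
    rw [hk] at h1 h2 hb
    have hsafe : ∀ s' : State, s'.word = s0.word → ∀ i < 4,
        (WExpr.add (.mul (.lit i) (.read 0 (.lit 1))) (wvar 8)).Safe M s' := by
      intro s' hs' i hi
      have := Nat.mul_le_mul_right m (show i ≤ 3 by omega)
      simp [WExpr.Safe, WExpr.eval, hs', w0, hk]; omega
    have hsafe1 : ∀ s' : State, s'.word = s0.word →
        (WExpr.add (.read 0 (.lit 1)) (wvar 8)).Safe M s' := by
      intro s' hs'
      simp [WExpr.Safe, WExpr.eval, hs', w0, hk]; omega
    have heval : ∀ s' : State, s'.word = s0.word → ∀ i,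
        (WExpr.add (.mul (.lit i) (.read 0 (.lit 1))) (wvar 8)).eval s' = i * m + k := by
      intro s' hs' i
      simp [WExpr.eval, hs', w0, hk]
    have heval1 : ∀ s' : State, s'.word = s0.word →
        (WExpr.add (.read 0 (.lit 1)) (wvar 8)).eval s' = m + k := by
      intro s' hs'
      simp [WExpr.eval, hs', w0, hk]
    have hlt : ∀ i < 4, i * m + k < 4 * m := by
      intro i hi
      have := Nat.mul_le_mul_right m (show i ≤ 3 by omega)
      omega
    have hstep : ∀ {s' : State}, s'.word = s0.word → s'.real 9 = s.real 9 → s'.real 10 0 = K →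
        ∀ i < 4, IsTangent (fun k => (if i = 0 ∨ i = 3 then 1 else -1) * X k)
          (fun k => (if i < 2 then 1 else -1) * Y k) b (b + k)
          (s'.word 16 ((WExpr.add (.mul (.lit i) (.read 0 (.lit 1))) (wvar 8)).eval s'))
          (s'.real 9 ((WExpr.add (.mul (.lit i) (.read 0 (.lit 1))) (wvar 8)).eval s')) ∧
        |s'.real 9 ((WExpr.add (.mul (.lit i) (.read 0 (.lit 1))) (wvar 8)).eval s')| <
          s'.real 10 0 := by
      intro s' hw h9 h10 i hi
      rw [heval s' hw, h9, h10, hw, w16]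
      exact ⟨hT i hi k hb, hK _ (hlt i hi)⟩
    have hS : ∀ s' : State, s'.word = s0.word → (wvar 8).Safe M s' := by
      intro s' _; simp [WExpr.Safe]; omega
    have hE : ∀ s' : State, s'.word = s0.word → (wvar 8).eval s' = k := by
      intro s' hw; simp [WExpr.eval, hw, hk]
    -- The sign changes of the four tangent computations turn maxima into minima.
    refine .seq ((storeMax_spec (by omega) (hS s0 rfl) (hsafe s0 rfl 0 (by omega))
      (by decide) (hstep rfl r9 r10 0 (by omega)).1 (hstep rfl r9 r10 0 (by omega)).2).mono ?_)
    rintro t1 s1 - ⟨ht1, v1, e1, H1⟩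
    rw [hE s0 rfl] at e1
    rw [r10] at H1
    have w1 : s1.word = s0.word := by rw [e1]; rfl
    have r91 : s1.real 9 = s.real 9 := by rw [e1]; simp [r9]
    have r101 : s1.real 10 0 = K := by rw [e1]; simp [r10]
    refine .seq ((storeMin_spec (by omega) (hsafe1 s1 w1) (hsafe s1 w1 1 (by omega))
      (by decide) (hstep w1 r91 r101 1 (by omega)).1 (hstep w1 r91 r101 1 (by omega)).2).mono ?_)
    rintro t2 s2 - ⟨ht2, v2, e2, H2⟩
    rw [heval1 s1 w1] at e2
    rw [r101] at H2
    have w2 : s2.word = s0.word := by rw [e2]; exact w1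
    have r92 : s2.real 9 = s.real 9 := by rw [e2]; simp [r91]
    have r102 : s2.real 10 0 = K := by rw [e2]; simp [r101]
    refine .seq ((storeMax_spec (by omega) (hS s2 w2) (hsafe s2 w2 2 (by omega))
      (by decide) (hstep w2 r92 r102 2 (by omega)).1 (hstep w2 r92 r102 2 (by omega)).2).mono ?_)
    rintro t3 s3 - ⟨ht3, v3, e3, H3⟩
    rw [hE s2 w2] at e3
    rw [r102] at H3
    have w3 : s3.word = s0.word := by rw [e3]; exact w2
    have r93 : s3.real 9 = s.real 9 := by rw [e3]; simp [r92]
    have r103 : s3.real 10 0 = K := by rw [e3]; simp [r102]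
    refine .seq ((storeMin_spec (by omega) (hsafe1 s3 w3) (hsafe s3 w3 3 (by omega))
      (by decide) (hstep w3 r93 r103 3 (by omega)).1 (hstep w3 r93 r103 3 (by omega)).2).mono ?_)
    rintro t4 s4 - ⟨ht4, v4, e4, H4⟩
    rw [heval1 s3 w3] at e4
    rw [r103] at H4
    have w4 : s4.word = s0.word := by rw [e4]; exact w3
    have r14 : s4.real 14 = Function.update (Function.update (s0.real 14) k v1) (m + k) v2 := by
      rw [e4, e3, e2, e1]; simp
    have r15 : s4.real 15 = Function.update (Function.update (s0.real 15) k v3) (m + k) v4 := by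
      rw [e4, e3, e2, e1]; simp
    refine .of_exec rfl ?_ fun t5 ht5 => ?_
    · simp [Prog.SafeAt, WExpr.Safe, WExpr.eval, w4, hk]; omega
    have ht5' : t5 ≤ 6 := ht5
    simp only [Prog.exec, WExpr.eval, State.setWord_word_self, Function.update_self,
      State.setWord_real, w4, hk, r14, r15, Test.cost, WExpr.cost]
    refine ⟨⟨by omega, fun j hj => ?_⟩, by omega⟩
    by_cases hjk : j = k
    · subst hjk
      rw [Function.update_self, Function.update_of_ne (by omega), Function.update_self,
        Function.update_self, Function.update_of_ne (by omega), Function.update_self]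
      simp only [true_or, or_true, if_true, show ¬ ((1 : ℕ) = 0 ∨ (1 : ℕ) = 3) by decide,
        show ¬ ((2 : ℕ) = 0 ∨ (2 : ℕ) = 3) by decide, if_false, show (0 : ℕ) < 2 by decide,
        show (1 : ℕ) < 2 by decide, lt_irrefl, show ¬ (3 : ℕ) < 2 by decide, one_mul, neg_mul,
        neg_lt_neg_iff, slo_neg_left, slo_neg_right, neg_neg] at H1 H2 H3 H4
      exact ⟨H1, H2, H3, H4⟩
    · rw [Function.update_of_ne (by omega), Function.update_of_ne (by omega),
        Function.update_of_ne (by omega), Function.update_of_ne (by omega),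
        Function.update_of_ne (by omega), Function.update_of_ne (by omega),
        Function.update_of_ne (by omega), Function.update_of_ne (by omega)]
      exact h2 j (by omega)
  · rintro t1 s1 hf ⟨⟨h1, h2⟩, hb, ht1⟩
    have w0 : s1.word 0 1 = m := by rw [hf.1 0 rfl]; simp [hm]
    simp only [Test.Holds, WExpr.eval, w0] at hb
    simp only [Test.cost, WExpr.cost, State.setWord_word_self, Function.update_self,
      Nat.sub_zero] at ht1
    refine ⟨by omega, hK0, fun j hj => (h2 j (by omega)).1, fun j hj => (h2 j (by omega)).2.1,
      fun j hj => (h2 j (by omega)).2.2.1, fun j hj => (h2 j (by omega)).2.2.2⟩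

theorem Sorted.congr {v v' : ℕ → ℝ} {N : ℕ} {ord pos pos' : ℕ → ℕ} (h : Sorted v N ord pos)
    (hv : ∀ k < N, v k = v' k) (hp : ∀ k < N, pos k = pos' k) : Sorted v' N ord pos' where
  ord_lt := h.ord_lt
  pos_ord k hk := by rw [← hp _ (h.ord_lt k hk), h.pos_ord k hk]
  pos_lt x hx := by rw [← hp x hx]; exact h.pos_lt x hx
  ord_pos x hx := by rw [← hp x hx]; exact h.ord_pos x hx
  before k₁ k₂ h1 h2 := by
    have := h.before k₁ k₂ h1 h2
    unfold Before at this ⊢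
    rwa [hv _ (h.ord_lt k₁ (by omega)), hv _ (h.ord_lt k₂ h2)] at this

/-- Copy the endpoints in real array `a` to the array that is to be sorted. -/
def loadKeys (a : ℕ) : Prog :=
  .seq (.seq (wset 4 (.mul (.lit 2) (.read 0 (.lit 1)))) (wset 8 (.lit 0)))
    (.loop (.wlt (wvar 8) (wvar 4))
      (.seq (.setReal 5 (wvar 8) (.read a (wvar 8))) (wset 8 (.add (wvar 8) (.lit 1)))))

theorem loadKeys_spec {M m a : ℕ} {s : State} (ha : a ≠ 5) (hM : 2 * m + 8 < M)
    (hm : s.word 0 1 = m) :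
    WP M (loadKeys a) s fun t s' => t ≤ 50 * m + 20 ∧ s'.word 4 0 = 2 * m ∧
      ∀ k < 2 * m, s'.real 5 k = s.real a k := by
  refine .seq (.of_exec rfl (by simp [Prog.SafeAt, WExpr.Safe, WExpr.eval, hm]; omega) ?_)
  intro t ht
  have ht' : t ≤ 10 := ht.trans (by decide)
  simp only [Prog.exec, WExpr.eval, hm]
  refine (WP.loop (fun s' => s'.word 8 0 ≤ 2 * m ∧ s'.word 4 0 = 2 * m ∧ s'.real a = s.real a ∧
    ∀ k < s'.word 8 0, s'.real 5 k = s.real a k)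
    (fun s' => 20 * (2 * m - s'.word 8 0)) ?_ ?_ ?_).mono ?_
  · simp
  · intro s' hf _
    simp [Test.Safe, WExpr.Safe]; omega
  · rintro s1 hf ⟨h1, h2, h3, h4⟩ hb
    simp only [Test.Holds, WExpr.eval, h2] at hb
    refine .of_exec rfl ?_ ?_
    · simp [Prog.SafeAt, Prog.exec, RExpr.Safe, WExpr.Safe, WExpr.eval]; omega
    intro t1 ht1
    have ht1' : t1 ≤ 12 := ht1
    simp only [Prog.exec, WExpr.eval, RExpr.eval, ne_eq, Nat.reduceEqDiff, not_false_eq_true,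
      State.setReal_word, State.setWord_word_self, State.setWord_word_of_ne, Function.update_self,
      State.setWord_real, State.setReal_real_self, State.setReal_real_of_ne _ _ _ _ ha, h3,
      Test.cost, WExpr.cost]
    refine ⟨⟨by omega, h2, trivial, fun k hk => ?_⟩, by omega⟩
    by_cases hk' : k = s1.word 8 0
    · rw [hk', Function.update_self]
    · rw [Function.update_of_ne hk']; exact h4 k (by omega)
  · rintro t1 s1 - ⟨⟨h1, h2, h3, h4⟩, hb, ht1⟩
    simp only [Test.Holds, WExpr.eval, h2] at hb
    simp only [Test.cost, WExpr.cost, State.setWord_word_self, Function.update_self,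
      Nat.sub_zero] at ht1
    exact ⟨by omega, h2, fun k hk => h4 k (by omega)⟩

/-- Copy the positions computed by the sorting program to word array 22. -/
def savePos : Prog :=
  .seq (wset 8 (.lit 0))
    (.loop (.wlt (wvar 8) (wvar 4))
      (.seq (.setWord 22 (wvar 8) (.read 7 (wvar 8))) (wset 8 (.add (wvar 8) (.lit 1)))))

theorem savePos_spec {M N : ℕ} {s : State} (hM : N + 8 < M) (hN : s.word 4 0 = N) :
    WP M savePos s fun t s' => t ≤ 20 * N + 20 ∧ ∀ k < N, s.word 7 k = s'.word 22 k := by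
  refine .seq (.of_exec rfl (by simp [Prog.SafeAt, WExpr.Safe]; omega) ?_)
  intro t ht
  have ht' : t ≤ 10 := ht.trans (by decide)
  simp only [Prog.exec, WExpr.eval]
  refine (WP.loop (fun s' => s'.word 8 0 ≤ N ∧ ∀ k < s'.word 8 0, s.word 7 k = s'.word 22 k)
    (fun s' => 20 * (N - s'.word 8 0)) ?_ ?_ ?_).mono ?_
  · simp
  · intro s' hf _
    simp [Test.Safe, WExpr.Safe]; omega
  · rintro s1 hf ⟨h1, h4⟩ hb
    have e4 : s1.word 4 0 = N := by rw [hf.1 4 rfl]; simp [hN]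
    have e7 : s1.word 7 = s.word 7 := by rw [hf.1 7 rfl]; simp
    simp only [Test.Holds, WExpr.eval, e4] at hb
    refine .of_exec rfl ?_ ?_
    · simp [Prog.SafeAt, Prog.exec, WExpr.Safe, WExpr.eval]; omega
    intro t1 ht1
    have ht1' : t1 ≤ 12 := ht1
    simp only [Prog.exec, WExpr.eval, ne_eq, Nat.reduceEqDiff, not_false_eq_true,
      State.setWord_word_self, State.setWord_word_of_ne, Function.update_self, e7,
      Test.cost, WExpr.cost]
    refine ⟨⟨by omega, fun k hk => ?_⟩, by omega⟩
    by_cases hk' : k = s1.word 8 0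
    · rw [hk', Function.update_self]
    · rw [Function.update_of_ne hk']; exact h4 k (by omega)
  · rintro t1 s1 hf ⟨⟨h1, h4⟩, hb, ht1⟩
    have e4 : s1.word 4 0 = N := by rw [hf.1 4 rfl]; simp [hN]
    simp only [Test.Holds, WExpr.eval, e4] at hb
    simp only [Test.cost, WExpr.cost, State.setWord_word_self, Function.update_self,
      Nat.sub_zero] at ht1
    exact ⟨by omega, fun k hk => h4 k (by omega)⟩

/-- Sort the endpoints of both families of intervals. -/
def sortEnds : Prog :=
  .seq (loadKeys 15) (.seq sort (.seq savePos (.seq (loadKeys 14) sort)))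

theorem sortEnds_spec {M m : ℕ} {s : State} (hM : 16 * m + 8 < M) (hm : s.word 0 1 = m) :
    WP M sortEnds s fun t s' => t ≤ 3000 * ((2 * m + 1) * Nat.size (8 * m + 2)) ∧
      Sorted (s.real 14) (2 * m) (s'.word 6) (s'.word 7) ∧
      (∃ ord, Sorted (s.real 15) (2 * m) ord (s'.word 22)) ∧
      2 * m < s'.word 2 0 ∧ s'.word 2 0 ≤ 4 * m + 1 ∧ ∃ H, s'.word 2 0 = 2 ^ H := by
  refine .seq ((loadKeys_spec (by decide) (by omega) hm).mono ?_)
  rintro t1 s1 f1 ⟨ht1, n1, k1⟩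
  refine .seq ((sort_spec (by omega)).mono ?_)
  rintro t2 s2 f2 ⟨ht2, S2, -⟩
  rw [n1] at ht2 S2
  refine .seq ((savePos_spec (N := 2 * m) (by omega) (by rw [f2.1 4 rfl, n1])).mono ?_)
  rintro t3 s3 f3 ⟨ht3, k3⟩
  have r14 : s3.real 14 = s.real 14 := by rw [f3.2 14 rfl, f2.2 14 rfl, f1.2 14 rfl]
  refine .seq ((loadKeys_spec (m := m) (by decide) (by omega)
    (by rw [f3.1 0 rfl, f2.1 0 rfl, f1.1 0 rfl, hm])).mono ?_)
  rintro t4 s4 f4 ⟨ht4, n4, k4⟩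
  refine (sort_spec (by omega)).mono ?_
  rintro t5 s5 f5 ⟨ht5, S5, P1, P2, H⟩
  rw [n4] at ht5 S5 P1 P2
  refine ⟨?_, S5.congr (fun k hk => ?_) (fun _ _ => rfl), ⟨s2.word 6, ?_⟩, P1, by omega, H⟩
  · rw [show 4 * (2 * m) + 2 = 8 * m + 2 by ring] at ht2 ht5
    have h2 : 1 ≤ Nat.size (8 * m + 2) := Nat.size_pos.2 (by omega)
    have h4 : 2 * m + 1 ≤ (2 * m + 1) * Nat.size (8 * m + 2) := Nat.le_mul_of_pos_right _ h2
    omega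
  · rw [k4 k hk, r14]
  · refine S2.congr (fun k hk => k1 k hk) (fun k hk => ?_)
    rw [f5.1 22 rfl, f4.1 22 rfl, k3 k hk]

/-! ### Maximal prefix sums in a tree -/

/-- The summary of a nonempty sequence of reals consists of its sum, its maximal sum over a nonempty
prefix, and the leaf at which a prefix that attains this maximum ends. This is the summary of a
concatenation in terms of the summaries of both parts. -/
noncomputable def mergeSums (x y : ℝ × ℝ × ℕ) : ℝ × ℝ × ℕ :=
  (x.1 + y.1, if x.2.1 < x.1 + y.2.1 then (x.1 + y.2.1, y.2.2) else x.2)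

/-- The tree of summaries in real arrays 7 and 8 and word array 10. -/
def sumView (s : State) (k : ℕ) : ℝ × ℝ × ℕ := (s.real 7 k, s.real 8 k, s.word 10 k)

/-- Recompute the node in variable 3 of the tree of summaries. -/
def sumNode : Prog :=
  let i := wvar 3
  let l := WExpr.mul (.lit 2) i
  let r := WExpr.add (.mul (.lit 2) i) (.lit 1)
  .seq (.setReal 7 i (.add (.read 7 l) (.read 7 r)))
    (.branch (.rlt (.read 8 l) (.add (.read 7 l) (.read 8 r)))
      (.seq (.setReal 8 i (.add (.read 7 l) (.read 8 r))) (.setWord 10 i (.read 10 r)))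
      (.seq (.setReal 8 i (.read 8 l)) (.setWord 10 i (.read 10 l))))

theorem sumView_update (s : State) (i : ℕ) (x y : ℝ) (a : ℕ) {s' : State}
    (h7 : s'.real 7 = Function.update (s.real 7) i x)
    (h8 : s'.real 8 = Function.update (s.real 8) i y)
    (h10 : s'.word 10 = Function.update (s.word 10) i a) :
    sumView s' = Function.update (sumView s) i (x, y, a) := by
  funext k
  unfold sumView
  rw [h7, h8, h10]
  by_cases hk : k = i
  · subst hk; simp
  · simp [hk]

theorem sumNode_spec {M P : ℕ} {s : State} (hM : 2 * P < M) (hi0 : 0 < s.word 3 0)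
    (hi : s.word 3 0 < P) :
    WP M sumNode s fun t s' => t ≤ 100 ∧ s'.word 3 0 = s.word 3 0 ∧
      sumView s' = Function.update (sumView s) (s.word 3 0)
        (mergeSums (sumView s (2 * s.word 3 0)) (sumView s (2 * s.word 3 0 + 1))) := by
  obtain ⟨i, hii⟩ : ∃ i, s.word 3 0 = i := ⟨_, rfl⟩
  rw [hii] at hi0 hi ⊢
  refine .seq (.of_exec rfl ?_ ?_)
  · simp [Prog.SafeAt, RExpr.Safe, WExpr.Safe, WExpr.eval, hii]; omega
  intro t ht
  have ht' : t ≤ 30 := ht.trans (by decide)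
  simp only [Prog.exec, WExpr.eval, RExpr.eval, hii]
  refine .branch ?_ (fun hc => ?_) (fun hc => ?_)
  · simp [Test.Safe, RExpr.Safe, WExpr.Safe, WExpr.eval, hii]; omega
  all_goals
    simp only [Test.Holds, WExpr.eval, RExpr.eval, State.setReal_word, State.setReal_real_self, hii,
      ne_eq, Nat.reduceEqDiff, not_false_eq_true, State.setReal_real_of_ne,
      Function.update_of_ne (show 2 * i ≠ i by omega)] at hc
    refine .of_exec rfl ?_ fun t1 ht1 => ⟨?_, ?_, ?_⟩
    · simp [Prog.SafeAt, Prog.exec, RExpr.Safe, WExpr.Safe, WExpr.eval, hii]; omega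
    · have ht1' : t1 ≤ 40 := ht1.trans (by decide)
      simp only [Test.cost, RExpr.cost, WExpr.cost]; omega
    · simp [Prog.exec, hii]
    · simp only [mergeSums, sumView, hc, if_true, if_false]
      apply sumView_update
      all_goals
        simp [Prog.exec, WExpr.eval, RExpr.eval, hii, Function.update_of_ne (show 2 * i ≠ i by omega)]

/-- The node `i` at height `h` whose subtree has the leaves `P + o, …, P + o + 2 ^ h - 1` holds the
summary of the corresponding part of the sequence `f`. -/
theorem mergeSums_tree {T : ℕ → ℝ × ℝ × ℕ} {P : ℕ} {f : ℕ → ℝ}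
    (hOK : ∀ k, 0 < k → k < P → NodeOK mergeSums T k)
    (hleaf : ∀ p < P, T (P + p) = (f p, f p, P + p)) (h i o : ℕ) (hi : 0 < i)
    (ho : i * 2 ^ h = P + o) (hoP : o + 2 ^ h ≤ P) :
    (T i).1 = ∑ p ∈ Finset.range (2 ^ h), f (o + p) ∧
    (∃ a < 2 ^ h, (T i).2.2 = P + o + a ∧
      (T i).2.1 = ∑ p ∈ Finset.range (a + 1), f (o + p)) ∧
    ∀ a < 2 ^ h, ∑ p ∈ Finset.range (a + 1), f (o + p) ≤ (T i).2.1 := by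
  induction h generalizing i o with
  | zero =>
    simp only [pow_zero, mul_one] at ho hoP
    rw [ho, hleaf o (by omega)]
    refine ⟨by simp, ⟨0, by simp, by simp, by simp⟩, fun a ha => ?_⟩
    have ha' : a = 0 := by simpa using ha
    simp [ha']
  | succ h ih =>
    have hp : 0 < 2 ^ h := by positivity
    rw [pow_succ] at ho hoP
    obtain ⟨l1, ⟨l2, l3, l4, l5⟩, l6⟩ := ih (2 * i) o (by omega) (by rw [← ho]; ring) (by omega)
    obtain ⟨r1, ⟨r2, r3, r4, r5⟩, r6⟩ := ih (2 * i + 1) (o + 2 ^ h) (by omega)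
      (by rw [← add_assoc, ← ho]; ring) (by omega)
    have hiP : i < P := by nlinarith
    rw [hOK i hi hiP]
    have hsplit : ∀ c, ∑ p ∈ Finset.range (2 ^ h + c), f (o + p) =
        (T (2 * i)).1 + ∑ p ∈ Finset.range c, f (o + 2 ^ h + p) := by
      intro c
      rw [Finset.sum_range_add, l1]
      simp only [add_assoc]
    have hup : ∀ a < 2 ^ (h + 1), ∑ p ∈ Finset.range (a + 1), f (o + p) ≤ (T (2 * i)).2.1 ∨
        ∑ p ∈ Finset.range (a + 1), f (o + p) ≤ (T (2 * i)).1 + (T (2 * i + 1)).2.1 := by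
      intro a ha
      rw [pow_succ] at ha
      rcases Nat.lt_or_ge a (2 ^ h) with h1 | h1
      · exact .inl (l6 a h1)
      · obtain ⟨c, rfl⟩ := Nat.exists_eq_add_of_le h1
        right
        rw [add_assoc, hsplit]
        have := r6 c (by omega)
        linarith
    refine ⟨?_, ?_, ?_⟩
    · rw [pow_succ, mul_two, hsplit, mergeSums, r1]
    · unfold mergeSums
      dsimp only
      split_ifs with hc
      · refine ⟨2 ^ h + r2, by rw [pow_succ]; omega, by rw [r4]; ring, ?_⟩
        rw [add_assoc, hsplit, r5]
      · exact ⟨l2, by rw [pow_succ]; omega, l4, l5⟩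
    · intro a ha
      unfold mergeSums
      dsimp only
      split_ifs with hc
      · rcases hup a ha with h1 | h1 <;> linarith
      · rcases hup a ha with h1 | h1 <;> linarith

/-- The tree with `P` leaves in variable 2 holds the summaries of the sequence `f`. -/
structure SumTree (P : ℕ) (f : ℕ → ℝ) (s : State) : Prop where
  node : ∀ k, 0 < k → k < P → NodeOK mergeSums (sumView s) k
  leaf : ∀ p < P, sumView s (P + p) = (f p, f p, P + p)

theorem SumTree.root {P H : ℕ} {f : ℕ → ℝ} {s : State} (h : SumTree P f s) (hP : P = 2 ^ H) :
    ∃ a < P, s.word 10 1 = P + a ∧ s.real 8 1 = ∑ p ∈ Finset.range (a + 1), f p ∧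
      ∀ a' < P, ∑ p ∈ Finset.range (a' + 1), f p ≤ s.real 8 1 := by
  obtain ⟨-, ⟨a, ha, h1, h2⟩, h3⟩ := mergeSums_tree h.node h.leaf H 1 0 one_pos (by simp [hP])
    (by simp [hP])
  simp only [zero_add, add_zero] at h1 h2 h3
  rw [← hP] at ha h3
  exact ⟨a, ha, h1, h2, h3⟩

/-- Initialize leaf `i` (variable 3) with the summary of a sequence with the single element 0. -/
def zeroLeaf : Prog :=
  .seq (.setReal 7 (wvar 3) (.lit 0)) (.seq (.setReal 8 (wvar 3) (.lit 0))
    (.setWord 10 (wvar 3) (wvar 3)))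

theorem buildSums_spec {M P : ℕ} {s : State} (hP : s.word 2 0 = P) (hP0 : 0 < P)
    (hM : 2 * P + 2 < M) :
    WP M (build sumNode zeroLeaf) s fun t s' => t ≤ 117 * (2 * P) + 12 ∧
      SumTree P (fun _ => 0) s' := by
  refine (build_spec (view := sumView) (op := mergeSums) (Tr := 100) (P := P)
    (I := fun s => s.word 2 0 = P) (f := fun k => (0, 0, k)) ?_ ?_ ?_ ?_ ?_ hP0 (by omega)
    hP).mono ?_
  · intro s v h; simp [h]
  · intro s v; funext k; simp [sumView]
  · exact fun s h => h
  · intro s h h1 h2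
    refine (sumNode_spec (by omega) h1 h2).mono ?_
    rintro t s' hf ⟨ht, h3, h4⟩
    exact ⟨ht, by rw [hf.1 2 rfl, h], h3, h4⟩
  · intro s h h1 h2
    refine .of_exec rfl ?_ fun t ht => ⟨ht.trans (by decide), ?_, ?_, ?_⟩
    · simp [zeroLeaf, Prog.SafeAt, RExpr.Safe, WExpr.Safe]; omega
    · simp [zeroLeaf, Prog.exec, h]
    · simp [zeroLeaf, Prog.exec]
    · apply sumView_update <;> simp [zeroLeaf, Prog.exec, WExpr.eval, RExpr.eval]
  · rintro t s' _ ⟨ht, -, h1, h2⟩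
    exact ⟨ht, h1, fun p hp => h2 _ (by omega) (by omega)⟩

/-- Replace the element with the index in variable 18 by the number in real variable 11. -/
def setLeaf : Prog :=
  let i := WExpr.add (wvar 2) (wvar 18)
  .seq (.seq (.setReal 7 i (rvar 11)) (.seq (.setReal 8 i (rvar 11)) (wset 3 i))) (climb sumNode)

theorem setLeaf_spec {M P : ℕ} {f : ℕ → ℝ} {s : State} (hP : s.word 2 0 = P)
    (hM : 2 * P + 2 < M) (hp : s.word 18 0 < P) (hT : SumTree P f s) :
    WP M setLeaf s fun t s' => t ≤ 111 * Nat.size (2 * P) + 40 ∧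
      SumTree P (Function.update f (s.word 18 0) (s.real 11 0)) s' := by
  obtain ⟨p, hpp⟩ : ∃ p, s.word 18 0 = p := ⟨_, rfl⟩
  obtain ⟨v, hv⟩ : ∃ v, s.real 11 0 = v := ⟨_, rfl⟩
  rw [hpp, hv]
  rw [hpp] at hp
  refine .seq (.of_exec rfl ?_ ?_)
  · simp [Prog.SafeAt, Prog.exec, RExpr.Safe, WExpr.Safe, WExpr.eval, hP, hpp]; omega
  intro t ht
  have ht' : t ≤ 30 := ht.trans (by decide)
  obtain ⟨s1, hs1⟩ : ∃ s1, s1 = Prog.exec (.seq (.setReal 7 (.add (wvar 2) (wvar 18)) (rvar 11))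
    (.seq (.setReal 8 (.add (wvar 2) (wvar 18)) (rvar 11)) (wset 3 (.add (wvar 2) (wvar 18))))) s :=
    ⟨_, rfl⟩
  rw [← hs1]
  simp only [Prog.exec, WExpr.eval, RExpr.eval, State.setReal_word, hP, hpp, hv] at hs1
  have a2 : s1.word 2 0 = P := by rw [hs1]; simp [hP]
  have a3 : s1.word 3 0 = P + p := by rw [hs1]; simp
  have av : sumView s1 = Function.update (sumView s) (P + p) (v, v, P + p) := by
    apply sumView_update
    · rw [hs1]; simp
    · rw [hs1]; simp [hv]
    · have := congrArg (fun x => x.2.2) (hT.leaf p hp)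
      simp only [sumView] at this
      rw [Function.update_eq_self_iff.2 this.symm, hs1]; simp
  refine (climb_spec (view := sumView) (op := mergeSums) (Tr := 100) (P := P)
    (I := fun s => s.word 2 0 = P) ?_ ?_ ?_ (by omega) a2 (by omega) (by omega) ?_).mono ?_
  · intro s v h; simp [h]
  · intro s v; funext k; simp [sumView]
  · intro s h h1 h2
    refine (sumNode_spec (by omega) h1 h2).mono ?_
    rintro t s' hf ⟨ht, h3, h4⟩
    exact ⟨ht, by rw [hf.1 2 rfl, h], h3, h4⟩
  · intro j hj hjP hanc
    rw [a3] at hanc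
    have : j ≠ (P + p) / 2 := fun h => hanc (anc_iff.2 (.inl h))
    unfold NodeOK
    rw [av, Function.update_of_ne (by omega), Function.update_of_ne (by omega),
      Function.update_of_ne (by omega)]
    exact hT.node j hj hjP
  · rintro t2 s2 - ⟨ht2, -, h1, h2⟩
    rw [a3] at ht2
    have hsz : Nat.size (P + p) ≤ Nat.size (2 * P) := Nat.size_le_size (by omega)
    refine ⟨by omega, h1, fun q hq => ?_⟩
    rw [h2 _ (by omega), av]
    by_cases hqp : q = p
    · subst hqp; simp
    · rw [Function.update_of_ne (by omega), Function.update_of_ne hqp]; exact hT.leaf q hq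

/-! ### Sweeping over the slopes of the lower line -/

open Classical in
/-- The indicator of a proposition. -/
noncomputable def ind (p : Prop) : ℝ := if p then 1 else 0

@[simp] theorem ind_true {p : Prop} (h : p) : ind p = 1 := by simp [ind, h]

@[simp] theorem ind_false {p : Prop} (h : ¬ p) : ind p = 0 := by simp [ind, h]

theorem sum_eq_of_eq_off {m j : ℕ} {f g : ℕ → ℝ} (hj : j < m)
    (h : ∀ j' < m, j' ≠ j → f j' = g j') :
    ∑ i ∈ Finset.range m, f i = ∑ i ∈ Finset.range m, g i + (f j - g j) := by
  have hj' : j ∈ Finset.range m := Finset.mem_range.2 hj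
  rw [← Finset.add_sum_erase _ _ hj', ← Finset.add_sum_erase _ g hj',
    Finset.sum_congr rfl fun i hi => h i (Finset.mem_range.1 (Finset.mem_of_mem_erase hi))
      (Finset.ne_of_mem_erase hi)]
  ring

/-- Interval `j`, whose endpoints have the positions `pos j` and `pos (m + j)` in the sorted
sequence, has been entered but not left after the first `k` endpoints. -/
def Active (pos : ℕ → ℕ) (m k j : ℕ) : Prop := pos j < k ∧ k ≤ pos (m + j)

/-- The number of intervals covered by the slopes after the first `k` lower and the first `a`
upper endpoints. -/
noncomputable def covered (pos₁ pos₂ : ℕ → ℕ) (m k a : ℕ) : ℝ :=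
  ∑ j ∈ Finset.range m, ind (Active pos₁ m k j ∨ Active pos₂ m a j)

/-- The sequence whose entry at `p + 1` is `c j` or `-c j` if the endpoint at position `p` is the
left or right endpoint of interval `j`. -/
noncomputable def weights (pos : ℕ → ℕ) (m : ℕ) (c : ℕ → ℝ) (p : ℕ) : ℝ :=
  ∑ j ∈ Finset.range m, c j * (ind (p = pos j + 1) - ind (p = pos (m + j) + 1))

section Weights

variable {pos : ℕ → ℕ} {m : ℕ} {c c' : ℕ → ℝ}

theorem weights_congr (h : ∀ j < m, c j = c' j) : weights pos m c = weights pos m c' := by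
  funext p
  exact Finset.sum_congr rfl fun j hj => by rw [h j (Finset.mem_range.1 hj)]

/-- A prefix of length `a + 1` contains the left or right endpoint of an interval if and only if its
position is smaller than `a`. The entry at `0` is zero, so that the empty set of endpoints is a
nonempty prefix. -/
theorem sum_weights (a : ℕ) : ∑ p ∈ Finset.range (a + 1), weights pos m c p =
    ∑ j ∈ Finset.range m, c j * (ind (pos j < a) - ind (pos (m + j) < a)) := by
  unfold weights
  rw [Finset.sum_comm]
  refine Finset.sum_congr rfl fun j _ => ?_
  have : ∀ q, ∑ p ∈ Finset.range (a + 1), ind (p = q + 1) = ind (q < a) := by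
    intro q
    by_cases hq : q < a
    · rw [ind_true hq, Finset.sum_eq_single_of_mem (q + 1) (Finset.mem_range.2 (by omega))
        (fun p _ hp => ind_false hp), ind_true rfl]
    · rw [ind_false hq]
      refine Finset.sum_eq_zero fun p hp => ind_false ?_
      have := Finset.mem_range.1 hp
      omega
  rw [← Finset.mul_sum, Finset.sum_sub_distrib, this, this]

theorem weights_left (hinj : ∀ x < 2 * m, ∀ y < 2 * m, pos x = pos y → x = y) {j : ℕ} (hj : j < m) :
    weights pos m c (pos j + 1) = c j := by
  unfold weights
  rw [Finset.sum_eq_single_of_mem j (Finset.mem_range.2 hj)]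
  · rw [ind_true rfl, ind_false, sub_zero, mul_one]
    intro h
    have := hinj j (by omega) (m + j) (by omega) (by omega)
    omega
  · intro i hi hij
    have hi := Finset.mem_range.1 hi
    rw [ind_false, ind_false, sub_zero, mul_zero]
    · intro h; have := hinj j (by omega) (m + i) (by omega) (by omega); omega
    · intro h; exact hij (hinj j (by omega) i (by omega) (by omega)).symm

theorem weights_right (hinj : ∀ x < 2 * m, ∀ y < 2 * m, pos x = pos y → x = y) {j : ℕ} (hj : j < m) :
    weights pos m c (pos (m + j) + 1) = -c j := by
  unfold weights
  rw [Finset.sum_eq_single_of_mem j (Finset.mem_range.2 hj)]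
  · rw [ind_true rfl, ind_false, zero_sub, mul_neg, mul_one]
    intro h
    have := hinj (m + j) (by omega) j (by omega) (by omega)
    omega
  · intro i hi hij
    have hi := Finset.mem_range.1 hi
    rw [ind_false, ind_false, sub_zero, mul_zero]
    · intro h; have := hinj (m + j) (by omega) (m + i) (by omega) (by omega); omega
    · intro h; have := hinj (m + j) (by omega) i (by omega) (by omega); omega

theorem weights_update (hinj : ∀ x < 2 * m, ∀ y < 2 * m, pos x = pos y → x = y) {j : ℕ} (hj : j < m)
    (v : ℝ) : Function.update (Function.update (weights pos m c) (pos j + 1) v) (pos (m + j) + 1) (-v)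
      = weights pos m (Function.update c j v) := by
  funext p
  by_cases h1 : p = pos (m + j) + 1
  · rw [h1, Function.update_self, weights_right hinj hj, Function.update_self]
  rw [Function.update_of_ne h1]
  by_cases h2 : p = pos j + 1
  · rw [h2, Function.update_self, weights_left hinj hj, Function.update_self]
  rw [Function.update_of_ne h2]
  refine Finset.sum_congr rfl fun i _ => ?_
  by_cases h3 : i = j
  · subst h3; rw [ind_false h1, ind_false h2]; simp
  · rw [Function.update_of_ne h3]

/-- The prefix sums of the weights of the intervals that are not active for the lower line count
the intervals that are covered in addition. -/
theorem active_add_sum_weights {pos₁ : ℕ → ℕ} (k a : ℕ) :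
    ∑ j ∈ Finset.range m, ind (Active pos₁ m k j) +
      ∑ p ∈ Finset.range (a + 1), weights pos m
        (fun j => ind (pos j < pos (m + j) ∧ ¬ Active pos₁ m k j)) p =
      covered pos₁ pos m k a := by
  rw [sum_weights, ← Finset.sum_add_distrib]
  refine Finset.sum_congr rfl fun j _ => ?_
  by_cases h1 : Active pos₁ m k j
  · rw [ind_true h1, ind_false (fun h => h.2 h1), ind_true (Or.inl h1)]; simp
  rw [ind_false h1]
  by_cases h2 : Active pos m a j
  · rw [ind_true (Or.inr h2), ind_true ⟨by unfold Active at h2; omega, h1⟩, ind_true h2.1,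
      ind_false (not_lt.2 h2.2)]
    norm_num
  · rw [ind_false (not_or.2 ⟨h1, h2⟩)]
    by_cases h3 : pos j < pos (m + j)
    · have : ind (pos j < a) = ind (pos (m + j) < a) := by
        unfold Active at h2
        congr 1
        exact propext ⟨fun h => by omega, fun h => by omega⟩
      rw [this]; simp
    · rw [ind_false (fun h => h3 h.1)]; simp

end Weights

section Events

variable {v : ℕ → ℝ} {m k : ℕ} {ord pos : ℕ → ℕ}

theorem Sorted.inj {N : ℕ} (h : Sorted v N ord pos) :
    ∀ x < N, ∀ y < N, pos x = pos y → x = y := fun x hx y hy hxy => by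
  rw [← h.ord_pos x hx, hxy, h.ord_pos y hy]

theorem Sorted.active_succ_of_ne (h : Sorted v (2 * m) ord pos) {j : ℕ}
    (hj : j < m) (h1 : ord k ≠ j) (h2 : ord k ≠ m + j) :
    Active pos m (k + 1) j ↔ Active pos m k j := by
  have e1 : pos j ≠ k := fun h' => h1 (by rw [← h', h.ord_pos j (by omega)])
  have e2 : pos (m + j) ≠ k := fun h' => h2 (by rw [← h', h.ord_pos (m + j) (by omega)])
  unfold Active
  omega

end Events

/-- Give interval `j` (variable 19) the weight in real variable 12. -/
def setWeight : Prog :=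
  .seq (.seq (wset 18 (.add (.read 22 (wvar 19)) (.lit 1))) (rset 11 (rvar 12)))
    (.seq setLeaf
      (.seq (.seq (wset 18 (.add (.read 22 (.add (.read 0 (.lit 1)) (wvar 19))) (.lit 1)))
        (rset 11 (.sub (.lit 0) (rvar 12)))) setLeaf))

theorem setWeight_spec {M P m j : ℕ} {c : ℕ → ℝ} {s : State} (hm : s.word 0 1 = m)
    (hP : s.word 2 0 = P) (hM : 2 * P + 2 < M) (hmP : 2 * m < P) (hjs : s.word 19 0 = j)
    (hj : j < m) (hlt : ∀ x < 2 * m, s.word 22 x < 2 * m)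
    (hinj : ∀ x < 2 * m, ∀ y < 2 * m, s.word 22 x = s.word 22 y → x = y)
    (hT : SumTree P (weights (s.word 22) m c) s) :
    WP M setWeight s fun t s' => t ≤ 222 * Nat.size (2 * P) + 150 ∧
      SumTree P (weights (s.word 22) m (Function.update c j (s.real 12 0))) s' := by
  have hl1 := hlt j (by omega)
  have hl2 := hlt (m + j) (by omega)
  refine .seq (.of_exec rfl ?_ ?_)
  · simp [Prog.SafeAt, RExpr.Safe, WExpr.Safe, WExpr.eval, hjs]; omega
  intro t ht
  have ht' : t ≤ 20 := ht.trans (by decide)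
  simp only [Prog.exec, WExpr.eval, RExpr.eval, State.setWord_real, hjs]
  refine .seq ((setLeaf_spec (P := P) (f := weights (s.word 22) m c) (by simpa) hM ?_ ?_).mono ?_)
  · simp; omega
  · exact ⟨hT.node, hT.leaf⟩
  rintro t1 s1 f1 ⟨ht1, h1⟩
  simp only [State.setReal_word, State.setWord_word_self, Function.update_self,
    State.setReal_real_self] at h1
  have e0 : s1.word 0 1 = m := by rw [f1.1 0 rfl]; simp [hm]
  have e2 : s1.word 2 0 = P := by rw [f1.1 2 rfl]; simp [hP]
  have e19 : s1.word 19 0 = j := by rw [f1.1 19 rfl]; simp [hjs]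
  have e22 : s1.word 22 = s.word 22 := by rw [f1.1 22 rfl]; simp
  have e12 : s1.real 12 0 = s.real 12 0 := by rw [f1.2 12 rfl]; simp
  refine .seq (.of_exec rfl ?_ ?_)
  · simp [Prog.SafeAt, RExpr.Safe, WExpr.Safe, WExpr.eval, e19, e0, e22]; omega
  intro t2 ht2
  have ht2' : t2 ≤ 30 := ht2.trans (by decide)
  simp only [Prog.exec, WExpr.eval, RExpr.eval, State.setWord_real, e0, e19, e22, e12]
  refine (setLeaf_spec (P := P) (f := Function.update (weights (s.word 22) m c)
    (s.word 22 j + 1) (s.real 12 0)) (by simp [e2]) hM ?_ ?_).mono ?_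
  · simp; omega
  · exact ⟨h1.node, h1.leaf⟩
  rintro t3 s3 - ⟨ht3, h3⟩
  simp only [State.setReal_word, State.setWord_word_self, Function.update_self,
    State.setReal_real_self, Int.cast_zero, zero_sub] at h3
  rw [weights_update hinj hj] at h3
  exact ⟨by omega, h3⟩

/-- The test whether the right endpoint of interval `j` (variable 19) comes after its left endpoint
in the order given by word array `a`. -/
def proper (a : ℕ) : Test :=
  .wlt (.read a (wvar 19)) (.read a (.add (.read 0 (.lit 1)) (wvar 19)))

/-- Give weight 1 to all upper intervals whose endpoints come in the right order; the others are never
active. -/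
def initWeights : Prog :=
  .seq (wset 8 (.lit 0))
    (.loop (.wlt (wvar 8) (.read 0 (.lit 1)))
      (.seq (.seq (wset 19 (wvar 8)) (rset 12 (.lit 1)))
        (.seq (.branch (proper 22) setWeight .skip) (wset 8 (.add (wvar 8) (.lit 1))))))

theorem initWeights_spec {M P m : ℕ} {s : State} (hm : s.word 0 1 = m)
    (hP : s.word 2 0 = P) (hM : 2 * P + 8 < M) (hmP : 2 * m < P)
    (hlt : ∀ x < 2 * m, s.word 22 x < 2 * m)
    (hinj : ∀ x < 2 * m, ∀ y < 2 * m, s.word 22 x = s.word 22 y → x = y)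
    (hT : SumTree P (fun _ => 0) s) :
    WP M initWeights s fun t s' => t ≤ (222 * Nat.size (2 * P) + 250) * m + 20 ∧
      SumTree P (weights (s.word 22) m (fun j => ind (s.word 22 j < s.word 22 (m + j)))) s' := by
  obtain ⟨pos, hpos⟩ : ∃ pos, s.word 22 = pos := ⟨_, rfl⟩
  rw [hpos] at hlt hinj ⊢
  refine .seq (.of_exec rfl (by simp [Prog.SafeAt, WExpr.Safe]; omega) ?_)
  intro t ht
  have ht' : t ≤ 3 := ht
  simp only [Prog.exec, WExpr.eval]
  refine (WP.loop (fun s' => s'.word 8 0 ≤ m ∧ SumTree P (weights pos m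
    (fun j => ind (j < s'.word 8 0 ∧ pos j < pos (m + j)))) s')
    (fun s' => (222 * Nat.size (2 * P) + 250) * (m - s'.word 8 0)) ?_ ?_ ?_).mono ?_
  · refine ⟨by simp, ?_⟩
    have : weights pos m (fun j => ind (j < (s.setWord 8 0 0).word 8 0 ∧ pos j < pos (m + j))) =
        fun _ => 0 := by
      funext p
      refine Finset.sum_eq_zero fun j _ => ?_
      have h0 : ind (j < (s.setWord 8 0 0).word 8 0 ∧ pos j < pos (m + j)) = 0 :=
        ind_false (by simp)
      simp only [h0, zero_mul]
    rw [this]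
    exact ⟨hT.node, hT.leaf⟩
  · intro s' _ _
    simp [Test.Safe, WExpr.Safe]; omega
  · rintro s1 f1 ⟨h1, h2⟩ hb
    have e0 : s1.word 0 1 = m := by rw [f1.1 0 rfl]; simp [hm]
    have e2 : s1.word 2 0 = P := by rw [f1.1 2 rfl]; simp [hP]
    have e22 : s1.word 22 = pos := by rw [f1.1 22 rfl]; simp [hpos]
    simp only [Test.Holds, WExpr.eval, e0] at hb
    obtain ⟨k, hk⟩ : ∃ k, s1.word 8 0 = k := ⟨_, rfl⟩
    rw [hk] at h1 h2 hb
    obtain ⟨d, hd⟩ : ∃ d, m - k = d + 1 := ⟨m - k - 1, by omega⟩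
    have hmul : (222 * Nat.size (2 * P) + 250) * (d + 1) =
      (222 * Nat.size (2 * P) + 250) * d + (222 * Nat.size (2 * P) + 250) := by ring
    have hfin : ∀ (s' : State) (t : ℕ), s'.word 8 0 = k → t ≤ 222 * Nat.size (2 * P) + 200 →
        SumTree P (weights pos m (fun j => ind (j < k + 1 ∧ pos j < pos (m + j)))) s' →
        WP M (wset 8 (.add (wvar 8) (.lit 1))) s' fun t' s'' =>
          (s''.word 8 0 ≤ m ∧ SumTree P (weights pos m
            (fun j => ind (j < s''.word 8 0 ∧ pos j < pos (m + j)))) s'') ∧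
          t + t' + (Test.wlt (wvar 8) (.read 0 (.lit 1))).cost + 1 +
            (222 * Nat.size (2 * P) + 250) * (m - s''.word 8 0) ≤
            (222 * Nat.size (2 * P) + 250) * (m - s1.word 8 0) := by
      intro s' t h8 ht hS
      refine .of_exec rfl (by simp [Prog.SafeAt, WExpr.Safe, WExpr.eval, h8]; omega) ?_
      intro t' ht'
      have ht2 : t' ≤ 6 := ht'
      simp only [Prog.exec, WExpr.eval, State.setWord_word_self, Function.update_self, h8, hk,
        Test.cost, WExpr.cost]
      refine ⟨⟨by omega, hS.node, hS.leaf⟩, ?_⟩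
      rw [show m - (k + 1) = d by omega, hd, hmul]
      omega
    refine .seq (.of_exec rfl (by simp [Prog.SafeAt, WExpr.Safe, RExpr.Safe]; omega) ?_)
    intro t1 ht1
    have ht1' : t1 ≤ 10 := ht1.trans (by decide)
    simp only [Prog.exec, WExpr.eval, RExpr.eval, hk]
    refine .seq (.branch ?_ (fun hc => ?_) (fun hc => ?_))
    · simp [proper, Test.Safe, WExpr.Safe, WExpr.eval, e0]; omega
    all_goals
      simp [proper, Test.Holds, WExpr.eval, e0, e22] at hc
    · refine (setWeight_spec (P := P) (m := m) (j := k)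
        (c := fun j => ind (j < k ∧ pos j < pos (m + j)))
        (by simpa) (by simpa) (by omega) hmP (by simp) hb (by simpa [e22])
        (by simpa [e22]) ?_).mono ?_
      · simp only [ne_eq, Nat.reduceEqDiff, not_false_eq_true, State.setReal_word,
          State.setWord_word_of_ne, e22]
        exact ⟨h2.node, h2.leaf⟩
      rintro t2 s2 f2 ⟨ht2, h3⟩
      simp only [ne_eq, Nat.reduceEqDiff, not_false_eq_true, State.setReal_word,
          State.setWord_word_of_ne, e22, State.setReal_real_self, Function.update_self] at h3
      refine (hfin s2 (t1 + ((proper 22).cost + t2 + 1)) (by rw [f2.1 8 rfl]; simp [hk])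
        ?_ ?_).mono fun t s _ h => ⟨h.1, by rw [← hk]; have := h.2; omega⟩
      · simp only [proper, Test.cost, WExpr.cost]; omega
      · convert h3 using 1
        refine weights_congr fun j hj => ?_
        by_cases hjk : j = k
        · subst hjk; rw [Function.update_self, ind_true ⟨by omega, hc⟩]; simp
        · rw [Function.update_of_ne hjk]
          congr 1
          exact propext (and_congr_left fun _ => by omega)
    · refine .of_exec rfl trivial fun t2 ht2 => ?_
      have ht2' : t2 ≤ 1 := ht2
      refine (hfin _ (t1 + ((proper 22).cost + t2 + 1)) (by simp [Prog.exec, hk])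
        ?_ ?_).mono fun t s _ h => ⟨h.1, by rw [← hk]; have := h.2; omega⟩
      · simp only [proper, Test.cost, WExpr.cost]; omega
      · have : weights pos m (fun j => ind (j < k + 1 ∧ pos j < pos (m + j))) =
            weights pos m (fun j => ind (j < k ∧ pos j < pos (m + j))) := by
          refine weights_congr fun j hj => ?_
          congr 1
          refine propext ⟨fun h => ⟨?_, h.2⟩, fun h => ⟨by omega, h.2⟩⟩
          have : j ≠ k := by rintro rfl; omega
          omega
        rw [this]
        exact ⟨h2.node, h2.leaf⟩
  · rintro t1 s1 f1 ⟨⟨h1, h2⟩, hb, ht1⟩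
    have e0 : s1.word 0 1 = m := by rw [f1.1 0 rfl]; simp [hm]
    simp only [Test.Holds, WExpr.eval, e0] at hb
    simp only [Test.cost, WExpr.cost, State.setWord_word_self, Function.update_self,
      Nat.sub_zero] at ht1
    refine ⟨by omega, ?_⟩
    convert h2 using 1
    refine weights_congr fun j hj => ?_
    congr 1
    exact propext ⟨fun h => ⟨by omega, h⟩, fun h => h.2⟩

/-- Process the next endpoint of a lower interval, whose position is in variable 8: update the
number of active lower intervals (real variable 17) and the weight of the upper interval. -/
def processEvent : Prog :=
  let m := WExpr.read 0 (.lit 1)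
  .seq (.seq (wset 9 (.read 6 (wvar 8)))
      (.branch (.wlt (wvar 9) m)
        (.seq (wset 19 (wvar 9)) (.seq (rset 12 (.lit 0)) (rset 18 (.add (rvar 17) (.lit 1)))))
        (.seq (wset 19 (.sub (wvar 9) m))
          (.seq (rset 12 (.lit 1)) (rset 18 (.sub (rvar 17) (.lit 1)))))))
    (.branch (proper 7)
      (.seq (rset 17 (rvar 18)) (.branch (proper 22) setWeight .skip))
      .skip)

/-- After the first `k` lower endpoints, the tree holds the weights of the upper intervals of the
points whose lower intervals are not active, and the number of active lower intervals is known. -/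
structure SweepState (pos₁ pos₂ : ℕ → ℕ) (m P k : ℕ) (s : State) : Prop where
  tree : SumTree P (weights pos₂ m
    fun j => ind (pos₂ j < pos₂ (m + j) ∧ ¬ Active pos₁ m k j)) s
  count : s.real 17 0 = ∑ j ∈ Finset.range m, ind (Active pos₁ m k j)

theorem processEvent_spec {M P m k : ℕ} {v : ℕ → ℝ} {ord pos₁ pos₂ : ℕ → ℕ} {s : State}
    (hm : s.word 0 1 = m)
    (hP : s.word 2 0 = P) (hM : 2 * P + 8 < M) (hmP : 2 * m < P)
    (h6 : s.word 6 = ord) (h7 : s.word 7 = pos₁) (h22 : s.word 22 = pos₂)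
    (hS : Sorted v (2 * m) ord pos₁)
    (hlt : ∀ x < 2 * m, pos₂ x < 2 * m)
    (hinj : ∀ x < 2 * m, ∀ y < 2 * m, pos₂ x = pos₂ y → x = y)
    (hk : s.word 8 0 = k) (hkm : k < 2 * m) (h : SweepState pos₁ pos₂ m P k s) :
    WP M processEvent s fun t s' => t ≤ 222 * Nat.size (2 * P) + 300 ∧
      SweepState pos₁ pos₂ m P (k + 1) s' := by
  -- In either case the event concerns interval `j`, with the new weight `w` and the increment `δ`.
  suffices H : ∀ (j : ℕ) (w δ : ℝ) (s1 : State), j < m → (ord k = j ∧ w = 0 ∧ δ = 1 ∨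
      ord k = m + j ∧ w = 1 ∧ δ = -1) → s1.word 19 0 = j → s1.real 12 0 = w →
      s1.real 18 0 = s.real 17 0 + δ → s1.word 0 = s.word 0 → s1.word 2 = s.word 2 →
      s1.word 7 = s.word 7 → s1.word 22 = s.word 22 → s1.real 7 = s.real 7 → s1.real 8 = s.real 8 →
      s1.word 10 = s.word 10 → s1.real 17 = s.real 17 →
      WP M (.branch (proper 7)
      (.seq (rset 17 (rvar 18)) (.branch (proper 22) setWeight .skip))
      .skip) s1 fun t s' => t ≤ 222 * Nat.size (2 * P) + 200 ∧
      SweepState pos₁ pos₂ m P (k + 1) s' by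
    have hord := hS.ord_lt k hkm
    refine .seq (.seq (.of_exec rfl (by simp [Prog.SafeAt, WExpr.Safe]; omega) fun t ht => ?_))
    have ht' : t ≤ 10 := ht.trans (by decide)
    simp only [Prog.exec, WExpr.eval, hk, h6]
    refine .branch (by simp [Test.Safe, WExpr.Safe]; omega) (fun hc => ?_) (fun hc => ?_)
    all_goals
      simp [Test.Holds, WExpr.eval, hm] at hc
      refine .of_exec rfl (by simp [Prog.SafeAt, RExpr.Safe, WExpr.Safe]; omega) fun t1 ht1 => ?_
      have ht1' : t1 ≤ 25 := ht1.trans (by decide)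
    · refine (H (ord k) 0 1 _ hc (.inl ⟨rfl, rfl, rfl⟩) ?_ ?_ ?_ ?_ ?_ ?_ ?_ ?_ ?_ ?_ ?_).mono
        fun t2 s2 _ h2 => ⟨by simp only [Test.cost, WExpr.cost]; omega, h2.2⟩
      all_goals simp [Prog.exec, WExpr.eval, RExpr.eval]
    · refine (H (ord k - m) 1 (-1) _ (by omega) (.inr ⟨by omega, rfl, rfl⟩)
        ?_ ?_ ?_ ?_ ?_ ?_ ?_ ?_ ?_ ?_ ?_).mono
        fun t2 s2 _ h2 => ⟨by simp only [Test.cost, WExpr.cost]; omega, h2.2⟩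
      all_goals simp [Prog.exec, WExpr.eval, RExpr.eval, hm, sub_eq_add_neg]
  intro j w δ s1 hj hcase e19 e12 e18 e0 e2 e7 e22 r7 r8 w10 r17
  have hview : sumView s1 = sumView s := by unfold sumView; rw [r7, r8, w10]
  have hother : ∀ j' < m, j' ≠ j → (Active pos₁ m (k + 1) j' ↔ Active pos₁ m k j') := by
    intro j' hj' hne
    refine hS.active_succ_of_ne hj' ?_ ?_ <;> omega
  have hpk := hS.pos_ord k hkm
  refine .branch ?_ (fun hc => ?_) (fun hc => ?_)
  · simp [proper, Test.Safe, WExpr.Safe, WExpr.eval, e0, e19, hm]; omega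
  · simp only [proper, Test.Holds, WExpr.eval, e7, e19, e0, hm, h7] at hc
    refine .seq (.of_exec rfl (by simp [Prog.SafeAt, RExpr.Safe, WExpr.Safe]; omega)
      fun t ht => ?_)
    have ht' : t ≤ 5 := ht.trans (by decide)
    simp only [Prog.exec, WExpr.eval, RExpr.eval, e18]
    have hact : ind (Active pos₁ m (k + 1) j) - ind (Active pos₁ m k j) = δ ∧
        ind (¬ Active pos₁ m (k + 1) j) = w := by
      unfold Active
      rcases hcase with ⟨h1, rfl, rfl⟩ | ⟨h1, rfl, rfl⟩
      · rw [h1] at hpk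
        rw [ind_true (show pos₁ j < k + 1 ∧ k + 1 ≤ pos₁ (m + j) by omega),
          ind_false (show ¬ (pos₁ j < k ∧ k ≤ pos₁ (m + j)) by omega), ind_false (by omega)]
        simp
      · rw [h1] at hpk
        rw [ind_false (show ¬ (pos₁ j < k + 1 ∧ k + 1 ≤ pos₁ (m + j)) by omega),
          ind_true (show pos₁ j < k ∧ k ≤ pos₁ (m + j) by omega), ind_true (by omega)]
        simp
    have hcount : s.real 17 0 + δ = ∑ j ∈ Finset.range m, ind (Active pos₁ m (k + 1) j) := by
      rw [h.count, ← hact.1]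
      exact (sum_eq_of_eq_off (f := fun j => ind (Active pos₁ m (k + 1) j))
        (g := fun j => ind (Active pos₁ m k j)) hj
        fun j' hj' hne => by simp only [hother j' hj' hne]).symm
    refine .branch ?_ (fun hc2 => ?_) (fun hc2 => ?_)
    · simp [proper, Test.Safe, WExpr.Safe, WExpr.eval, e0, e19, hm]; omega
    · simp [proper, Test.Holds, WExpr.eval, e22, e19, e0, hm, h22] at hc2
      refine (setWeight_spec (P := P) (m := m) (j := j)
        (c := fun j => ind (pos₂ j < pos₂ (m + j) ∧ ¬ Active pos₁ m k j)) (by simp [e0, hm])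
        (by simp [e2, hP]) (by omega) hmP (by simp [e19]) hj (by simpa [e22, h22])
        (by simpa [e22, h22]) ?_).mono ?_
      · simp only [State.setReal_word, e22, h22]
        have := h.tree
        have hv2 : sumView (s1.setReal 17 0 (s.real 17 0 + δ)) = sumView s := by
          rw [← hview]; funext k; simp [sumView]
        exact ⟨by rw [hv2]; exact this.node, by rw [hv2]; exact this.leaf⟩
      rintro t2 s2 f2 ⟨ht2, hT⟩
      refine ⟨by simp only [proper, Test.cost, WExpr.cost]; omega, ?_, ?_⟩
      · convert hT using 1
        simp only [State.setReal_word, e22, h22, ne_eq, Nat.reduceEqDiff, not_false_eq_true,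
          State.setReal_real_of_ne, e12]
        refine weights_congr fun j' hj' => ?_
        by_cases hne : j' = j
        · subst hne
          rw [Function.update_self, ← hact.2]
          congr 1
          exact propext ⟨fun h => h.2, fun h => ⟨hc2, h⟩⟩
        · rw [Function.update_of_ne hne, hother j' hj' hne]
      · rw [f2.2 17 rfl, ← hcount]; simp
    · simp [proper, Test.Holds, WExpr.eval, e22, e19, e0, hm, h22] at hc2
      refine .of_exec rfl trivial fun t2 ht2 => ?_
      have ht2' : t2 ≤ 1 := ht2
      refine ⟨by simp only [proper, Test.cost, WExpr.cost]; omega, ?_, ?_⟩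
      · have hv2 : sumView (Prog.exec .skip (s1.setReal 17 0 (s.real 17 0 + δ))) = sumView s := by
          rw [← hview]; funext k; simp [sumView, Prog.exec]
        have := h.tree
        have hw : weights pos₂ m (fun j => ind (pos₂ j < pos₂ (m + j) ∧ ¬ Active pos₁ m (k + 1) j)) =
            weights pos₂ m (fun j => ind (pos₂ j < pos₂ (m + j) ∧ ¬ Active pos₁ m k j)) := by
          refine weights_congr fun j' hj' => ?_
          by_cases hne : j' = j
          · subst hne; rw [ind_false (fun h => by omega), ind_false (fun h => by omega)]
          · rw [hother j' hj' hne]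
        rw [hw]
        exact ⟨by rw [hv2]; exact this.node, by rw [hv2]; exact this.leaf⟩
      · simp [Prog.exec, hcount]
  · simp only [proper, Test.Holds, WExpr.eval, e7, e19, e0, hm, h7] at hc
    refine .of_exec rfl trivial fun t2 ht2 => ?_
    have ht2' : t2 ≤ 1 := ht2
    have hall : ∀ j' < m, (Active pos₁ m (k + 1) j' ↔ Active pos₁ m k j') := by
      intro j' hj'
      by_cases hne : j' = j
      · subst hne; unfold Active; omega
      · exact hother j' hj' hne
    refine ⟨by simp only [proper, Test.cost, WExpr.cost]; omega, ?_, ?_⟩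
    · have hw : weights pos₂ m (fun j => ind (pos₂ j < pos₂ (m + j) ∧ ¬ Active pos₁ m (k + 1) j)) =
          weights pos₂ m (fun j => ind (pos₂ j < pos₂ (m + j) ∧ ¬ Active pos₁ m k j)) :=
        weights_congr fun j' hj' => by rw [hall j' hj']
      rw [hw]
      exact ⟨by rw [Prog.exec, hview]; exact h.tree.node, by rw [Prog.exec, hview]; exact h.tree.leaf⟩
    · rw [Prog.exec, r17, h.count]
      exact Finset.sum_congr rfl fun j' hj' => by rw [hall j' (Finset.mem_range.1 hj')]

/-- Record the current slopes as the best ones found so far: the number of covered intervals in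
real variable 16, the numbers of lower and upper endpoints passed in variables 23 and 24. -/
def record : Prog :=
  .seq (rset 16 (.add (rvar 17) (.read 8 (.lit 1)))) (.seq (wset 23 (wvar 8))
    (wset 24 (.sub (.read 10 (.lit 1)) (wvar 2))))

/-- Find the numbers of lower and upper endpoints to pass that maximize the number of covered
intervals. -/
def sweep : Prog :=
  .seq (build sumNode zeroLeaf) (.seq initWeights
    (.seq (.seq (.seq (wset 8 (.lit 0)) (rset 17 (.lit 0))) record)
      (.loop (.wlt (wvar 8) (.mul (.lit 2) (.read 0 (.lit 1))))
        (.seq processEvent (.seq (wset 8 (.add (wvar 8) (.lit 1)))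
          (.branch (.rlt (rvar 16) (.add (rvar 17) (.read 8 (.lit 1)))) record .skip))))))

theorem SweepState.root {pos₁ pos₂ : ℕ → ℕ} {m P H k : ℕ} {s : State}
    (h : SweepState pos₁ pos₂ m P k s) (hP : P = 2 ^ H) :
    ∃ a < P, s.word 10 1 = P + a ∧ s.real 17 0 + s.real 8 1 = covered pos₁ pos₂ m k a ∧
      ∀ a' < P, covered pos₁ pos₂ m k a' ≤ s.real 17 0 + s.real 8 1 := by
  obtain ⟨a, ha, h1, h2, h3⟩ := h.tree.root hP
  refine ⟨a, ha, h1, ?_, fun a' ha' => ?_⟩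
  · rw [h2, h.count, active_add_sum_weights]
  · rw [← active_add_sum_weights, h.count]
    have := h3 a' ha'
    linarith

theorem sweep_spec {M P H m : ℕ} {v : ℕ → ℝ} {ord pos₁ pos₂ : ℕ → ℕ} {s : State}
    (hm : s.word 0 1 = m)
    (hP : s.word 2 0 = P) (hPH : P = 2 ^ H) (hM : 2 * P + 8 < M) (hmP : 2 * m < P)
    (h6 : s.word 6 = ord) (h7 : s.word 7 = pos₁) (h22 : s.word 22 = pos₂)
    (hS : Sorted v (2 * m) ord pos₁)
    (hlt : ∀ x < 2 * m, pos₂ x < 2 * m)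
    (hinj : ∀ x < 2 * m, ∀ y < 2 * m, pos₂ x = pos₂ y → x = y) :
    WP M sweep s fun t s' => t ≤ 2000 * (P * Nat.size (2 * P)) ∧
      ∀ k ≤ 2 * m, ∀ a ≤ 2 * m,
        covered pos₁ pos₂ m k a ≤ covered pos₁ pos₂ m (s'.word 23 0) (s'.word 24 0) := by
  refine .seq ((buildSums_spec hP (by omega) (by omega)).mono ?_)
  rintro t1 s1 f1 ⟨ht1, hT1⟩
  refine .seq ((initWeights_spec (P := P) (m := m) (by rw [f1.1 0 rfl, hm])
    (by rw [f1.1 2 rfl, hP]) hM hmP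
    (by rw [f1.1 22 rfl, h22]; exact hlt) (by rw [f1.1 22 rfl, h22]; exact hinj) hT1).mono ?_)
  rintro t2 s2 f2 ⟨ht2, hT2⟩
  rw [f1.1 22 rfl, h22] at hT2
  have e0 : s2.word 0 1 = m := by rw [f2.1 0 rfl, f1.1 0 rfl, hm]
  have e2 : s2.word 2 0 = P := by rw [f2.1 2 rfl, f1.1 2 rfl, hP]
  have e6 : s2.word 6 = ord := by rw [f2.1 6 rfl, f1.1 6 rfl, h6]
  have e7 : s2.word 7 = pos₁ := by rw [f2.1 7 rfl, f1.1 7 rfl, h7]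
  have e22 : s2.word 22 = pos₂ := by rw [f2.1 22 rfl, f1.1 22 rfl, h22]
  have hSS : SweepState pos₁ pos₂ m P 0 ((s2.setWord 8 0 0).setReal 17 0 0) := by
    have hna : ∀ j, ¬ Active pos₁ m 0 j := fun j h => by unfold Active at h; omega
    constructor
    · have hv : sumView ((s2.setWord 8 0 0).setReal 17 0 0) = sumView s2 := by
        funext k; simp [sumView]
      have hw : weights pos₂ m (fun j => ind (pos₂ j < pos₂ (m + j) ∧ ¬ Active pos₁ m 0 j)) =
          weights pos₂ m (fun j => ind (pos₂ j < pos₂ (m + j))) := by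
        refine weights_congr fun j _ => ?_
        congr 1
        exact propext ⟨fun h => h.1, fun h => ⟨h, hna j⟩⟩
      rw [hw]
      exact ⟨by rw [hv]; exact hT2.node, by rw [hv]; exact hT2.leaf⟩
    · simp only [State.setReal_real_self, Function.update_self]
      exact (Finset.sum_eq_zero fun j _ => ind_false (hna j)).symm
  have hrec : ∀ (s' : State) (k : ℕ), s'.word 2 0 = P → s'.word 8 0 = k →
      SweepState pos₁ pos₂ m P k s' → WP M record s' fun t s'' => t ≤ 30 ∧
        s''.word 8 0 = k ∧ SweepState pos₁ pos₂ m P k s'' ∧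
        s''.real 16 0 = covered pos₁ pos₂ m (s''.word 23 0) (s''.word 24 0) ∧
        s''.real 16 0 = s'.real 17 0 + s'.real 8 1 ∧
        ∀ a < P, covered pos₁ pos₂ m k a ≤ s''.real 16 0 := by
    intro s' k h2 h8 hs'
    obtain ⟨a, ha, h10, hr1, hr2⟩ := hs'.root hPH
    refine .of_exec rfl ?_ fun t ht => ⟨ht.trans (by decide), ?_⟩
    · simp [record, Prog.SafeAt, RExpr.Safe, WExpr.Safe]; omega
    obtain ⟨s'', hs⟩ : ∃ s'', s'' = record.exec s' := ⟨_, rfl⟩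
    rw [← hs]
    simp only [record, Prog.exec, WExpr.eval, RExpr.eval] at hs
    have k8 : s''.word 8 0 = k := by rw [hs]; simp [h8]
    have k23 : s''.word 23 0 = k := by rw [hs]; simp [h8]
    have k24 : s''.word 24 0 = a := by rw [hs]; simp [h10, h2]
    have k16 : s''.real 16 0 = s'.real 17 0 + s'.real 8 1 := by rw [hs]; simp
    have hv : sumView s'' = sumView s' := by rw [hs]; funext k; simp [sumView]
    refine ⟨k8, ⟨⟨by rw [hv]; exact hs'.tree.node, by rw [hv]; exact hs'.tree.leaf⟩, ?_⟩, ?_, k16, ?_⟩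
    · rw [← hs'.count, hs]; simp
    · rw [k23, k24, k16, hr1]
    · rw [k16]; exact hr2
  refine .seq (.seq (.of_exec rfl (by simp [Prog.SafeAt, RExpr.Safe, WExpr.Safe]; omega)
    fun t3 ht3 => ?_))
  have ht3' : t3 ≤ 10 := ht3.trans (by decide)
  simp only [Prog.exec, WExpr.eval, RExpr.eval, Int.cast_zero]
  refine (hrec _ 0 (by simp [e2]) (by simp) hSS).mono ?_
  rintro t4 s4 f4 ⟨ht4, g8, gS, g16, -, gopt⟩
  -- Every position `k` of the lower slope is compared with all positions of the upper slope at once.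
  refine (WP.loop (fun s' => s'.word 8 0 ≤ 2 * m ∧
    SweepState pos₁ pos₂ m P (s'.word 8 0) s' ∧
    s'.real 16 0 = covered pos₁ pos₂ m (s'.word 23 0) (s'.word 24 0) ∧
    ∀ k ≤ s'.word 8 0, ∀ a < P, covered pos₁ pos₂ m k a ≤ s'.real 16 0)
    (fun s' => (222 * Nat.size (2 * P) + 400) * (2 * m - s'.word 8 0)) ?_ ?_ ?_).mono ?_
  · rw [g8]
    refine ⟨by omega, gS, g16, fun k hk a ha => ?_⟩
    rw [show k = 0 by omega]; exact gopt a ha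
  · intro s' f5 _
    have d0 : s'.word 0 1 = m := by rw [f5.1 0 rfl, f4.1 0 rfl]; simp [e0]
    simp [Test.Safe, WExpr.Safe, WExpr.eval, d0]; omega
  · rintro s5 f5 ⟨h1, h2, h3, h4⟩ hb
    have d0 : s5.word 0 1 = m := by rw [f5.1 0 rfl, f4.1 0 rfl]; simp [e0]
    have d2 : s5.word 2 0 = P := by rw [f5.1 2 rfl, f4.1 2 rfl]; simp [e2]
    have d6 : s5.word 6 = ord := by rw [f5.1 6 rfl, f4.1 6 rfl]; simp [e6]
    have d7 : s5.word 7 = pos₁ := by rw [f5.1 7 rfl, f4.1 7 rfl]; simp [e7]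
    have d22 : s5.word 22 = pos₂ := by rw [f5.1 22 rfl, f4.1 22 rfl]; simp [e22]
    simp only [Test.Holds, WExpr.eval, d0] at hb
    obtain ⟨k, hk⟩ : ∃ k, s5.word 8 0 = k := ⟨_, rfl⟩
    rw [hk] at h1 h2 h4 hb
    obtain ⟨d, hd⟩ : ∃ d, 2 * m - k = d + 1 := ⟨2 * m - k - 1, by omega⟩
    have hmul : (222 * Nat.size (2 * P) + 400) * (d + 1) =
      (222 * Nat.size (2 * P) + 400) * d + (222 * Nat.size (2 * P) + 400) := by ring
    refine .seq ((processEvent_spec (P := P) (k := k) d0 d2 hM hmP d6 d7 d22 hS hlt hinj hk hb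
      h2).mono ?_)
    rintro t6 s6 f6 ⟨ht6, hSS6⟩
    have c8 : s6.word 8 0 = k := by rw [f6.1 8 rfl, hk]
    have c2 : s6.word 2 0 = P := by rw [f6.1 2 rfl, d2]
    have c16 : s6.real 16 = s5.real 16 := f6.2 16 rfl
    have c23 : s6.word 23 = s5.word 23 := f6.1 23 rfl
    have c24 : s6.word 24 = s5.word 24 := f6.1 24 rfl
    refine .seq (.of_exec rfl (by simp [Prog.SafeAt, WExpr.Safe, WExpr.eval, c8]; omega)
      fun t7 ht7 => ?_)
    have ht7' : t7 ≤ 6 := ht7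
    simp only [Prog.exec, WExpr.eval, c8]
    have hSS7 : SweepState pos₁ pos₂ m P (k + 1) (s6.setWord 8 0 (k + 1)) := by
      have hv : sumView (s6.setWord 8 0 (k + 1)) = sumView s6 := by funext k; simp [sumView]
      exact ⟨⟨by rw [hv]; exact hSS6.tree.node, by rw [hv]; exact hSS6.tree.leaf⟩, hSS6.count⟩
    refine .branch (by simp [Test.Safe, RExpr.Safe, WExpr.Safe]; omega) (fun hc => ?_)
      (fun hc => ?_)
    · simp only [Test.Holds, RExpr.eval, WExpr.eval, State.setWord_real] at hc
      refine (hrec _ (k + 1) (by simp [c2]) (by simp) hSS7).mono ?_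
      rintro t8 s8 - ⟨ht8, i8, iS, i16, iv, iopt⟩
      rw [i8]
      refine ⟨⟨by omega, iS, i16, fun k' hk' a ha => ?_⟩, ?_⟩
      · rcases Nat.lt_or_ge k' (k + 1) with h | h
        · have := h4 k' (by omega) a ha
          rw [iv, State.setWord_real]
          rw [c16] at hc
          linarith
        · rw [show k' = k + 1 by omega]; exact iopt a ha
      · rw [hk, show 2 * m - (k + 1) = d by omega, hd, hmul]
        simp only [Test.cost, RExpr.cost, WExpr.cost]
        omega
    · simp only [Test.Holds, RExpr.eval, WExpr.eval, State.setWord_real, not_lt] at hc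
      refine .of_exec rfl trivial fun t8 ht8 => ?_
      have ht8' : t8 ≤ 1 := ht8
      obtain ⟨a0, -, -, -, hr2⟩ := hSS7.root hPH
      simp only [Prog.exec, State.setWord_word_self, Function.update_self, ne_eq, Nat.reduceEqDiff,
        not_false_eq_true, State.setWord_word_of_ne, State.setWord_real, c16, c23, c24]
      refine ⟨⟨by omega, hSS7, h3, fun k' hk' a ha => ?_⟩, ?_⟩
      · rcases Nat.lt_or_ge k' (k + 1) with h | h
        · exact h4 k' (by omega) a ha
        · rw [show k' = k + 1 by omega]
          have := hr2 a ha
          rw [State.setWord_real] at this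
          rw [c16] at hc
          linarith
      · rw [hk, show 2 * m - (k + 1) = d by omega, hd, hmul]
        simp only [Test.cost, RExpr.cost, WExpr.cost]
        omega
  · rintro t5 s5 f5 ⟨⟨h1, h2, h3, h4⟩, hb, ht5⟩
    have d0 : s5.word 0 1 = m := by rw [f5.1 0 rfl, f4.1 0 rfl]; simp [e0]
    simp only [Test.Holds, WExpr.eval, d0] at hb
    refine ⟨?_, fun k hk a ha => ?_⟩
    · simp only [Test.cost, WExpr.cost, g8, Nat.sub_zero] at ht5
      have hL : 1 ≤ Nat.size (2 * P) := Nat.size_pos.2 (by omega)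
      set L := Nat.size (2 * P)
      have h1 : P ≤ P * L := Nat.le_mul_of_pos_right _ hL
      have h2 : m * L ≤ P * L := Nat.mul_le_mul_right _ (by omega)
      have h3 : (222 * L + 250) * m = 222 * (m * L) + 250 * m := by ring
      have h4 : (222 * L + 400) * (2 * m) = 444 * (m * L) + 800 * m := by ring
      omega
    · rw [← h3]
      exact h4 k (by omega) a (by omega)

/-! ### The lines -/

/-- The number `l` is the maximum of `l₀` and the numbers `σ j` for the indices `j < n` in `S`. -/
def IsTop (S : ℕ → Prop) (σ : ℕ → ℝ) (n : ℕ) (l₀ l : ℝ) : Prop :=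
  l₀ ≤ l ∧ (l = l₀ ∨ ∃ j < n, S j ∧ l = σ j) ∧ ∀ j < n, S j → σ j ≤ l

section IsTop

variable {S : ℕ → Prop} {σ : ℕ → ℝ} {n : ℕ} {l₀ l : ℝ}

theorem IsTop.zero : IsTop S σ 0 l₀ l₀ := ⟨le_rfl, .inl rfl, by simp⟩

theorem IsTop.replace (h : IsTop S σ n l₀ l) (hS : S n) (hl : l < σ n) :
    IsTop S σ (n + 1) l₀ (σ n) := by
  refine ⟨h.1.trans hl.le, .inr ⟨n, by omega, hS, rfl⟩, fun j hj hjS => ?_⟩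
  rcases Nat.lt_or_ge j n with h1 | h1
  · exact (h.2.2 j h1 hjS).trans hl.le
  · rw [show j = n by omega]

theorem IsTop.keep (h : IsTop S σ n l₀ l) (hS : ¬ (S n ∧ l < σ n)) : IsTop S σ (n + 1) l₀ l := by
  refine ⟨h.1, h.2.1.imp_right fun ⟨j, hj, h2⟩ => ⟨j, by omega, h2⟩, fun j hj hjS => ?_⟩
  rcases Nat.lt_or_ge j n with h1 | h1
  · exact h.2.2 j h1 hjS
  · obtain rfl : j = n := by omega
    exact not_lt.1 fun h2 => hS ⟨hjS, h2⟩

end IsTop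

/-- The test whether interval `j` (variable 8) is active after the number of endpoints in variable
`b`, where word array `a` holds the positions of the endpoints. -/
def activeTest (a b : ℕ) : Test :=
  .and (.wlt (.read a (wvar 8)) (wvar b))
    (.not (.wlt (.read a (.add (.read 0 (.lit 1)) (wvar 8))) (wvar b)))

/-- Choose slopes in the intersections of the active intervals: for the lower line, the left end of
the intersection (real variable 18), and for the upper line, the right end of the intersection (real
variable 20), or the left end (real variable 19) if the right end is the slope of the lower line. -/
def chooseSlopes : Prog :=
  let right := WExpr.add (.read 0 (.lit 1)) (wvar 8)
  .seq (.seq (rset 18 (.sub (.lit 0) (rvar 10))) (.seq (rset 19 (.sub (.lit 0) (rvar 10)))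
      (.seq (rset 20 (rvar 10)) (wset 8 (.lit 0)))))
    (.seq
      (.loop (.wlt (wvar 8) (.read 0 (.lit 1)))
        (.seq (.branch (.and (activeTest 7 23) (.rlt (rvar 18) (.read 14 (wvar 8))))
          (rset 18 (.read 14 (wvar 8))) .skip)
        (.seq (.branch (.and (activeTest 22 24) (.rlt (rvar 19) (.read 15 (wvar 8))))
          (rset 19 (.read 15 (wvar 8))) .skip)
        (.seq (.branch (.and (activeTest 22 24) (.rlt (.read 15 right) (rvar 20)))
          (rset 20 (.read 15 right)) .skip)
        (wset 8 (.add (wvar 8) (.lit 1)))))))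
      (.branch (.or (.rlt (rvar 18) (rvar 20)) (.rlt (rvar 20) (rvar 18))) .skip
        (rset 20 (rvar 19))))

theorem maxStep_spec {M a n : ℕ} {S : ℕ → Prop} {σ : ℕ → ℝ} {l₀ : ℝ} {b : Test} {e : RExpr}
    {s : State} (hM : 0 < M) (hs : b.Safe M s) (he : e.Safe M s) (hcost : b.cost + e.cost ≤ 80)
    (hev : e.eval s = σ n) (hb : b.Holds s ↔ S n ∧ s.real a 0 < σ n)
    (h : IsTop S σ n l₀ (s.real a 0)) :
    WP M (.branch b (rset a e) .skip) s fun t s' => t ≤ 90 ∧ IsTop S σ (n + 1) l₀ (s'.real a 0) := by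
  refine .branch hs (fun hc => ?_) (fun hc => ?_)
  · refine .of_exec rfl ⟨hM, he⟩ fun t ht => ?_
    simp only [Prog.time, WExpr.cost] at ht
    obtain ⟨h1, h2⟩ := hb.1 hc
    refine ⟨by omega, ?_⟩
    simp only [Prog.exec, WExpr.eval, State.setReal_real_self, Function.update_self, hev]
    exact h.replace h1 h2
  · refine .of_exec rfl trivial fun t ht => ?_
    simp only [Prog.time] at ht
    exact ⟨by omega, h.keep fun h' => hc (hb.2 h')⟩

theorem minStep_spec {M a n : ℕ} {S : ℕ → Prop} {σ : ℕ → ℝ} {l₀ : ℝ} {b : Test} {e : RExpr}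
    {s : State} (hM : 0 < M) (hs : b.Safe M s) (he : e.Safe M s) (hcost : b.cost + e.cost ≤ 80)
    (hev : e.eval s = σ n) (hb : b.Holds s ↔ S n ∧ σ n < s.real a 0)
    (h : IsTop S (fun j => - σ j) n l₀ (- s.real a 0)) :
    WP M (.branch b (rset a e) .skip) s fun t s' => t ≤ 90 ∧
      IsTop S (fun j => - σ j) (n + 1) l₀ (- s'.real a 0) := by
  refine .branch hs (fun hc => ?_) (fun hc => ?_)
  · refine .of_exec rfl ⟨hM, he⟩ fun t ht => ?_
    simp only [Prog.time, WExpr.cost] at ht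
    obtain ⟨h1, h2⟩ := hb.1 hc
    refine ⟨by omega, ?_⟩
    simp only [Prog.exec, WExpr.eval, State.setReal_real_self, Function.update_self, hev]
    exact h.replace h1 (by simpa using h2)
  · refine .of_exec rfl trivial fun t ht => ?_
    simp only [Prog.time] at ht
    exact ⟨by omega, h.keep fun h' => hc (hb.2 (by simpa using h'))⟩

theorem activeTest_holds {a b m : ℕ} {s : State} (hm : s.word 0 1 = m) :
    (activeTest a b).Holds s ↔ Active (s.word a) m (s.word b 0) (s.word 8 0) := by
  simp [activeTest, Test.Holds, WExpr.eval, Active, hm]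

theorem activeTest_safe {M a b m : ℕ} {s : State} (hm : s.word 0 1 = m)
    (hM : m + s.word 8 0 + 2 < M) : (activeTest a b).Safe M s := by
  simp [activeTest, Test.Safe, WExpr.Safe, WExpr.eval, hm]; omega

theorem chooseSlopes_spec {M m : ℕ} {s : State} (hm : s.word 0 1 = m) (hM : 2 * m + 8 < M) :
    WP M chooseSlopes s fun t s' => t ≤ 320 * m + 100 ∧ ∃ lo hi,
      IsTop (Active (s.word 7) m (s.word 23 0)) (s.real 14) m (-s.real 10 0) (s'.real 18 0) ∧
      IsTop (Active (s.word 22) m (s.word 24 0)) (s.real 15) m (-s.real 10 0) lo ∧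
      IsTop (Active (s.word 22) m (s.word 24 0)) (fun j => -s.real 15 (m + j)) m (-s.real 10 0)
        (-hi) ∧
      (s'.real 18 0 ≠ hi ∧ s'.real 20 0 = hi ∨ s'.real 18 0 = hi ∧ s'.real 20 0 = lo) := by
  obtain ⟨K, hK⟩ : ∃ K, s.real 10 0 = K := ⟨_, rfl⟩
  obtain ⟨A₁, hA₁⟩ : ∃ A₁, Active (s.word 7) m (s.word 23 0) = A₁ := ⟨_, rfl⟩
  obtain ⟨A₂, hA₂⟩ : ∃ A₂, Active (s.word 22) m (s.word 24 0) = A₂ := ⟨_, rfl⟩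
  rw [hK, hA₁, hA₂]
  refine .seq (.of_exec rfl (by simp [Prog.SafeAt, RExpr.Safe, WExpr.Safe]; omega) fun t ht => ?_)
  have ht' : t ≤ 30 := ht.trans (by decide)
  refine .seq ((WP.loop (fun s' => s'.word 8 0 ≤ m ∧
    IsTop A₁ (s.real 14) (s'.word 8 0) (-K) (s'.real 18 0) ∧
    IsTop A₂ (s.real 15) (s'.word 8 0) (-K) (s'.real 19 0) ∧
    IsTop A₂ (fun j => -s.real 15 (m + j)) (s'.word 8 0) (-K) (-s'.real 20 0))
    (fun s' => 320 * (m - s'.word 8 0)) ?_ ?_ ?_).mono ?_)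
  · simp [Prog.exec, RExpr.eval, WExpr.eval, hK, IsTop.zero]
  · intro s' _ _
    simp [Test.Safe, WExpr.Safe]; omega
  · rintro s1 f1 ⟨h1, h2, h3, h4⟩ hb
    have e0 : s1.word 0 1 = m := by rw [f1.1 0 rfl]; simp [Prog.exec, hm]
    have e7 : s1.word 7 = s.word 7 := by rw [f1.1 7 rfl]; simp [Prog.exec]
    have e22 : s1.word 22 = s.word 22 := by rw [f1.1 22 rfl]; simp [Prog.exec]
    have e23 : s1.word 23 = s.word 23 := by rw [f1.1 23 rfl]; simp [Prog.exec]
    have e24 : s1.word 24 = s.word 24 := by rw [f1.1 24 rfl]; simp [Prog.exec]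
    have r14 : s1.real 14 = s.real 14 := by rw [f1.2 14 rfl]; simp [Prog.exec]
    have r15 : s1.real 15 = s.real 15 := by rw [f1.2 15 rfl]; simp [Prog.exec]
    simp only [Test.Holds, WExpr.eval, e0] at hb
    obtain ⟨k, hk⟩ : ∃ k, s1.word 8 0 = k := ⟨_, rfl⟩
    rw [hk] at h1 h2 h3 h4 hb
    refine .seq ((maxStep_spec (n := k) (S := A₁) (σ := s.real 14) (l₀ := -K) (by omega) ?_ ?_
      (by decide) ?_ ?_ h2).mono ?_)
    · exact ⟨activeTest_safe e0 (by omega), by simp [Test.Safe, RExpr.Safe, WExpr.Safe]; omega⟩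
    · simp [RExpr.Safe, WExpr.Safe]; omega
    · simp [RExpr.eval, WExpr.eval, hk, r14]
    · rw [Test.Holds, activeTest_holds e0, e7, e23, hA₁, hk]
      simp [Test.Holds, RExpr.eval, WExpr.eval, hk, r14]
    rintro t2 s2 f2 ⟨ht2, g2⟩
    have w2 : s2.word = s1.word := funext fun a => f2.1 a rfl
    have g3 : IsTop A₂ (s.real 15) k (-K) (s2.real 19 0) := by rw [f2.2 19 rfl]; exact h3
    refine .seq ((maxStep_spec (n := k) (S := A₂) (σ := s.real 15) (l₀ := -K) (by omega) ?_ ?_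
      (by decide) ?_ ?_ g3).mono ?_)
    · exact ⟨activeTest_safe (by rw [w2, e0]) (by rw [w2]; omega),
        by simp [Test.Safe, RExpr.Safe, WExpr.Safe]; omega⟩
    · simp [RExpr.Safe, WExpr.Safe]; omega
    · simp [RExpr.eval, WExpr.eval, w2, hk, f2.2 15 rfl, r15]
    · rw [Test.Holds, activeTest_holds (by rw [w2, e0]), w2, e22, e24, hA₂, hk]
      simp [Test.Holds, RExpr.eval, WExpr.eval, w2, hk, f2.2 15 rfl, r15]
    rintro t3 s3 f3 ⟨ht3, i3⟩
    have w3 : s3.word = s1.word := funext fun a => (f3.1 a rfl).trans (f2.1 a rfl)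
    have g4 : IsTop A₂ (fun j => -s.real 15 (m + j)) k (-K) (-s3.real 20 0) := by
      rw [f3.2 20 rfl, f2.2 20 rfl]; exact h4
    have r153 : s3.real 15 = s.real 15 := by rw [f3.2 15 rfl, f2.2 15 rfl, r15]
    refine .seq ((minStep_spec (n := k) (S := A₂) (σ := fun j => s.real 15 (m + j)) (l₀ := -K)
      (by omega) ?_ ?_ (by decide) ?_ ?_ g4).mono ?_)
    · exact ⟨activeTest_safe (by rw [w3, e0]) (by rw [w3]; omega),
        by simp [Test.Safe, RExpr.Safe, WExpr.Safe, WExpr.eval, w3, e0, hk]; omega⟩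
    · simp [RExpr.Safe, WExpr.Safe, WExpr.eval, w3, e0, hk]; omega
    · simp [RExpr.eval, WExpr.eval, w3, hk, e0, r153]
    · rw [Test.Holds, activeTest_holds (by rw [w3, e0]), w3, e22, e24, hA₂, hk]
      simp [Test.Holds, RExpr.eval, WExpr.eval, w3, hk, e0, r153]
    rintro t4 s4 f4 ⟨ht4, j4⟩
    have w4 : s4.word 8 0 = k := by rw [f4.1 8 rfl, w3, hk]
    have j2 : s4.real 18 = s2.real 18 := by rw [f4.2 18 rfl, f3.2 18 rfl]
    have j3 : s4.real 19 = s3.real 19 := f4.2 19 rfl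
    refine .of_exec rfl (by simp [Prog.SafeAt, WExpr.Safe, WExpr.eval, w4]; omega) fun t5 ht5 => ?_
    have ht5' : t5 ≤ 6 := ht5
    simp only [Prog.exec, WExpr.eval, State.setWord_word_self, Function.update_self, w4,
      State.setWord_real, Test.cost, WExpr.cost, j2, j3]
    exact ⟨⟨by omega, g2, i3, j4⟩, by omega⟩
  · rintro t1 s1 f1 ⟨⟨h1, h2, h3, h4⟩, hb, ht1⟩
    have e0 : s1.word 0 1 = m := by rw [f1.1 0 rfl]; simp [Prog.exec, hm]
    simp only [Test.Holds, WExpr.eval, e0] at hb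
    rw [show s1.word 8 0 = m by omega] at h2 h3 h4
    have ht1' : t1 ≤ 320 * m + 7 := by
      simp [Test.cost, WExpr.cost, Prog.exec, WExpr.eval] at ht1; omega
    refine .branch (by simp [Test.Safe, Test.or, RExpr.Safe, WExpr.Safe]; omega) (fun hc => ?_)
      (fun hc => ?_)
    · rw [Test.or_holds] at hc
      simp only [Test.Holds, RExpr.eval, WExpr.eval] at hc
      refine .of_exec rfl trivial fun t2 ht2 => ?_
      have ht2' : t2 ≤ 1 := ht2
      refine ⟨by simp only [Test.or, Test.cost, RExpr.cost, WExpr.cost]; omega, _, _, h2, h3, h4,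
        .inl ⟨?_, rfl⟩⟩
      rcases hc with hc | hc
      · exact hc.ne
      · exact hc.ne'
    · rw [Test.or_holds] at hc
      simp only [Test.Holds, RExpr.eval, WExpr.eval, not_or, not_lt] at hc
      refine .of_exec rfl (by simp [Prog.SafeAt, RExpr.Safe, WExpr.Safe]; omega) fun t2 ht2 => ?_
      have ht2' : t2 ≤ 5 := ht2.trans (by decide)
      refine ⟨by simp only [Test.or, Test.cost, RExpr.cost, WExpr.cost]; omega, _, _,
        by simpa [Prog.exec] using h2, h3, h4, .inr ⟨?_, ?_⟩⟩
      · simp only [Prog.exec, ne_eq, Nat.reduceEqDiff, not_false_eq_true, State.setReal_real_of_ne]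
        exact le_antisymm hc.2 hc.1
      · simp [Prog.exec, RExpr.eval, WExpr.eval]

/-- Compute the intercepts (real variables 21 and 22) of the lines of the chosen slopes that touch
the blue points from below and from above. -/
def intercepts : Prog :=
  let f (a : ℕ) (j : WExpr) := RExpr.sub (.read 1 j) (.mul (rvar a) (.read 0 j))
  .seq (.seq (rset 21 (f 18 (.lit 0))) (.seq (rset 22 (f 20 (.lit 0))) (wset 8 (.lit 0))))
    (.loop (.wlt (wvar 8) (wvar 0))
      (.seq (.branch (.rlt (f 18 (wvar 8)) (rvar 21)) (rset 21 (f 18 (wvar 8))) .skip)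
      (.seq (.branch (.rlt (rvar 22) (f 20 (wvar 8))) (rset 22 (f 20 (wvar 8))) .skip)
        (wset 8 (.add (wvar 8) (.lit 1))))))

theorem intercepts_spec {M b : ℕ} {s : State} (hb : s.word 0 0 = b) (hb0 : 0 < b)
    (hM : b + 8 < M) :
    WP M intercepts s fun t s' => t ≤ 200 * b + 60 ∧
      (∃ q < b, s'.real 21 0 = s.real 1 q - s.real 18 0 * s.real 0 q) ∧
      (∀ q < b, s'.real 21 0 ≤ s.real 1 q - s.real 18 0 * s.real 0 q) ∧
      (∃ q < b, s'.real 22 0 = s.real 1 q - s.real 20 0 * s.real 0 q) ∧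
      (∀ q < b, s.real 1 q - s.real 20 0 * s.real 0 q ≤ s'.real 22 0) := by
  obtain ⟨f, hf⟩ : ∃ f : ℕ → ℝ, f = fun q => s.real 1 q - s.real 18 0 * s.real 0 q := ⟨_, rfl⟩
  obtain ⟨g, hg⟩ : ∃ g : ℕ → ℝ, g = fun q => s.real 1 q - s.real 20 0 * s.real 0 q := ⟨_, rfl⟩
  have hf' : ∀ q, s.real 1 q - s.real 18 0 * s.real 0 q = f q := fun q => by rw [hf]
  have hg' : ∀ q, s.real 1 q - s.real 20 0 * s.real 0 q = g q := fun q => by rw [hg]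
  simp only [hf', hg']
  refine .seq (.of_exec rfl (by simp [Prog.SafeAt, RExpr.Safe, WExpr.Safe]; omega) fun t ht => ?_)
  have ht' : t ≤ 50 := ht.trans (by decide)
  refine (WP.loop (fun s' => s'.word 8 0 ≤ b ∧
    IsTop (fun _ => True) (fun q => - f q) (s'.word 8 0) (-f 0) (-s'.real 21 0) ∧
    IsTop (fun _ => True) g (s'.word 8 0) (g 0) (s'.real 22 0))
    (fun s' => 200 * (b - s'.word 8 0)) ?_ ?_ ?_).mono ?_
  · simp [Prog.exec, RExpr.eval, WExpr.eval, hf', hg', IsTop.zero]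
  · intro s' _ _
    simp [Test.Safe, WExpr.Safe]; omega
  · rintro s1 f1 ⟨h1, h2, h3⟩ hc
    have e0 : s1.word 0 0 = b := by rw [f1.1 0 rfl]; simp [Prog.exec, hb]
    have r0 : s1.real 0 = s.real 0 := by rw [f1.2 0 rfl]; simp [Prog.exec]
    have r1 : s1.real 1 = s.real 1 := by rw [f1.2 1 rfl]; simp [Prog.exec]
    have r18 : s1.real 18 = s.real 18 := by rw [f1.2 18 rfl]; simp [Prog.exec]
    have r20 : s1.real 20 = s.real 20 := by rw [f1.2 20 rfl]; simp [Prog.exec]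
    simp only [Test.Holds, WExpr.eval, e0] at hc
    obtain ⟨k, hk⟩ : ∃ k, s1.word 8 0 = k := ⟨_, rfl⟩
    rw [hk] at h1 h2 h3 hc
    refine .seq ((minStep_spec (n := k) (S := fun _ => True) (σ := f) (l₀ := -f 0)
      (by omega) ?_ ?_ (by decide) ?_ ?_ h2).mono ?_)
    · simp [Test.Safe, RExpr.Safe, WExpr.Safe]; omega
    · simp [RExpr.Safe, WExpr.Safe]; omega
    · simp [RExpr.eval, WExpr.eval, hk, r0, r1, r18, hf']
    · simp [Test.Holds, RExpr.eval, WExpr.eval, hk, r0, r1, r18, hf']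
    rintro t2 s2 f2 ⟨ht2, g2⟩
    have w2 : s2.word = s1.word := funext fun a => f2.1 a rfl
    have g3 : IsTop (fun _ => True) g k (g 0) (s2.real 22 0) := by rw [f2.2 22 rfl]; exact h3
    refine .seq ((maxStep_spec (n := k) (S := fun _ => True) (σ := g) (l₀ := g 0)
      (by omega) ?_ ?_ (by decide) ?_ ?_ g3).mono ?_)
    · simp [Test.Safe, RExpr.Safe, WExpr.Safe]; omega
    · simp [RExpr.Safe, WExpr.Safe]; omega
    · simp [RExpr.eval, WExpr.eval, w2, hk, f2.2 0 rfl, f2.2 1 rfl, f2.2 20 rfl, r0, r1, r20, hg']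
    · simp [Test.Holds, RExpr.eval, WExpr.eval, w2, hk, f2.2 0 rfl, f2.2 1 rfl, f2.2 20 rfl, r0, r1,
        r20, hg']
    rintro t3 s3 f3 ⟨ht3, i3⟩
    have w3 : s3.word 8 0 = k := by rw [f3.1 8 rfl, w2, hk]
    have j2 : s3.real 21 = s2.real 21 := f3.2 21 rfl
    refine .of_exec rfl (by simp [Prog.SafeAt, WExpr.Safe, WExpr.eval, w3]; omega) fun t5 ht5 => ?_
    have ht5' : t5 ≤ 6 := ht5
    simp only [Prog.exec, WExpr.eval, State.setWord_word_self, Function.update_self, w3,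
      State.setWord_real, Test.cost, WExpr.cost, j2]
    exact ⟨⟨by omega, g2, i3⟩, by omega⟩
  · rintro t1 s1 f1 ⟨⟨h1, h2, h3⟩, hc, ht1⟩
    have e0 : s1.word 0 0 = b := by rw [f1.1 0 rfl]; simp [Prog.exec, hb]
    simp only [Test.Holds, WExpr.eval, e0] at hc
    rw [show s1.word 8 0 = b by omega] at h2 h3
    have ht1' : t1 ≤ 200 * b + 6 := by
      simp [Test.cost, WExpr.cost, Prog.exec, WExpr.eval] at ht1; omega
    refine ⟨by omega, ?_, fun q hq => neg_le_neg_iff.1 (h2.2.2 q hq trivial), ?_,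
      fun q hq => h3.2.2 q hq trivial⟩
    · rcases h2.2.1 with h | ⟨q, hq, -, h⟩
      · exact ⟨0, hb0, neg_injective h⟩
      · exact ⟨q, hq, neg_injective h⟩
    · rcases h3.2.1 with h | ⟨q, hq, -, h⟩
      · exact ⟨0, hb0, h⟩
      · exact ⟨q, hq, h⟩

/-- Write the result: the lower line is the first one if it has the smaller slope, and the region is
their East wedge; otherwise the upper line is the first one, and the region is their West wedge. -/
def output : Prog :=
  let put (i : ℕ) (a : ℕ) := Prog.setReal 4 (.lit i) (rvar a)
  .branch (.rlt (rvar 18) (rvar 20))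
    (.seq (put 0 18) (.seq (put 1 21) (.seq (put 2 20) (.seq (put 3 22) (wset 1 (.lit 0))))))
    (.seq (put 0 20) (.seq (put 1 22) (.seq (put 2 18) (.seq (put 3 21) (wset 1 (.lit 1))))))

/-- The final memory holds the line with slope `a₁` and intercept `c₁` as the lower one, and the
line with slope `a₂` and intercept `c₂` as the upper one. -/
def IsOutput (s : State) (a₁ c₁ a₂ c₂ : ℝ) : Prop :=
  (a₁ < a₂ ∧ s.word 1 0 = 0 ∧ TwoLines.outLine₁ s = ⟨a₁, c₁⟩ ∧ TwoLines.outLine₂ s = ⟨a₂, c₂⟩) ∨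
  (a₂ < a₁ ∧ s.word 1 0 = 1 ∧ TwoLines.outLine₁ s = ⟨a₂, c₂⟩ ∧ TwoLines.outLine₂ s = ⟨a₁, c₁⟩)

theorem output_spec {M : ℕ} {s : State} (hM : 8 < M) (hne : s.real 18 0 ≠ s.real 20 0) :
    WP M output s fun t s' => t ≤ 60 ∧
      IsOutput s' (s.real 18 0) (s.real 21 0) (s.real 20 0) (s.real 22 0) := by
  refine .branch (by simp [Test.Safe, RExpr.Safe, WExpr.Safe]; omega) (fun hc => ?_) (fun hc => ?_)
  all_goals
    simp only [Test.Holds, RExpr.eval, WExpr.eval] at hc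
    refine .of_exec rfl (by simp [Prog.SafeAt, RExpr.Safe, WExpr.Safe]; omega) fun t ht => ?_
    have ht' : t ≤ 50 := ht.trans (by decide)
    refine ⟨by simp only [Test.cost, RExpr.cost, WExpr.cost]; omega, ?_⟩
  · left
    simp [Prog.exec, WExpr.eval, RExpr.eval, TwoLines.outLine₁, TwoLines.outLine₂, hc]
  · right
    refine ⟨lt_of_le_of_ne (not_lt.1 hc) hne.symm, ?_⟩
    simp [Prog.exec, WExpr.eval, RExpr.eval, TwoLines.outLine₁, TwoLines.outLine₂]

/-- Without blue points, a wedge above the red points is a solution. -/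
def noBlue : Prog :=
  .seq (.seq (rset 21 (.lit 0)) (wset 8 (.lit 0)))
    (.seq
      (.loop (.wlt (wvar 8) (.read 0 (.lit 1)))
        (.seq (.branch (.rlt (rvar 21) (.read 3 (wvar 8))) (rset 21 (.read 3 (wvar 8))) .skip)
          (wset 8 (.add (wvar 8) (.lit 1)))))
      (.seq (.seq (rset 18 (.lit 0)) (.seq (rset 20 (.lit 1)) (rset 22 (.lit 0)))) output))

theorem noBlue_spec {M m : ℕ} {s : State} (hm : s.word 0 1 = m) (hM : m + 8 < M) :
    WP M noBlue s fun t s' => t ≤ 120 * m + 120 ∧ ∃ c₁,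
      IsOutput s' 0 c₁ 1 0 ∧ ∀ j < m, s.real 3 j ≤ c₁ := by
  refine .seq (.of_exec rfl (by simp [Prog.SafeAt, RExpr.Safe, WExpr.Safe]; omega) fun t ht => ?_)
  have ht' : t ≤ 20 := ht.trans (by decide)
  refine .seq ((WP.loop (fun s' => s'.word 8 0 ≤ m ∧
    IsTop (fun _ => True) (s.real 3) (s'.word 8 0) 0 (s'.real 21 0))
    (fun s' => 120 * (m - s'.word 8 0)) ?_ ?_ ?_).mono ?_)
  · simp [Prog.exec, RExpr.eval, WExpr.eval, IsTop.zero]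
  · intro s' _ _
    simp [Test.Safe, WExpr.Safe]; omega
  · rintro s1 f1 ⟨h1, h2⟩ hc
    have e0 : s1.word 0 1 = m := by rw [f1.1 0 rfl]; simp [Prog.exec, hm]
    have r3 : s1.real 3 = s.real 3 := by rw [f1.2 3 rfl]; simp [Prog.exec]
    simp only [Test.Holds, WExpr.eval, e0] at hc
    obtain ⟨k, hk⟩ : ∃ k, s1.word 8 0 = k := ⟨_, rfl⟩
    rw [hk] at h1 h2 hc
    refine .seq ((maxStep_spec (n := k) (S := fun _ => True) (σ := s.real 3) (l₀ := 0)
      (by omega) ?_ ?_ (by decide) ?_ ?_ h2).mono ?_)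
    · simp [Test.Safe, RExpr.Safe, WExpr.Safe]; omega
    · simp [RExpr.Safe, WExpr.Safe]; omega
    · simp [RExpr.eval, WExpr.eval, hk, r3]
    · simp [Test.Holds, RExpr.eval, WExpr.eval, hk, r3]
    rintro t2 s2 f2 ⟨ht2, g2⟩
    have w2 : s2.word 8 0 = k := by rw [f2.1 8 rfl, hk]
    refine .of_exec rfl (by simp [Prog.SafeAt, WExpr.Safe, WExpr.eval, w2]; omega) fun t5 ht5 => ?_
    have ht5' : t5 ≤ 6 := ht5
    simp only [Prog.exec, WExpr.eval, State.setWord_word_self, Function.update_self, w2,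
      State.setWord_real, Test.cost, WExpr.cost]
    exact ⟨⟨by omega, g2⟩, by omega⟩
  · rintro t1 s1 f1 ⟨⟨h1, h2⟩, hc, ht1⟩
    have e0 : s1.word 0 1 = m := by rw [f1.1 0 rfl]; simp [Prog.exec, hm]
    simp only [Test.Holds, WExpr.eval, e0] at hc
    rw [show s1.word 8 0 = m by omega] at h2
    have ht1' : t1 ≤ 120 * m + 7 := by
      simp [Test.cost, WExpr.cost, Prog.exec, WExpr.eval] at ht1; omega
    refine .seq (.of_exec rfl (by simp [Prog.SafeAt, RExpr.Safe, WExpr.Safe]; omega) fun t2 ht2 => ?_)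
    have ht2' : t2 ≤ 20 := ht2.trans (by decide)
    refine (output_spec (by omega) (by simp [Prog.exec, WExpr.eval, RExpr.eval])).mono ?_
    rintro t3 s3 - ⟨ht3, ho⟩
    refine ⟨by omega, s1.real 21 0, ?_, fun j hj => h2.2.2 j hj trivial⟩
    simpa [Prog.exec, WExpr.eval, RExpr.eval] using ho

/-- The program for inputs with blue points. -/
def someBlue : Prog :=
  .seq allTangents (.seq slopeBound (.seq storeEnds (.seq sortEnds (.seq sweep
    (.seq chooseSlopes (.seq intercepts output))))))

/-- What the program for inputs with blue points computes: slopes `a₁` and `a₂` in the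
intersections of the intervals that are active at an optimal pair of positions, and the intercepts
of the lines of these slopes that touch the blue points from below and above. -/
structure IsChoice (b m : ℕ) (X Y : ℕ → ℝ) (a₁ c₁ a₂ c₂ : ℝ) (K lo hi : ℝ) (e₁ e₂ : ℕ → ℝ)
    (ord₁ pos₁ ord₂ pos₂ : ℕ → ℕ) (k a : ℕ) : Prop where
  ends : IsEnds b m X Y K e₁ e₂
  sorted₁ : Sorted e₁ (2 * m) ord₁ pos₁
  sorted₂ : Sorted e₂ (2 * m) ord₂ pos₂
  optimal : ∀ k' ≤ 2 * m, ∀ a' ≤ 2 * m, covered pos₁ pos₂ m k' a' ≤ covered pos₁ pos₂ m k a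
  top₁ : IsTop (Active pos₁ m k) e₁ m (-K) a₁
  lo_top : IsTop (Active pos₂ m a) e₂ m (-K) lo
  hi_top : IsTop (Active pos₂ m a) (fun j => -e₂ (m + j)) m (-K) (-hi)
  slope₂ : a₁ ≠ hi ∧ a₂ = hi ∨ a₁ = hi ∧ a₂ = lo
  touch₁ : (∃ q < b, c₁ = Y q - a₁ * X q) ∧ ∀ q < b, c₁ ≤ Y q - a₁ * X q
  touch₂ : (∃ q < b, c₂ = Y q - a₂ * X q) ∧ ∀ q < b, Y q - a₂ * X q ≤ c₂

theorem someBlue_spec {M n b m : ℕ} {s : State} (hM : 16 * n + 20 < M)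
    (hbn : b ≤ n) (hmn : m ≤ n) (hn : 2 ≤ n)
    (hb : s.word 0 0 = b) (hm : s.word 0 1 = m) (hb0 : 0 < b)
    (hxi : ∀ i < b + m, ∀ j < b + m,
      join b (s.real 0) (s.real 2) i = join b (s.real 0) (s.real 2) j → i = j)
    (hne : ∀ {a₁ c₁ a₂ c₂ K lo hi : ℝ} {e₁ e₂ : ℕ → ℝ} {ord₁ pos₁ ord₂ pos₂ : ℕ → ℕ} {k a : ℕ},
      IsChoice b m (join b (s.real 0) (s.real 2)) (join b (s.real 1) (s.real 3)) a₁ c₁ a₂ c₂ K lo hi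
        e₁ e₂ ord₁ pos₁ ord₂ pos₂ k a → a₁ ≠ a₂) :
    WP M someBlue s fun t s' => t ≤ 60000 * (n * Nat.size (16 * n)) ∧
      ∃ a₁ c₁ a₂ c₂ K lo hi e₁ e₂ ord₁ pos₁ ord₂ pos₂ k a,
      IsChoice b m (join b (s.real 0) (s.real 2)) (join b (s.real 1) (s.real 3)) a₁ c₁ a₂ c₂ K lo hi
        e₁ e₂ ord₁ pos₁ ord₂ pos₂ k a ∧ IsOutput s' a₁ c₁ a₂ c₂ := by
  obtain ⟨X, hX⟩ : ∃ X, join b (s.real 0) (s.real 2) = X := ⟨_, rfl⟩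
  obtain ⟨Y, hY⟩ : ∃ Y, join b (s.real 1) (s.real 3) = Y := ⟨_, rfl⟩
  refine .seq ((allTangents_spec (by omega) hb hm hxi).mono ?_)
  rw [hX, hY] at hne ⊢
  rintro t1 s1 f1 ⟨ht1, T1⟩
  have m1 : s1.word 0 = s.word 0 := f1.1 0 rfl
  refine .seq ((slopeBound_spec (m := m) (by omega) (by rw [m1, hm])).mono ?_)
  rintro t2 s2 f2 ⟨ht2, K0, hK⟩
  have m2 : s2.word 0 = s.word 0 := (f2.1 0 rfl).trans m1
  refine .seq ((storeEnds_spec (m := m) (b := b) (X := X) (Y := Y) (by omega) (by rw [m2, hm]) K0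
    ?_ ?_).mono ?_)
  · rw [f2.1 16 rfl, f2.2 9 rfl]; exact T1
  · rw [f2.2 9 rfl]; exact hK
  rintro t3 s3 f3 ⟨ht3, hE⟩
  have m3 : s3.word 0 = s.word 0 := (f3.1 0 rfl).trans m2
  refine .seq ((sortEnds_spec (m := m) (by omega) (by rw [m3, hm])).mono ?_)
  rintro t4 s4 f4 ⟨ht4, S1, ⟨ord2, S2⟩, P1, P2, H, hH⟩
  have m4 : s4.word 0 = s.word 0 := (f4.1 0 rfl).trans m3
  refine .seq ((sweep_spec (m := m) (by rw [m4, hm]) rfl hH (by omega) P1 rfl rfl rfl S1 S2.pos_lt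
    S2.inj).mono ?_)
  rintro t5 s5 f5 ⟨ht5, hopt⟩
  have m5 : s5.word 0 = s.word 0 := (f5.1 0 rfl).trans m4
  refine .seq ((chooseSlopes_spec (m := m) (by rw [m5, hm]) (by omega)).mono ?_)
  rintro t6 s6 f6 ⟨ht6, lo, hi, ha1, hlo, hhi, hsl⟩
  have m6 : s6.word 0 = s.word 0 := (f6.1 0 rfl).trans m5
  have x6 : s6.real 0 = s.real 0 := by
    rw [f6.2 0 rfl, f5.2 0 rfl, f4.2 0 rfl, f3.2 0 rfl, f2.2 0 rfl, f1.2 0 rfl]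
  have y6 : s6.real 1 = s.real 1 := by
    rw [f6.2 1 rfl, f5.2 1 rfl, f4.2 1 rfl, f3.2 1 rfl, f2.2 1 rfl, f1.2 1 rfl]
  have r14 : s5.real 14 = s3.real 14 := by rw [f5.2 14 rfl, f4.2 14 rfl]
  have r15 : s5.real 15 = s3.real 15 := by rw [f5.2 15 rfl, f4.2 15 rfl]
  have r10 : s5.real 10 = s2.real 10 := by rw [f5.2 10 rfl, f4.2 10 rfl, f3.2 10 rfl]
  rw [r14, r10, f5.1 7 rfl] at ha1
  rw [r15, r10, f5.1 22 rfl] at hlo hhi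
  refine .seq ((intercepts_spec (b := b) (by rw [m6, hb]) hb0 (by omega)).mono ?_)
  rintro t7 s7 f7 ⟨ht7, c1, c2, c3, c4⟩
  have hXq : ∀ q < b, s6.real 0 q = X q := fun q hq => by rw [x6, ← hX]; simp [join, hq]
  have hYq : ∀ q < b, s6.real 1 q = Y q := fun q hq => by rw [y6, ← hY]; simp [join, hq]
  have hchoice : IsChoice b m X Y (s6.real 18 0) (s7.real 21 0) (s6.real 20 0) (s7.real 22 0)
      (s2.real 10 0) lo hi (s3.real 14) (s3.real 15) (s4.word 6) (s4.word 7) ord2 (s4.word 22)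
      (s5.word 23 0) (s5.word 24 0) := by
    refine ⟨hE, S1, S2, hopt, ha1, hlo, hhi, hsl, ⟨?_, ?_⟩, ?_, ?_⟩
    · obtain ⟨q, hq, h⟩ := c1
      exact ⟨q, hq, by rw [h, hXq q hq, hYq q hq]⟩
    · intro q hq
      rw [← hXq q hq, ← hYq q hq]; exact c2 q hq
    · obtain ⟨q, hq, h⟩ := c3
      exact ⟨q, hq, by rw [h, hXq q hq, hYq q hq]⟩
    · intro q hq
      rw [← hXq q hq, ← hYq q hq]; exact c4 q hq
  refine (output_spec (by omega) ?_).mono ?_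
  · rw [f7.2 18 rfl, f7.2 20 rfl]; exact hne hchoice
  rintro t8 s8 - ⟨ht8, ho⟩
  rw [f7.2 18 rfl, f7.2 20 rfl] at ho
  refine ⟨?_, _, _, _, _, _, _, _, _, _, _, _, _, _, _, _, hchoice, ho⟩
  have hL : 1 ≤ Nat.size (16 * n) := Nat.size_pos.2 (by omega)
  have hL1 : Nat.size (4 * (b + m) + 2) ≤ Nat.size (16 * n) := Nat.size_le_size (by omega)
  have hL2 : Nat.size (8 * m + 2) ≤ Nat.size (16 * n) := Nat.size_le_size (by omega)
  have hL3 : Nat.size (2 * s4.word 2 0) ≤ Nat.size (16 * n) := Nat.size_le_size (by omega)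
  set L := Nat.size (16 * n)
  have h0 : n ≤ n * L := Nat.le_mul_of_pos_right _ hL
  have h1 : (b + m + 1) * Nat.size (4 * (b + m) + 2) ≤ (3 * n) * L :=
    Nat.mul_le_mul (by omega) hL1
  have h2 : (2 * m + 1) * Nat.size (8 * m + 2) ≤ (3 * n) * L := Nat.mul_le_mul (by omega) hL2
  have h3 : s4.word 2 0 * Nat.size (2 * s4.word 2 0) ≤ (5 * n) * L :=
    Nat.mul_le_mul (by omega) hL3
  rw [mul_assoc] at h1 h2 h3
  omega

/-- The program of the theorem. -/
def twoLines : Prog := .branch (.wlt (.lit 0) (wvar 0)) someBlue noBlue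

/-! ### Optimality and general position -/

section Choice

variable {b m : ℕ} {X Y : ℕ → ℝ}

theorem slo_comm (p q : ℕ) : slo X Y p q = slo X Y q p := by
  rw [slo, slo, ← neg_sub (Y p), ← neg_sub (X p), neg_div_neg_eq]

theorem slo_le_iff {q z : ℕ} {a : ℝ} (h : X q < X z) :
    slo X Y q z ≤ a ↔ Y z - a * X z ≤ Y q - a * X q := by
  rw [slo, div_le_iff₀ (sub_pos.2 h), mul_sub]
  constructor <;> intro <;> linarith

theorem le_slo_iff {q z : ℕ} {a : ℝ} (h : X q < X z) :
    a ≤ slo X Y q z ↔ Y q - a * X q ≤ Y z - a * X z := by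
  rw [slo, le_div_iff₀ (sub_pos.2 h), mul_sub]
  constructor <;> intro <;> linarith

/-- No point of index below `b` lies below the line of slope `a` through the point with index
`z`. -/
def Below (b : ℕ) (X Y : ℕ → ℝ) (a : ℝ) (z : ℕ) : Prop := ∀ q < b, Y z - a * X z ≤ Y q - a * X q

/-- No point of index below `b` lies above the line of slope `a` through the point with index
`z`. -/
def Above (b : ℕ) (X Y : ℕ → ℝ) (a : ℝ) (z : ℕ) : Prop := ∀ q < b, Y q - a * X q ≤ Y z - a * X z

theorem IsMaxSlope.le {K l a : ℝ} {S : ℕ → Prop} {σ : ℕ → ℝ}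
    (h : IsMaxSlope b K S σ l) (ha : ∀ q < b, S q → σ q ≤ a) : l ≤ max (-K) (min a K) := by
  rcases h.2 with ⟨rfl, -⟩ | ⟨h1, q, hq, hS, rfl⟩
  · exact le_max_left _ _
  · exact (le_min (ha q hq hS) (abs_lt.1 h1).2.le).trans (le_max_right _ _)

theorem IsMinSlope.le {K u a : ℝ} {S : ℕ → Prop} {σ : ℕ → ℝ} (hK : 0 < K)
    (h : IsMinSlope b K S σ u) (ha : ∀ q < b, S q → a ≤ σ q) : max (-K) (min a K) ≤ u := by
  rcases h.2 with ⟨rfl, -⟩ | ⟨h1, q, hq, hS, rfl⟩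
  · exact max_le (by linarith) (min_le_right _ _)
  · exact max_le (abs_lt.1 h1).1.le ((min_le_left _ _).trans (ha q hq hS))

theorem IsMaxSlope.lt_bound {K l : ℝ} {S : ℕ → Prop} {σ : ℕ → ℝ} (hK : 0 < K)
    (h : IsMaxSlope b K S σ l) : l < K := by
  rcases h.2 with ⟨rfl, -⟩ | ⟨h1, -⟩
  · linarith
  · exact (abs_lt.1 h1).2

theorem IsMinSlope.bound_lt {K u : ℝ} {S : ℕ → Prop} {σ : ℕ → ℝ} (hK : 0 < K)
    (h : IsMinSlope b K S σ u) : -K < u := by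
  rcases h.2 with ⟨rfl, -⟩ | ⟨h1, -⟩
  · linarith
  · exact (abs_lt.1 h1).1

variable {K : ℝ} {e₁ e₂ : ℕ → ℝ}

theorem IsEnds.below (h : IsEnds b m X Y K e₁ e₂) (hx : ∀ q < b, ∀ j < m, X q ≠ X (b + j)) {j : ℕ}
    (hj : j < m) {a : ℝ} (h1 : e₁ j ≤ a) (h2 : a ≤ e₁ (m + j)) : Below b X Y a (b + j) := by
  intro q hq
  rcases (hx q hq j hj).lt_or_gt with h' | h'
  · exact (slo_le_iff h').1 (((h.lower_left j hj).1 q hq h').trans h1)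
  · rw [← le_slo_iff h', slo_comm]
    exact h2.trans ((h.lower_right j hj).1 q hq h')

theorem IsEnds.above (h : IsEnds b m X Y K e₁ e₂) (hx : ∀ q < b, ∀ j < m, X q ≠ X (b + j)) {j : ℕ}
    (hj : j < m) {a : ℝ} (h1 : e₂ j ≤ a) (h2 : a ≤ e₂ (m + j)) : Above b X Y a (b + j) := by
  intro q hq
  rcases (hx q hq j hj).lt_or_gt with h' | h'
  · exact (le_slo_iff h').1 (h2.trans ((h.upper_right j hj).1 q hq h'))
  · rw [← slo_le_iff h', slo_comm]
    exact ((h.upper_left j hj).1 q hq h').trans h1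

theorem IsEnds.le_of_below (h : IsEnds b m X Y K e₁ e₂) {j : ℕ} (hj : j < m) {a : ℝ}
    (ha : Below b X Y a (b + j)) :
    e₁ j ≤ max (-K) (min a K) ∧ max (-K) (min a K) ≤ e₁ (m + j) := by
  refine ⟨(h.lower_left j hj).le fun q hq hS => (slo_le_iff hS).2 (ha q hq),
    (h.lower_right j hj).le h.pos fun q hq hS => ?_⟩
  rw [slo_comm]
  exact (le_slo_iff hS).2 (ha q hq)

theorem IsEnds.le_of_above (h : IsEnds b m X Y K e₁ e₂) {j : ℕ} (hj : j < m) {a : ℝ}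
    (ha : Above b X Y a (b + j)) :
    e₂ j ≤ max (-K) (min a K) ∧ max (-K) (min a K) ≤ e₂ (m + j) := by
  refine ⟨(h.upper_left j hj).le fun q hq hS => ?_,
    (h.upper_right j hj).le h.pos fun q hq hS => (le_slo_iff hS).2 (ha q hq)⟩
  rw [slo_comm]
  exact (slo_le_iff hS).2 (ha q hq)

/-- The intervals that contain a given number are all active at some position: at the first one with
a right endpoint that is not smaller, or a left endpoint that is larger than the number. -/
theorem Sorted.exists_active {v : ℕ → ℝ} {ord pos : ℕ → ℕ} (h : Sorted v (2 * m) ord pos) (a : ℝ) :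
    ∃ k ≤ 2 * m, ∀ j < m, v j ≤ a → a ≤ v (m + j) → Active pos m k j := by
  classical
  have hex : ∃ k, k = 2 * m ∨ ¬ (ord k < m ∧ v (ord k) ≤ a ∨ m ≤ ord k ∧ v (ord k) < a) :=
    ⟨2 * m, .inl rfl⟩
  have hk := Nat.find_spec hex
  have hmin := fun k => Nat.find_min (m := k) hex
  have hle : Nat.find hex ≤ 2 * m := Nat.find_min' hex (.inl rfl)
  generalize Nat.find hex = k at hk hmin hle
  refine ⟨k, hle, fun j hj h1 h2 => ⟨?_, ?_⟩⟩
  · by_contra hjk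
    have hp := h.pos_lt j (by omega)
    rcases hk with rfl | hk
    · omega
    refine hk ?_
    rcases (not_lt.1 hjk).eq_or_lt with h3 | h3
    · exact .inl (by rw [h3, h.ord_pos j (by omega)]; exact ⟨hj, h1⟩)
    · have hb := h.before k (pos j) h3 hp
      rw [h.ord_pos j (by omega)] at hb
      rcases hb with hb | ⟨hb, hb'⟩
      · rcases Nat.lt_or_ge (ord k) m with h4 | h4
        · exact .inl ⟨h4, hb.le.trans h1⟩
        · exact .inr ⟨h4, hb.trans_le h1⟩
      · exact .inl ⟨hb'.trans hj, hb.le.trans h1⟩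
  · by_contra hjk
    have := hmin _ (not_le.1 hjk)
    rw [h.ord_pos (m + j) (by omega)] at this
    refine this (.inr ?_)
    rintro (⟨h3, -⟩ | ⟨-, h3⟩)
    · omega
    · exact absurd h2 (not_le.2 h3)

theorem Sorted.le_of_active {v : ℕ → ℝ} {ord pos : ℕ → ℕ} (h : Sorted v (2 * m) ord pos)
    {k j j' : ℕ} (hj : j < m) (hj' : j' < m) (h1 : Active pos m k j) (h2 : Active pos m k j') :
    v j ≤ v (m + j') := by
  have hb := h.before (pos j) (pos (m + j')) (h1.1.trans_le h2.2) (h.pos_lt _ (by omega))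
  rw [h.ord_pos j (by omega), h.ord_pos (m + j') (by omega)] at hb
  rcases hb with hb | ⟨hb, -⟩
  exacts [hb.le, hb.le]

theorem ind_mono {p q : Prop} (h : p → q) : ind p ≤ ind q := by
  by_cases hp : p
  · simp [hp, h hp]
  · by_cases hq : q <;> simp [hp, hq]

variable {a₁ c₁ a₂ c₂ lo hi : ℝ} {ord₁ pos₁ ord₂ pos₂ : ℕ → ℕ} {k a : ℕ}

theorem IsChoice.le_hi (h : IsChoice b m X Y a₁ c₁ a₂ c₂ K lo hi e₁ e₂ ord₁ pos₁ ord₂ pos₂ k a)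
    {j : ℕ} (hj : j < m) (hA : Active pos₂ m a j) : e₂ j ≤ hi ∧ hi ≤ e₂ (m + j) := by
  refine ⟨?_, neg_le_neg_iff.1 (h.hi_top.2.2 j hj hA)⟩
  rcases h.hi_top.2.1 with h1 | ⟨j', hj', hA', h1⟩
  · rw [neg_inj.1 h1]; exact ((h.ends.upper_left j hj).lt_bound h.ends.pos).le
  · rw [neg_inj.1 h1]; exact h.sorted₂.le_of_active hj hj' hA hA'

theorem IsChoice.lo_le (h : IsChoice b m X Y a₁ c₁ a₂ c₂ K lo hi e₁ e₂ ord₁ pos₁ ord₂ pos₂ k a)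
    {j : ℕ} (hj : j < m) (hA : Active pos₂ m a j) : e₂ j ≤ lo ∧ lo ≤ e₂ (m + j) := by
  refine ⟨h.lo_top.2.2 j hj hA, ?_⟩
  rcases h.lo_top.2.1 with rfl | ⟨j', hj', hA', rfl⟩
  · exact ((h.ends.upper_right j hj).bound_lt h.ends.pos).le
  · exact h.sorted₂.le_of_active hj' hj hA' hA

theorem IsChoice.le_slope₁ (h : IsChoice b m X Y a₁ c₁ a₂ c₂ K lo hi e₁ e₂ ord₁ pos₁ ord₂ pos₂ k a)
    {j : ℕ} (hj : j < m) (hA : Active pos₁ m k j) : e₁ j ≤ a₁ ∧ a₁ ≤ e₁ (m + j) := by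
  refine ⟨h.top₁.2.2 j hj hA, ?_⟩
  rcases h.top₁.2.1 with rfl | ⟨j', hj', hA', rfl⟩
  · exact ((h.ends.lower_right j hj).bound_lt h.ends.pos).le
  · exact h.sorted₁.le_of_active hj' hj hA' hA

/-- The chosen slopes exclude the largest number of red points. -/
theorem IsChoice.sum_le (h : IsChoice b m X Y a₁ c₁ a₂ c₂ K lo hi e₁ e₂ ord₁ pos₁ ord₂ pos₂ k a)
    (hx : ∀ q < b, ∀ j < m, X q ≠ X (b + j)) (a₁' a₂' : ℝ) :
    ∑ j ∈ Finset.range m, ind (Below b X Y a₁' (b + j) ∨ Above b X Y a₂' (b + j)) ≤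
      ∑ j ∈ Finset.range m, ind (Below b X Y a₁ (b + j) ∨ Above b X Y a₂ (b + j)) := by
  obtain ⟨k', hk', h1⟩ := h.sorted₁.exists_active (max (-K) (min a₁' K))
  obtain ⟨a', ha', h2⟩ := h.sorted₂.exists_active (max (-K) (min a₂' K))
  refine le_trans (Finset.sum_le_sum fun j hj => ind_mono ?_) ((h.optimal k' hk' a' ha').trans
    (Finset.sum_le_sum fun j hj => ind_mono ?_)) <;> rw [Finset.mem_range] at hj
  · rintro (h3 | h3)
    · exact .inl (h1 j hj (h.ends.le_of_below hj h3).1 (h.ends.le_of_below hj h3).2)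
    · exact .inr (h2 j hj (h.ends.le_of_above hj h3).1 (h.ends.le_of_above hj h3).2)
  · rintro (h3 | h3)
    · exact .inl (h.ends.below hx hj (h.le_slope₁ hj h3).1 (h.le_slope₁ hj h3).2)
    · refine .inr (h.ends.above hx hj ?_ ?_) <;> rcases h.slope₂ with ⟨-, rfl⟩ | ⟨-, rfl⟩
      exacts [(h.le_hi hj h3).1, (h.lo_le hj h3).1, (h.le_hi hj h3).2, (h.lo_le hj h3).2]

/-- In general position, the intersection of the active intervals of slopes of the upper line is not
a single slope: at this slope, a line would pass through two blue points and one red point or two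
red points and one blue point. -/
theorem IsChoice.lo_lt_hi
    (h : IsChoice b m X Y a₁ c₁ a₂ c₂ K lo hi e₁ e₂ ord₁ pos₁ ord₂ pos₂ k a)
    (hx : ∀ q < b, ∀ j < m, X q ≠ X (b + j))
    (hgp : ∀ p < b + m, ∀ q < b + m, ∀ r < b + m, p ≠ q → q ≠ r → p ≠ r → ∀ a,
      Y p - a * X p = Y q - a * X q → Y q - a * X q ≠ Y r - a * X r) : lo < hi := by
  have hK := h.ends.pos
  rcases h.lo_top.2.1 with h1 | ⟨j, hj, hA, h1⟩ <;>
    rcases h.hi_top.2.1 with h2 | ⟨j', hj', hA', h2⟩ <;> rw [neg_inj] at h2 <;> rw [h1, h2]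
  · linarith
  · exact (h.ends.upper_right j' hj').bound_lt hK
  · exact (h.ends.upper_left j hj).lt_bound hK
  refine lt_of_le_of_ne (h.sorted₂.le_of_active hj hj' hA hA') fun he => ?_
  have b1 := (h.ends.upper_left j hj).lt_bound hK
  have b2 := (h.ends.upper_right j' hj').bound_lt hK
  obtain ⟨-, q, hq, hS, h3⟩ := (h.ends.upper_left j hj).2.resolve_left fun h' => by
    linarith [h'.1]
  obtain ⟨-, q', hq', hS', h4⟩ := (h.ends.upper_right j' hj').2.resolve_left fun h' => by
    linarith [h'.1]
  have g1 : Above b X Y (e₂ j) (b + j) := h.ends.above hx hj le_rfl (by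
    rw [← h1]; exact (h.lo_le hj hA).2)
  have g2 : Above b X Y (e₂ j) (b + j') := h.ends.above hx hj' (by
    rw [← h1]; exact (h.lo_le hj' hA').1) he.le
  have f1 : Y (b + j) - e₂ j * X (b + j) ≤ Y q - e₂ j * X q :=
    (le_slo_iff hS).1 (by rw [slo_comm]; exact h3.le)
  have f2 : Y (b + j') - e₂ j * X (b + j') ≤ Y q' - e₂ j * X q' :=
    (slo_le_iff hS').1 (by rw [he]; exact h4.ge)
  have p1 := g1 q hq
  have p2 := g1 q' hq'
  have p3 := g2 q hq
  by_cases hjj : j = j'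
  · subst hjj
    exact hgp q (by omega) (b + j) (by omega) q' (by omega) (by omega) (by omega)
      (by rintro rfl; exact lt_asymm hS hS') (e₂ j) (by linarith) (by linarith)
  · exact hgp q (by omega) (b + j) (by omega) (b + j') (by omega) (by omega) (by omega)
      (by omega) (e₂ j) (by linarith) (by linarith)

theorem IsChoice.ne (h : IsChoice b m X Y a₁ c₁ a₂ c₂ K lo hi e₁ e₂ ord₁ pos₁ ord₂ pos₂ k a)
    (hx : ∀ q < b, ∀ j < m, X q ≠ X (b + j))
    (hgp : ∀ p < b + m, ∀ q < b + m, ∀ r < b + m, p ≠ q → q ≠ r → p ≠ r → ∀ a,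
      Y p - a * X p = Y q - a * X q → Y q - a * X q ≠ Y r - a * X r) : a₁ ≠ a₂ := by
  rcases h.slope₂ with ⟨h1, rfl⟩ | ⟨rfl, rfl⟩
  · exact h1
  · exact (h.lo_lt_hi hx hgp).ne'

end Choice

end RealRAM

/-! ### Wedges and their red outliers -/

namespace TwoLines

theorem mem_interior_upper_inter_lower {l u : Line} {p : ℝ × ℝ} :
    p ∈ interior (l.upper ∩ u.lower) ↔
      l.intercept < p.2 - l.slope * p.1 ∧ p.2 - u.slope * p.1 < u.intercept := by
  have hf (c : ℝ) : IsOpenMap (ContinuousLinearMap.snd ℝ ℝ ℝ - c • ContinuousLinearMap.fst ℝ ℝ ℝ) :=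
    ContinuousLinearMap.isOpenMap _ fun y => ⟨(0, y), by simp⟩
  have h1 : l.upper = (ContinuousLinearMap.snd ℝ ℝ ℝ - l.slope • ContinuousLinearMap.fst ℝ ℝ ℝ) ⁻¹'
      Set.Ici l.intercept := by
    ext p; simp [Line.upper, le_sub_iff_add_le']
  have h2 : u.lower = (ContinuousLinearMap.snd ℝ ℝ ℝ - u.slope • ContinuousLinearMap.fst ℝ ℝ ℝ) ⁻¹'
      Set.Iic u.intercept := by
    ext p; simp [Line.lower, add_comm]
  rw [interior_inter, h1, h2,
    ← (hf _).preimage_interior_eq_interior_preimage (ContinuousLinearMap.continuous _),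
    ← (hf _).preimage_interior_eq_interior_preimage (ContinuousLinearMap.continuous _),
    interior_Ici, interior_Iic]
  simp

/-- Wedges and strips alike are the points above one line and below another. -/
theorem IsSideways.eq_inter {W : Set (ℝ × ℝ)} (h : IsSideways W) :
    ∃ l u : Line, W = l.upper ∩ u.lower := by
  rcases h with ⟨l₁, l₂, ⟨-, h | h⟩ | ⟨-, -, h⟩⟩
  exacts [⟨l₁, l₂, h⟩, ⟨l₂, l₁, by rw [h, West, Set.inter_comm]⟩, ⟨l₁, l₂, h⟩]

theorem slope_lt_and_outRegion_eq {s : RealRAM.State} {a₁ c₁ a₂ c₂ : ℝ}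
    (h : RealRAM.IsOutput s a₁ c₁ a₂ c₂) : (outLine₁ s).slope < (outLine₂ s).slope ∧
      outRegion s = Line.upper ⟨a₁, c₁⟩ ∩ Line.lower ⟨a₂, c₂⟩ := by
  rcases h with ⟨h1, h2, h3, h4⟩ | ⟨h1, h2, h3, h4⟩
  · exact ⟨by rw [h3, h4]; exact h1, by rw [outRegion, if_pos h2, h3, h4, East]⟩
  · refine ⟨by rw [h3, h4]; exact h1, ?_⟩
    rw [outRegion, if_neg (by omega), h3, h4, West, Set.inter_comm]

theorem redOutliers_range {r : ℕ} {R : Fin r → ℝ × ℝ} (hR : Function.Injective R)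
    (W : Set (ℝ × ℝ)) :
    (redOutliers (Set.range R) W : ℝ) = ∑ j : Fin r, RealRAM.ind (R j ∈ interior W) := by
  classical
  rw [redOutliers, ← Set.image_preimage_eq_range_inter, Set.ncard_image_of_injective _ hR,
    Set.ncard_eq_toFinset_card']
  simp only [RealRAM.ind, Finset.sum_boole]
  congr 2
  ext j
  simp

theorem GeneralPosition.not_line {ι : Type*} {P : ι → ℝ × ℝ} (h : GeneralPosition P) {i j k : ι}
    (hij : i ≠ j) (hjk : j ≠ k) (hik : i ≠ k) (a : ℝ)
    (h1 : (P i).2 - a * (P i).1 = (P j).2 - a * (P j).1) :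
    (P j).2 - a * (P j).1 ≠ (P k).2 - a * (P k).1 := by
  intro h2
  refine h.2 i j k hij hjk hik ((collinear_iff_of_mem (p₀ := P i) (by simp)).2 ⟨(1, a), ?_⟩)
  intro p hp
  refine ⟨p.1 - (P i).1, Prod.ext (by simp) ?_⟩
  simp only [Set.mem_insert_iff, Set.mem_singleton_iff] at hp
  simp only [vadd_eq_add, Prod.snd_add, Prod.smul_snd, smul_eq_mul]
  rcases hp with rfl | rfl | rfl <;> linarith

section Input

variable {b r : ℕ} {B : Fin b → ℝ × ℝ} {R : Fin r → ℝ × ℝ}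

theorem join_input (f : ℝ × ℝ → ℝ) {p : ℕ} (hp : p < b + r) :
    RealRAM.join b (store fun j => f (B j)) (store fun j => f (R j)) p =
      f (Sum.elim B R (finSumFinEquiv.symm ⟨p, hp⟩)) := by
  rcases Nat.lt_or_ge p b with h | h
  · have : (⟨p, hp⟩ : Fin (b + r)) = Fin.castAdd r ⟨p, h⟩ := rfl
    rw [this, finSumFinEquiv_symm_apply_castAdd]
    simp [RealRAM.join, h, store]
  · have : (⟨p, hp⟩ : Fin (b + r)) = Fin.natAdd b ⟨p - b, by omega⟩ := by
      ext; simp; omega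
    rw [this, finSumFinEquiv_symm_apply_natAdd]
    simp [RealRAM.join, not_lt.2 h, store, show p - b < r by omega]

theorem join_blue (f : ℝ × ℝ → ℝ) (q : Fin b) :
    RealRAM.join b (store fun j => f (B j)) (store fun j => f (R j)) q = f (B q) := by
  simp [RealRAM.join, store]

theorem join_red (f : ℝ × ℝ → ℝ) (j : Fin r) :
    RealRAM.join b (store fun j => f (B j)) (store fun j => f (R j)) (b + j) = f (R j) := by
  simp [RealRAM.join, store]

/-- The output is a solution if its slopes and intercepts arise from an optimal choice. -/
theorem isSolution_of_isChoice (hR : Function.Injective R) {s : RealRAM.State}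
    {a₁ c₁ a₂ c₂ K lo hi : ℝ} {e₁ e₂ : ℕ → ℝ} {ord₁ pos₁ ord₂ pos₂ : ℕ → ℕ} {k a : ℕ}
    {X Y : ℕ → ℝ} (hXB : ∀ q : Fin b, X q = (B q).1) (hYB : ∀ q : Fin b, Y q = (B q).2)
    (hXR : ∀ j : Fin r, X (b + j) = (R j).1) (hYR : ∀ j : Fin r, Y (b + j) = (R j).2)
    (hx : ∀ q < b, ∀ j < r, X q ≠ X (b + j))
    (h : RealRAM.IsChoice b r X Y a₁ c₁ a₂ c₂ K lo hi e₁ e₂ ord₁ pos₁ ord₂ pos₂ k a)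
    (ho : RealRAM.IsOutput s a₁ c₁ a₂ c₂) : IsSolution (Set.range B) (Set.range R) s := by
  obtain ⟨h1, h2⟩ := slope_lt_and_outRegion_eq ho
  refine ⟨h1, ?_, fun W hW hBW => ?_⟩
  · rw [h2]
    rintro _ ⟨q, rfl⟩
    have g1 := h.touch₁.2 q q.2
    have g2 := h.touch₂.2 q q.2
    rw [hXB, hYB] at g1 g2
    constructor
    · simp only [Line.upper, Set.mem_ofPred_eq]; linarith
    · simp only [Line.lower, Set.mem_ofPred_eq]; linarith
  obtain ⟨l, u, rfl⟩ := hW.eq_inter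
  have hsum := h.sum_le hx l.slope u.slope
  rw [Finset.sum_range, Finset.sum_range] at hsum
  have hnot (p : Prop) : RealRAM.ind p = 1 - RealRAM.ind (¬ p) := by
    by_cases hp : p <;> simp [hp]
  simp only [hnot (_ ∨ _), Finset.sum_sub_distrib, sub_le_sub_iff_left] at hsum
  rw [← Nat.cast_le (α := ℝ), redOutliers_range hR, redOutliers_range hR]
  refine (Finset.sum_le_sum fun j _ => RealRAM.ind_mono fun hj => ?_).trans
    (hsum.trans (Finset.sum_le_sum fun j _ => RealRAM.ind_mono fun hj => ?_))
  · rw [h2, mem_interior_upper_inter_lower, ← hXR, ← hYR] at hj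
    obtain ⟨⟨q, hq, g1⟩, -⟩ := h.touch₁
    obtain ⟨⟨q', hq', g2⟩, -⟩ := h.touch₂
    rintro (h3 | h3)
    · have := h3 q hq; simp only at hj; linarith [hj.1]
    · have := h3 q' hq'; simp only at hj; linarith [hj.2]
  · simp only [RealRAM.Below, RealRAM.Above, not_or, not_forall, not_le] at hj
    obtain ⟨⟨q, hq, g1⟩, q', hq', g2⟩ := hj
    rw [mem_interior_upper_inter_lower, ← hXR, ← hYR]
    have f1 := (hBW ⟨⟨q, hq⟩, rfl⟩).1
    have f2 := (hBW ⟨⟨q', hq'⟩, rfl⟩).2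
    simp only [Line.upper, Line.lower, Set.mem_ofPred_eq, ← hXB, ← hYB] at f1 f2
    constructor <;> linarith

theorem isSolution_of_forall_le (hb : b = 0) {s : RealRAM.State} {c₁ : ℝ}
    (ho : RealRAM.IsOutput s 0 c₁ 1 0) (hc : ∀ j, (R j).2 ≤ c₁) :
    IsSolution (Set.range B) (Set.range R) s := by
  subst hb
  obtain ⟨h1, h2⟩ := slope_lt_and_outRegion_eq ho
  refine ⟨h1, by rintro _ ⟨q, -⟩; exact q.elim0, fun W _ _ => ?_⟩
  have : Set.range R ∩ interior (outRegion s) = ∅ := by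
    rw [h2, Set.eq_empty_iff_forall_notMem]
    rintro _ ⟨⟨j, rfl⟩, hj⟩
    have g1 := (mem_interior_upper_inter_lower.1 hj).1
    simp only [zero_mul, sub_zero] at g1
    exact absurd (hc j) (not_le.2 g1)
  rw [redOutliers, this, Set.ncard_empty]
  exact Nat.zero_le _

end Input

end TwoLines

theorem Nat.size_sixteen_mul_le {n : ℕ} (hn : 2 ≤ n) :
    (Nat.size (16 * n) : ℝ) ≤ 12 * Real.log n := by
  have hL : 0 < Nat.size (16 * n) := Nat.size_pos.2 (by omega)
  obtain ⟨l, hl⟩ : ∃ l, Nat.size (16 * n) = l + 1 := ⟨Nat.size (16 * n) - 1, by omega⟩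
  have h1 : 2 ^ l ≤ 16 * n := Nat.lt_size.1 (by omega)
  have h2 : (2 : ℝ) ^ l ≤ 2 ^ 4 * n := by
    have : (2 ^ l : ℝ) ≤ 16 * n := by exact_mod_cast h1
    norm_num; linarith
  have hn0 : (2 : ℝ) ≤ n := by exact_mod_cast hn
  have h3 := Real.log_le_log (by positivity) h2
  rw [Real.log_mul (by positivity) (by positivity), Real.log_pow, Real.log_pow] at h3
  have h4 := Real.log_le_log (by norm_num) hn0
  have h5 : (1 / 2 : ℝ) < Real.log 2 := by linarith [Real.log_two_gt_d9]
  rw [hl]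
  push_cast at h3 ⊢
  nlinarith

/-- One real RAM program computes, for all sets `B` and `R` of at most `n` points in general
position, given as arrays in any order, an optimal East or West wedge in `O(n log n)` time, with
words of `O(log n)` bits. -/
theorem mainTheorem1 :
    ∃ (p : RealRAM.Prog) (c : ℕ) (C : ℝ),
      ∀ (n b r : ℕ) (B : Fin b → ℝ × ℝ) (R : Fin r → ℝ × ℝ),
        2 ≤ n → b ≤ n → r ≤ n → TwoLines.GeneralPosition (Sum.elim B R) →
        ∃ (t : ℕ) (s : RealRAM.State),
          RealRAM.Runs (n ^ c) p (TwoLines.input B R) t s ∧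
          (t : ℝ) ≤ C * (n * Real.log n) ∧
          TwoLines.IsSolution (Set.range B) (Set.range R) s := by
  refine ⟨RealRAM.twoLines, 7, 1000000, fun n b r B R hn hb hr hgp => ?_⟩
  have hM : 16 * n + 20 < n ^ 7 := by
    have : 2 ^ 6 ≤ n ^ 6 := Nat.pow_le_pow_left hn 6
    have : n * 2 ^ 6 ≤ n * n ^ 6 := Nat.mul_le_mul_left n this
    rw [pow_succ']; omega
  have hL : 1 ≤ Nat.size (16 * n) := Nat.size_pos.2 (by omega)
  have h0 : n ≤ n * Nat.size (16 * n) := Nat.le_mul_of_pos_right _ hL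
  suffices H : RealRAM.WP (n ^ 7) RealRAM.twoLines (TwoLines.input B R) fun t s =>
      t ≤ 61000 * (n * Nat.size (16 * n)) ∧ TwoLines.IsSolution (Set.range B) (Set.range R) s by
    obtain ⟨t, s, hrun, ht, hs⟩ := H
    refine ⟨t, s, hrun, ?_, hs⟩
    have h1 : (t : ℝ) ≤ 61000 * (n * Nat.size (16 * n)) := by exact_mod_cast ht
    have h2 : (n : ℝ) * Nat.size (16 * n) ≤ n * (12 * Real.log n) :=
      mul_le_mul_of_nonneg_left (Nat.size_sixteen_mul_le hn) (Nat.cast_nonneg n)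
    have h3 : 0 ≤ (n : ℝ) * Real.log n := by positivity
    linarith
  have hR : Function.Injective R := fun i j hij => 
    Sum.inr_injective (hgp.1 (a₁ := .inr i) (a₂ := .inr j) (by simp [hij]))
  obtain ⟨X, hX⟩ : ∃ X, RealRAM.join b ((TwoLines.input B R).real 0)
    ((TwoLines.input B R).real 2) = X := ⟨_, rfl⟩
  obtain ⟨Y, hY⟩ : ∃ Y, RealRAM.join b ((TwoLines.input B R).real 1)
    ((TwoLines.input B R).real 3) = Y := ⟨_, rfl⟩
  have hXp {p : ℕ} (hp : p < b + r) :
      X p = (Sum.elim B R (finSumFinEquiv.symm ⟨p, hp⟩)).1 := by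
    rw [← hX]; exact TwoLines.join_input Prod.fst hp
  have hYp {p : ℕ} (hp : p < b + r) :
      Y p = (Sum.elim B R (finSumFinEquiv.symm ⟨p, hp⟩)).2 := by
    rw [← hY]; exact TwoLines.join_input Prod.snd hp
  have hxi : ∀ i < b + r, ∀ j < b + r, X i = X j → i = j := by
    intro i hi j hj hij
    rw [hXp hi, hXp hj] at hij
    simpa using finSumFinEquiv.symm.injective (hgp.1 hij)
  have hx : ∀ q < b, ∀ j < r, X q ≠ X (b + j) := by
    intro q hq j hj hqj
    have := hxi q (by omega) (b + j) (by omega) hqj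
    omega
  have hline : ∀ p < b + r, ∀ q < b + r, ∀ z < b + r, p ≠ q → q ≠ z → p ≠ z → ∀ a,
      Y p - a * X p = Y q - a * X q → Y q - a * X q ≠ Y z - a * X z := by
    intro p hp q hq z hz h1 h2 h3 a
    rw [hXp hp, hXp hq, hXp hz, hYp hp, hYp hq, hYp hz]
    exact hgp.not_line (by simpa using h1) (by simpa using h2) (by simpa using h3) a
  have hb0 : (TwoLines.input B R).word 0 0 = b := by simp [TwoLines.input]
  have hr0 : (TwoLines.input B R).word 0 1 = r := by simp [TwoLines.input]
  refine .branch (by simp [RealRAM.Test.Safe, RealRAM.WExpr.Safe]; omega) (fun hc => ?_)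
    (fun hc => ?_)
  · have hc0 : 0 < b := by simpa [RealRAM.Test.Holds, RealRAM.WExpr.eval, hb0] using hc
    refine (RealRAM.someBlue_spec hM hb hr hn hb0 hr0 hc0 (by rw [hX]; exact hxi)
      (by rw [hX, hY]; exact fun h => h.ne hx hline)).mono ?_
    rw [hX, hY]
    rintro t s - ⟨ht, a₁, c₁, a₂, c₂, K, lo, hi, e₁, e₂, ord₁, pos₁, ord₂, pos₂, k, a, h, ho⟩
    refine ⟨by simp only [RealRAM.Test.cost, RealRAM.WExpr.cost]; omega, ?_⟩
    refine TwoLines.isSolution_of_isChoice hR (fun q => ?_) (fun q => ?_) (fun j => ?_)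
      (fun j => ?_) hx h ho
    · rw [← hX]; exact TwoLines.join_blue Prod.fst q
    · rw [← hY]; exact TwoLines.join_blue Prod.snd q
    · rw [← hX]; exact TwoLines.join_red Prod.fst j
    · rw [← hY]; exact TwoLines.join_red Prod.snd j
  · have hc0 : b = 0 := by simpa [RealRAM.Test.Holds, RealRAM.WExpr.eval, hb0] using hc
    refine (RealRAM.noBlue_spec hr0 (by omega)).mono ?_
    rintro t s - ⟨ht, c₁, ho, hle⟩
    refine ⟨by simp only [RealRAM.Test.cost, RealRAM.WExpr.cost]; omega, ?_⟩
    refine TwoLines.isSolution_of_forall_le hc0 ho fun j => ?_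
    simpa [TwoLines.input, TwoLines.store] using hle j j.2
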